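/- Let $a,b,d:[0,1]\to\mathbb R$ and $\lambda\in\mathbb R$, and consider the problem $$y_{tt}-a\,y_{xx}-\frac{\lambda}{d}\,y-b\,y_x=0\ \text{ in }(0,\infty)\times(0,1),\qquad y(t,0)=y(t,1)=0,\qquad y(0,\cdot)=y^0,\quad y_t(0,\cdot)=y^1. \tag{P}$$ **Coefficients.** For $g:[0,1]\to\mathbb R$ with $g(0)=0$ and $g>0$ on $(0,1]$ set $K_g:=\sup_{x\in(0,1]}\frac{x|g'(x)|}{g(x)}$. The function $g$ is weakly degenerate (WD) if $g\in C^0[0,1]\cap C^1(0,1]$ and $K_g\in(0,1)$, and strongly degenerate (SD) if $g\in C^1[0,1]$ and $K_g\in[1,2)$. Assume that $b\in C^0[0,1]$, $b/a\in L^1(0,1)$, that each of $a$ and $d$ is (WD) or (SD), and $K_a+2K_d\le 2$. **Spaces.** Let $\eta(x)=\exp\int_{1/2}^x\frac{b(s)}{a(s)}ds$, $\sigma=a/\eta$, $L^2_{1/\sigma}(0,1)=\{u\in L^2(0,1):\int_0^1\frac{u^2}{\sigma}dx<\infty\}$ and $H^1_{1/\sigma}(0,1)=L^2_{1/\sigma}(0,1)\cap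 H^1_0(0,1)$, the latter with $\|u\|^2=\int_0^1\frac{u^2}{\sigma}dx+\int_0^1\eta (u')^2dx$. Let $C_{HP}$ be the best constant in $\int_0^1\frac{u^2}{\sigma d}dx\le C\int_0^1\eta(u')^2dx$ for all $u\in H^1_{1/\sigma}(0,1)$, and assume $\lambda<1/C_{HP}$. Let $A_\lambda u=au''+bu'+\frac{\lambda}{d}u$ with domain $D(A_\lambda)=\{u\in H^1_{1/\sigma}(0,1):A_\lambda u\in L^2_{1/\sigma}(0,1)\}$. **Solutions.** For $(y^0,y^1)\in H^1_{1/\sigma}(0,1)\times L^2_{1/\sigma}(0,1)$ the mild solution of (P) is the function $y\in C([0,\infty);H^1_{1/\sigma}(0,1))\cap C^1([0,\infty);L^2_{1/\sigma}(0,1))$ with $y(0)=y^0$, $y_t(0)=y^1$ such that, for all $t\ge0$, $\int_0^t y(s)\,ds\in D(A_\lambda)$ and $y_t(t)-y^1=A_\lambda\int_0^ty(s)\,ds$. Its normal derivative $y_x(\cdot,1)\in L^2(0,T)$ is the function satisfying $\int_0^t y_x(s,1)\,ds=\partial_x\big(\int_0^ty(s)\,ds\big)(1)$ for $0\le t\le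 T$. Its energy is $E_y(t)=\frac12\int_0^1\big[\frac{y_t^2}{\sigma}+\eta y_x^2-\frac{\lambda}{\sigma d}y^2\big]dx$. **Observability.** Problem (P) is observable in time $T>0$ if there is $C>0$ such that $C\,E_y(0)\le\int_0^Ty_x(t,1)^2dt$ for the mild solution $y$ of all data in $H^1_{1/\sigma}(0,1)\times L^2_{1/\sigma}(0,1)$; $C_T$ denotes the supremum of all such $C$. **Claim.** Suppose that either - $K_a\le1$, and put $m:=M:=\|b\|_{L^\infty(0,1)}/a(1)$; or - $K_a>1$ and $\frac{xb}{a}\in L^\infty(0,1)$, and put $m:=M_\infty:=\big\|\frac{xb}{a}\big\|_{L^\infty(0,1)}$. Assume moreover $\lambda\ge0$ and $K_a+2K_d\le2-2m$. Let $$C_5=4\max\Big\{\frac1{a(1)},1\Big\}+K_a\max\Big\{1,C_{HP}\max_{[0,1]}d\Big\},\qquad C_6=1-\frac{K_a}2-m .$$ Then, for every $T>C_5/C_6$, problem (P) is observable in time $T$ and $$C_T\ \ge\ \frac{C_6T-C_5}{\eta(1)} .$$ -/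

import Mathlib

open MeasureTheory Set Filter Topology

noncomputable section

namespace DegWave

/-- Weak degeneracy constant: the supremum over `(0,1]` of `x |g'(x)| / g(x)`
(one-sided derivative at `x = 1`). -/
def degConst (g : ℝ → ℝ) : ℝ :=
  sSup ((fun x => x * |derivWithin g (Icc 0 1) x| / g x) '' Ioc 0 1)

/-- `g` is weakly degenerate at `0`. -/
def WeaklyDeg (g : ℝ → ℝ) : Prop :=
  ContinuousOn g (Icc 0 1) ∧ ContDiffOn ℝ 1 g (Ioc 0 1) ∧ g 0 = 0 ∧
    (∀ x ∈ Ioc (0 : ℝ) 1, 0 < g x) ∧ 0 < degConst g ∧ degConst g < 1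

/-- `g` is strongly degenerate at `0`. -/
def StronglyDeg (g : ℝ → ℝ) : Prop :=
  ContDiffOn ℝ 1 g (Icc 0 1) ∧ g 0 = 0 ∧
    (∀ x ∈ Ioc (0 : ℝ) 1, 0 < g x) ∧ 1 ≤ degConst g ∧ degConst g < 2

/-- Lebesgue measure on `(0,1)`. -/
def leb : Measure ℝ := volume.restrict (Ioo 0 1)

/-- The coefficients of the equation `y_tt - a y_xx - (lam / d) y - b y_x = 0`. -/
structure Coeffs where
  a : ℝ → ℝ
  b : ℝ → ℝ
  d : ℝ → ℝ
  lam : ℝ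

namespace Coeffs

variable (p : Coeffs)

/-- The weight `η(x) = exp (∫_{1/2}^x b/a)`. -/
def eta (x : ℝ) : ℝ := Real.exp (∫ s in (1 / 2 : ℝ)..x, p.b s / p.a s)

/-- The weight `σ = a / η`. -/
def sigma (x : ℝ) : ℝ := p.a x / p.eta x

/-- The weighted space `L²_{1/σ}(0,1)`. -/
def MemL2 (u : ℝ → ℝ) : Prop :=
  MemLp u 2 leb ∧ Integrable (fun x => u x ^ 2 / p.sigma x) leb

/-- The square of the norm of `L²_{1/σ}(0,1)`. -/
def normL2sq (u : ℝ → ℝ) : ℝ := ∫ x, u x ^ 2 / p.sigma x ∂leb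

/-- The space `H¹_{1/σ}(0,1) = L²_{1/σ}(0,1) ∩ H¹₀(0,1)`; an element of `H¹₀(0,1)` is given by its
absolutely continuous representative on `[0,1]`, whose weak derivative is its a.e. derivative. -/
def MemH1 (u : ℝ → ℝ) : Prop :=
  p.MemL2 u ∧ AbsolutelyContinuousOnInterval u 0 1 ∧ MemLp (deriv u) 2 leb ∧ u 0 = 0 ∧ u 1 = 0

/-- The square of the norm of `H¹_{1/σ}(0,1)`. -/
def normH1sq (u : ℝ → ℝ) : ℝ :=
  p.normL2sq u + ∫ x, p.eta x * deriv u x ^ 2 ∂leb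

/-- The best constant `C_HP` in
`∫₀¹ u² / (σ d) dx ≤ C ∫₀¹ η (u')² dx` for all `u ∈ H¹_{1/σ}(0,1)`. -/
def hardyConst : ℝ :=
  sInf {C : ℝ | 0 < C ∧ ∀ u : ℝ → ℝ, p.MemH1 u →
    ∫⁻ x, ENNReal.ofReal (u x ^ 2 / (p.sigma x * p.d x)) ∂leb ≤
      ENNReal.ofReal C * ∫⁻ x, ENNReal.ofReal (p.eta x * deriv u x ^ 2) ∂leb}

/-- `A_λ u = a u'' + b u' + (λ / d) u`, defined a.e. when `u'` is locally absolutely continuous. -/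
def op (u : ℝ → ℝ) (x : ℝ) : ℝ :=
  p.a x * deriv (deriv u) x + p.b x * deriv u x + p.lam / p.d x * u x

/-- The domain `D(A_λ) = {u ∈ H¹_{1/σ}(0,1) | A_λ u ∈ L²_{1/σ}(0,1)}`. That `A_λ u` is a function
means that `u'` is absolutely continuous on `[δ,1]` for every `δ ∈ (0,1)`. -/
def MemDom (u : ℝ → ℝ) : Prop :=
  p.MemH1 u ∧
    (∀ δ ∈ Ioo (0 : ℝ) 1, AbsolutelyContinuousOnInterval (derivWithin u (Icc 0 1)) δ 1) ∧
    p.MemL2 (p.op u)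

/-- The primitive in time `x ↦ ∫₀ᵗ y(s,x) ds`. -/
def timeInt (y : ℝ → ℝ → ℝ) (t x : ℝ) : ℝ := ∫ s in (0 : ℝ)..t, y s x

/-- `(y, v)` with `v = y_t` is the mild solution on `[0,∞)` with initial data `(y0, y1)`:
`y ∈ C([0,∞); H¹_{1/σ}) ∩ C¹([0,∞); L²_{1/σ})` and `Y = (y, y_t)` is a mild solution of the Cauchy
problem `Y' = 𝒜 Y`, where `𝒜 (u, w) = (w, A_λ u)` on `D(A_λ) × H¹_{1/σ}`, that is
`∫₀ᵗ Y ds ∈ D(𝒜)` and `Y(t) = Y(0) + 𝒜 ∫₀ᵗ Y ds`. The first line of this identity says that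
`y` is the primitive of `y_t`; the second is the last clause below. -/
structure IsMildSolution (y0 y1 : ℝ → ℝ) (y v : ℝ → ℝ → ℝ) : Prop where
  memH1 : ∀ t, 0 ≤ t → p.MemH1 (y t)
  memL2 : ∀ t, 0 ≤ t → p.MemL2 (v t)
  continuousH1 : ∀ t, 0 ≤ t →
    Tendsto (fun s => p.normH1sq (fun x => y s x - y t x)) (𝓝[Ici 0] t) (𝓝 0)
  continuousL2 : ∀ t, 0 ≤ t →
    Tendsto (fun s => p.normL2sq (fun x => v s x - v t x)) (𝓝[Ici 0] t) (𝓝 0)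
  hasDeriv : ∀ t, 0 ≤ t →
    Tendsto (fun s => p.normL2sq (fun x => (y s x - y t x) / (s - t) - v t x))
      (𝓝[Ici 0 \ {t}] t) (𝓝 0)
  init_pos : ∀ x ∈ Icc (0 : ℝ) 1, y 0 x = y0 x
  init_vel : ∀ᵐ x ∂leb, v 0 x = y1 x
  memDom : ∀ t, 0 ≤ t → p.MemDom (timeInt y t)
  equation : ∀ t, 0 ≤ t → ∀ᵐ x ∂leb, v t x - v 0 x = p.op (timeInt y t) x

/-- The energy of a state `(u, w)`, where `u = y(t)` and `w = y_t(t)`. -/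
def energy (u w : ℝ → ℝ) : ℝ :=
  1 / 2 * ∫ x, (w x ^ 2 / p.sigma x + p.eta x * deriv u x ^ 2
    - p.lam / (p.sigma x * p.d x) * u x ^ 2) ∂leb

/-- `h ∈ L²(0,T)` is the normal derivative `t ↦ y_x(t,1)` on `(0,T)` of a mild solution `y`.
The function `∫₀ᵗ y ds` belongs to `D(A_λ)`, so it is `C¹` up to `x = 1`; `y_x(·,1)` is the
density of its normal derivative. It is `y_x(t,1)` itself for classical solutions and the limit in
`L²(0,T)` of the normal derivatives of approximating classical solutions otherwise. -/
def IsNormalDeriv (y : ℝ → ℝ → ℝ) (T : ℝ) (h : ℝ → ℝ) : Prop :=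
  MemLp h 2 (volume.restrict (Ioo 0 T)) ∧
    ∀ t ∈ Icc (0 : ℝ) T, derivWithin (timeInt y t) (Icc 0 1) 1 = ∫ s in (0 : ℝ)..t, h s

/-- `C` is an observability constant in time `T`: `C > 0` and
`C E_y(0) ≤ ∫₀ᵀ y_x(t,1)² dt` for the mild solution `y` of arbitrary initial data in
`H¹_{1/σ}(0,1) × L²_{1/σ}(0,1)`. -/
def IsObsConst (T C : ℝ) : Prop :=
  0 < C ∧ ∀ y0 y1 : ℝ → ℝ, p.MemH1 y0 → p.MemL2 y1 →
    ∀ y v : ℝ → ℝ → ℝ, p.IsMildSolution y0 y1 y v →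
      ∃ h : ℝ → ℝ, IsNormalDeriv y T h ∧
        C * p.energy (y 0) (v 0) ≤ ∫ t in Ioo 0 T, h t ^ 2

/-- Observability in time `T` via the normal derivative at `x = 1`. -/
def Observable (T : ℝ) : Prop := ∃ C, p.IsObsConst T C

/-- `C_T`, the supremum of the observability constants in time `T`. -/
def obsSup (T : ℝ) : EReal := sSup ((fun C : ℝ => (C : EReal)) '' {C | p.IsObsConst T C})

/-- `M = ‖b‖_∞ / a(1)`. -/
def M : ℝ := (eLpNorm p.b ⊤ leb).toReal / p.a 1

/-- `M_∞ = ‖x b / a‖_∞`. -/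
def Minf : ℝ := (eLpNorm (fun x => x * p.b x / p.a x) ⊤ leb).toReal

/-- The standing assumptions: `λ < 1 / C_HP`, `b` is continuous, `b/a ∈ L¹(0,1)`, `a` and `d` are
weakly or strongly degenerate and `K_a + 2 K_d ≤ 2`. -/
structure Standing : Prop where
  lam_lt : p.lam < 1 / p.hardyConst
  cont_b : ContinuousOn p.b (Icc 0 1)
  int_ba : Integrable (fun x => p.b x / p.a x) leb
  deg_a : WeaklyDeg p.a ∨ StronglyDeg p.a
  deg_d : WeaklyDeg p.d ∨ StronglyDeg p.d
  deg_le : degConst p.a + 2 * degConst p.d ≤ 2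

/-- The standing assumptions with `K_a ≤ 1`. -/
def HypLow : Prop := p.Standing ∧ degConst p.a ≤ 1

/-- The standing assumptions with `K_a > 1` and `x b / a ∈ L^∞(0,1)`. -/
def HypHigh : Prop :=
  p.Standing ∧ 1 < degConst p.a ∧ MemLp (fun x => x * p.b x / p.a x) ⊤ leb

/-- `C_5 = 4 max {1/a(1), 1} + K_a max {1, C_HP max_{[0,1]} d}`. -/
def C5 : ℝ :=
  4 * max (1 / p.a 1) 1 + degConst p.a * max 1 (p.hardyConst * sSup (p.d '' Icc 0 1))

/-- `C_6 = 1 - K_a / 2 - m`, with `m = M` or `m = M_∞`. -/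
def C6 (m : ℝ) : ℝ := 1 - degConst p.a / 2 - m

end Coeffs

end DegWave

end

/-!
Write `v = w_t` and `c = K_a / 4`. The proof is a multiplier argument, with multiplier
`x w' - c w` and weight `η / a`. Since `β = x b / a` is the logarithmic derivative of `η` in
`log x`, the product `η (w' - c w / x)` behaves well under differentiation, and
`multiplier_identity` expresses the boundary term `½ η(1) w_x(1)²` as the time derivative of the
momentum `∫ x v (w' - c w / x) / σ` plus quadratic densities in `v / √σ`, `w'` and `w / x`. The
choice of `c` balances the coefficients of the first two, and `K_a + 2 K_d ≤ 2 - 2 m` makes the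
whole density at least `C₆ = 1 - K_a / 2 - m` times that of the energy without potential
(`density_ge`), hence, as `λ ≥ 0`, its integral at least `C₆` times the energy (`energy_le`).
All terms at the degenerate end `0` vanish by Hardy's inequality on `(0,1)`.

Integrated over `(0,T)`, this identity leaves the momentum at the two ends of the time interval.
Rather than estimating it there by the energy, the multiplier is localized by a weight `Θ(t,x)`, a
front entering at `x = 1`, where the observation takes place, and moving to the left:
`Θ` vanishes at time `0` and is `1` after some time `t₁`. The movement of the front creates a flux of
momentum, which has to be dominated by `k` times the flux of energy, for a constant `k`
(`front_flux_nonneg`). The energy density is not positive pointwise, but it becomes manageable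
once the square of `w' - c w / x` is completed (`energy_identity`), which leaves the coefficient
`c (1 - c - β) - Y` of `(w / x)²`, where `Y = λ x² / (a d)`. As `Y` is nondecreasing there is one
switching point: to its left `Y ≤ c²`, the completed density is nonnegative, and the front may move
arbitrarily fast; to its right `Y ≥ c²`, and the front has to move slower than the waves by a
controlled factor (`exists_switch`). The front built in `exists_movingFront` satisfies
`k + C₆ t₁ ≤ 2 / √a(1)`.

On `[0, T/2]` the front gives an inequality whose only remaining momentum is the one at `T/2`
(`half_estimate`). The solution run backwards gives the same inequality on `[T/2, T]` with the
opposite momentum, and the sum is, for classical solutions (`observability_classical`),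
`(C₆ T - 4 / √a(1)) E(0) ≤ ½ η(1) ∫₀ᵀ w_x(t,1)² dt`.
As `4 / √a(1) ≤ C₅` (`le_C5`), this is stronger than what is claimed, by a factor `2` and by the
part of `C₅` that contains the Hardy constant.

For a mild solution `y`, the means of `y` over time intervals of length `ε` are classical solutions
(`classicalSolution_average`), because `∫₀ᵗ y` takes values in the domain of the generator. They
converge to `y` in the energy norm, uniformly in time. The direct inequality `exists_direct`, which is
the multiplier identity with `Θ = 1`, bounds the normal derivative in `L²(0,T)` by the energy norm,
so the normal derivatives of the means form a Cauchy sequence. Its limit is the normal derivative of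
`y`, and the estimate passes to the limit (`exists_normalDeriv`).
-/


noncomputable section

namespace DegWave

/-! ### Absolutely continuous functions on `(0,1]` -/

theorem absolutelyContinuousOnInterval_congr {f g : ℝ → ℝ} {a b : ℝ}
    (hf : AbsolutelyContinuousOnInterval f a b) (h : EqOn f g (uIcc a b)) :
    AbsolutelyContinuousOnInterval g a b := by
  rw [absolutelyContinuousOnInterval_iff] at hf ⊢
  intro ε hε
  obtain ⟨δ, hδ, H⟩ := hf ε hε
  refine ⟨δ, hδ, fun E hE hl => ?_⟩
  have := H E hE hl
  rwa [Finset.sum_congr rfl fun i hi => ?_] at this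
  rw [h (hE.1 i hi).1, h (hE.1 i hi).2]

theorem ae_leb_mem : ∀ᵐ x ∂leb, x ∈ Ioo (0 : ℝ) 1 :=
  ae_restrict_mem measurableSet_Ioo

theorem integral_leb_eq (f : ℝ → ℝ) : ∫ x, f x ∂leb = ∫ x in (0 : ℝ)..1, f x := by
  rw [intervalIntegral.integral_of_le zero_le_one, leb, integral_Ioc_eq_integral_Ioo]

theorem integrable_leb_iff {f : ℝ → ℝ} :
    Integrable f leb ↔ IntervalIntegrable f volume 0 1 := by
  rw [intervalIntegrable_iff_integrableOn_Ioo_of_le zero_le_one]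
  rfl

instance : IsFiniteMeasure leb := by
  unfold leb; infer_instance

theorem intervalIntegrable_of_leb {f : ℝ → ℝ} (hf : Integrable f leb) {x y : ℝ}
    (hx : x ∈ Icc (0 : ℝ) 1) (hy : y ∈ Icc (0 : ℝ) 1) : IntervalIntegrable f volume x y := by
  refine (integrable_leb_iff.1 hf).mono_set ?_
  rw [uIcc_of_le zero_le_one]
  exact uIcc_subset_Icc hx hy

theorem tendsto_integral_leb {f : ℝ → ℝ} (hf : Integrable f leb) :
    Tendsto (fun δ => ∫ x in δ..1, f x) (𝓝[>] 0) (𝓝 (∫ x, f x ∂leb)) := by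
  have h1 : ContinuousOn (fun δ => ∫ x in (1 : ℝ)..δ, f x) (uIcc 0 1) :=
    intervalIntegral.continuousOn_primitive_interval'
      (integrable_leb_iff.1 hf) (by simp)
  have h2 := (h1 0 (by simp)).tendsto
  have h3 : 𝓝[>] (0 : ℝ) ≤ 𝓝[uIcc (0 : ℝ) 1] 0 := by
    rw [uIcc_of_le zero_le_one, ← nhdsWithin_Ioc_eq_nhdsGT (zero_lt_one (α := ℝ))]
    exact nhdsWithin_mono _ Ioc_subset_Icc_self
  have h4 := (h2.mono_left h3).neg
  rw [integral_leb_eq]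
  simpa [← intervalIntegral.integral_symm] using h4

/-- The fundamental theorem of calculus on `(0,1]` for a function which is absolutely continuous
away from `0`, has an integrable derivative, and is small at points arbitrarily close to `0`. -/
theorem integral_leb_of_hasDerivAt {G g : ℝ → ℝ}
    (hG : ∀ δ ∈ Ioo (0 : ℝ) 1, AbsolutelyContinuousOnInterval G δ 1) (hg : Integrable g leb)
    (hd : ∀ᵐ x ∂leb, HasDerivAt G (g x) x)
    (h0 : ∀ ε > 0, ∃ᶠ x in 𝓝[>] (0 : ℝ), |G x| ≤ ε) : ∫ x, g x ∂leb = G 1 := by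
  have key : ∀ δ ∈ Ioo (0 : ℝ) 1, ∫ x in δ..1, g x = G 1 - G δ := by
    intro δ hδ
    rw [← (hG δ hδ).integral_deriv_eq_sub]
    refine intervalIntegral.integral_congr_ae ?_
    rw [leb, ae_restrict_iff' measurableSet_Ioo] at hd
    have h1 : ∀ᵐ x : ℝ, x ≠ 1 := by simp [ae_iff]
    filter_upwards [hd, h1] with x hx hx1 hm
    rw [uIoc_of_le hδ.2.le] at hm
    exact (hx ⟨hδ.1.trans hm.1, lt_of_le_of_ne hm.2 hx1⟩).deriv.symm
  by_contra hne
  have hpos : 0 < |∫ x, g x ∂leb - G 1| := abs_pos.2 (sub_ne_zero.2 hne)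
  set ε := |∫ x, g x ∂leb - G 1| / 3 with hε
  have hε0 : 0 < ε := by positivity
  have h1 := (tendsto_integral_leb hg).eventually (Metric.ball_mem_nhds _ hε0)
  have h2 : ∀ᶠ δ in 𝓝[>] (0 : ℝ), δ ∈ Ioo (0 : ℝ) 1 := Ioo_mem_nhdsGT zero_lt_one
  obtain ⟨x, hx, hx1, hx2⟩ := ((h0 ε hε0).and_eventually (h1.and h2)).exists
  rw [Real.dist_eq, key x hx2] at hx1
  have : |∫ x, g x ∂leb - G 1| ≤ |G x| + |G 1 - G x - ∫ x, g x ∂leb| := by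
    rw [abs_sub_comm (∫ x, g x ∂leb)]
    calc |G 1 - ∫ x, g x ∂leb| = |G x + (G 1 - G x - ∫ x, g x ∂leb)| := by ring_nf
      _ ≤ _ := abs_add_le _ _
  linarith

/-- If `φ²` is integrable, then `x φ(x)²` is small at points arbitrarily close to `0`. -/
theorem frequently_mul_sq_le {φ : ℝ → ℝ} (hφ : Integrable (fun x => φ x ^ 2) leb) {ε : ℝ}
    (hε : 0 < ε) : ∃ᶠ x in 𝓝[>] (0 : ℝ), x * φ x ^ 2 ≤ ε := by
  intro hev
  obtain ⟨u, hu, hsub⟩ := mem_nhdsGT_iff_exists_Ioo_subset.1 hev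
  have hu0 : (0 : ℝ) < u := hu
  set r := min u 1 with hr
  have hr0 : 0 < r := lt_min hu0 one_pos
  have h1 : IntegrableOn (fun x => φ x ^ 2) (Ioo 0 r) :=
    IntegrableOn.mono_set (t := Ioo 0 1) hφ (Ioo_subset_Ioo_right (min_le_right _ _))
  have h2 : IntegrableOn (fun x : ℝ => x⁻¹) (Ioo 0 r) := by
    refine Integrable.mono' (h1.const_mul ε⁻¹) (by fun_prop) ?_
    refine (ae_restrict_mem measurableSet_Ioo).mono fun x hx => ?_
    have h3 : ¬ x * φ x ^ 2 ≤ ε := hsub ⟨hx.1, hx.2.trans_le (min_le_left _ _)⟩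
    rw [Real.norm_of_nonneg (inv_nonneg.2 hx.1.le)]
    have hx0 : 0 < x := hx.1
    rw [← mul_le_mul_iff_right₀ hε, ← mul_assoc, mul_inv_cancel₀ hε.ne', one_mul,
      ← div_eq_mul_inv, div_le_iff₀ hx0]
    nlinarith
  rw [← intervalIntegrable_iff_integrableOn_Ioo_of_le hr0.le, intervalIntegrable_inv_iff] at h2
  rcases h2 with h2 | h2
  · exact hr0.ne h2
  · exact h2 (by simp [hr0.le])

/-! ### Functions vanishing at the degenerate end -/

/-- The part of the definition of `H¹₀(0,1)` that concerns the end `0`. -/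
structure IsH1Left (u : ℝ → ℝ) : Prop where
  ac : AbsolutelyContinuousOnInterval u 0 1
  memLp : MemLp (deriv u) 2 leb
  zero : u 0 = 0

theorem IsH1Left.eq_integral {u : ℝ → ℝ} (hu : IsH1Left u) {x : ℝ} (hx : x ∈ Icc (0 : ℝ) 1) :
    u x = ∫ s in (0 : ℝ)..x, deriv u s := by
  have h : AbsolutelyContinuousOnInterval u 0 x := by
    refine hu.ac.mono ?_
    rw [uIcc_of_le zero_le_one]
    exact uIcc_subset_Icc (by simp) hx
  rw [h.integral_deriv_eq_sub, hu.zero, sub_zero]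

theorem IsH1Left.sq_le {u : ℝ → ℝ} (hu : IsH1Left u) {x : ℝ} (hx : x ∈ Icc (0 : ℝ) 1) :
    u x ^ 2 ≤ x * ∫ s in (0 : ℝ)..x, deriv u s ^ 2 := by
  have hi1 : IntervalIntegrable (deriv u) volume 0 x :=
    intervalIntegrable_of_leb (hu.memLp.integrable one_le_two) (by simp) hx
  have hi2 : IntervalIntegrable (fun s => deriv u s ^ 2) volume 0 x :=
    intervalIntegrable_of_leb hu.memLp.integrable_sq (by simp) hx
  rcases hx.1.eq_or_lt with h0 | h0
  · simp [← h0, hu.zero]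
  set c := u x / x with hc
  have h1 : 0 ≤ ∫ s in (0 : ℝ)..x, (deriv u s - c) ^ 2 :=
    intervalIntegral.integral_nonneg hx.1 fun s _ => sq_nonneg _
  have h2 : ∫ s in (0 : ℝ)..x, (deriv u s - c) ^ 2
      = (∫ s in (0 : ℝ)..x, deriv u s ^ 2) - 2 * c * u x + c ^ 2 * x := by
    rw [hu.eq_integral hx, ← intervalIntegral.integral_const_mul,
      ← intervalIntegral.integral_sub hi2 (hi1.const_mul _)]
    have : c ^ 2 * x = ∫ s in (0 : ℝ)..x, c ^ 2 := by simp [mul_comm]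
    rw [this, ← intervalIntegral.integral_add (hi2.sub (hi1.const_mul _)) (by simp)]
    congr 1
    ext s
    ring
  rw [h2] at h1
  have h3 : 2 * c * u x - c ^ 2 * x = u x ^ 2 / x := by
    rw [hc]; field_simp; ring
  have h4 : u x ^ 2 / x ≤ ∫ s in (0 : ℝ)..x, deriv u s ^ 2 := by linarith
  rw [div_le_iff₀ h0] at h4
  linarith

theorem IsH1Left.sq_le' {u : ℝ → ℝ} (hu : IsH1Left u) {x : ℝ} (hx : x ∈ Icc (0 : ℝ) 1) :
    u x ^ 2 ≤ x * ∫ s, deriv u s ^ 2 ∂leb := by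
  refine (hu.sq_le hx).trans (mul_le_mul_of_nonneg_left ?_ hx.1)
  rw [integral_leb_eq]
  refine intervalIntegral.integral_mono_interval le_rfl hx.1 hx.2
    (ae_of_all _ fun s => sq_nonneg _) (integrable_leb_iff.1 hu.memLp.integrable_sq)

theorem IsH1Left.tendsto_sq_div {u : ℝ → ℝ} (hu : IsH1Left u) :
    Tendsto (fun x => u x ^ 2 / x) (𝓝[>] 0) (𝓝 0) := by
  have h1 : ContinuousOn (fun x => ∫ s in (0 : ℝ)..x, deriv u s ^ 2) (uIcc 0 1) :=
    intervalIntegral.continuousOn_primitive_interval'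
      (integrable_leb_iff.1 hu.memLp.integrable_sq) (by simp)
  have h2 := (h1 0 (by simp)).tendsto
  have h3 : 𝓝[>] (0 : ℝ) ≤ 𝓝[uIcc (0 : ℝ) 1] 0 := by
    rw [uIcc_of_le zero_le_one, ← nhdsWithin_Ioc_eq_nhdsGT (zero_lt_one (α := ℝ))]
    exact nhdsWithin_mono _ Ioc_subset_Icc_self
  have h4 := h2.mono_left h3
  simp only [intervalIntegral.integral_same] at h4
  refine squeeze_zero' ?_ ?_ h4
  · filter_upwards [self_mem_nhdsWithin] with x hx
    exact div_nonneg (sq_nonneg _) (le_of_lt hx)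
  · filter_upwards [Ioo_mem_nhdsGT (zero_lt_one (α := ℝ))] with x hx
    rw [div_le_iff₀ hx.1, mul_comm]
    exact hu.sq_le ⟨hx.1.le, hx.2.le⟩

theorem absolutelyContinuousOnInterval_of_contDiffOn {ρ : ℝ → ℝ} {δ : ℝ} (hδ : δ ≤ 1)
    (h : ContDiffOn ℝ 1 ρ (Icc δ 1)) : AbsolutelyContinuousOnInterval ρ δ 1 :=
  ContDiffOn.absolutelyContinuousOnInterval (by rwa [uIcc_of_le hδ])

theorem IsH1Left.ac_Icc {u : ℝ → ℝ} (hu : IsH1Left u) {δ : ℝ} (hδ : δ ∈ Ioo (0 : ℝ) 1) :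
    AbsolutelyContinuousOnInterval u δ 1 := by
  refine hu.ac.mono ?_
  rw [uIcc_of_le zero_le_one, uIcc_of_le hδ.2.le]
  exact Icc_subset_Icc_left hδ.1.le

theorem IsH1Left.ae_hasDerivAt {u : ℝ → ℝ} (hu : IsH1Left u) :
    ∀ᵐ x ∂leb, HasDerivAt u (deriv u x) x := by
  rw [leb, ae_restrict_iff' measurableSet_Ioo]
  filter_upwards [hu.ac.ae_differentiableAt] with x hx hm
  refine (hx ?_).hasDerivAt
  rw [uIcc_of_le zero_le_one]
  exact ⟨hm.1.le, hm.2.le⟩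

/-- Hardy's inequality `∫ u² / x² ≤ 6 ∫ (u')²`, on `(δ,1)`. -/
theorem IsH1Left.hardy_aux {u : ℝ → ℝ} (hu : IsH1Left u) {δ : ℝ} (hδ : δ ∈ Ioo (0 : ℝ) 1) :
    ∫ x in δ..1, u x ^ 2 / x ^ 2 ≤ 6 * ∫ x, deriv u x ^ 2 ∂leb := by
  set R := ∫ x, deriv u x ^ 2 ∂leb with hR
  have hinv : ContDiffOn ℝ 1 (fun x : ℝ => x⁻¹) (Icc δ 1) :=
    contDiffOn_id.inv fun x hx => (hδ.1.trans_le hx.1).ne'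
  have hac : AbsolutelyContinuousOnInterval (fun x => u x * u x * x⁻¹) δ 1 :=
    ((hu.ac_Icc hδ).fun_mul (hu.ac_Icc hδ)).fun_mul
      (absolutelyContinuousOnInterval_of_contDiffOn hδ.2.le hinv)
  have h1 := hac.integral_deriv_eq_sub
  have hcu : ContinuousOn u (Icc δ 1) := by
    simpa [uIcc_of_le hδ.2.le] using (hu.ac_Icc hδ).continuousOn
  have hcx : ContinuousOn (fun x => u x ^ 2 / x ^ 2) (Icc δ 1) :=
    (hcu.pow 2).div (continuousOn_id.pow 2) fun x hx => pow_ne_zero 2 (hδ.1.trans_le hx.1).ne'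
  have hi1 : IntervalIntegrable (fun x => u x ^ 2 / x ^ 2) volume δ 1 :=
    ContinuousOn.intervalIntegrable (by rwa [uIcc_of_le hδ.2.le])
  have hδ' : δ ∈ Icc (0 : ℝ) 1 := ⟨hδ.1.le, hδ.2.le⟩
  have hi2 : IntervalIntegrable (fun x => deriv u x ^ 2) volume δ 1 :=
    intervalIntegrable_of_leb hu.memLp.integrable_sq hδ' (by simp)
  have hi3 : IntervalIntegrable (deriv fun x => u x * u x * x⁻¹) volume δ 1 :=
    hac.intervalIntegrable_deriv
  have h2 : ∫ x in δ..1, (u x ^ 2 / x ^ 2 + deriv (fun x => u x * u x * x⁻¹) x)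
      ≤ ∫ x in δ..1, ((1 / 2) * (u x ^ 2 / x ^ 2) + 2 * deriv u x ^ 2) := by
    refine intervalIntegral.integral_mono_ae_restrict hδ.2.le (hi1.add hi3)
      ((hi1.const_mul _).add (hi2.const_mul _)) ?_
    have h3 := hu.ac.ae_differentiableAt
    refine (ae_restrict_iff' measurableSet_Icc).2 ?_
    filter_upwards [h3] with x hx hm
    have hx0 : 0 < x := hδ.1.trans_le hm.1
    have hd := (hx (by rw [uIcc_of_le zero_le_one]; exact ⟨hx0.le, hm.2⟩)).hasDerivAt
    have hD := ((hd.fun_mul hd).fun_mul (hasDerivAt_inv hx0.ne')).deriv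
    rw [hD]
    have : 0 ≤ 2 * (deriv u x - u x / x / 2) ^ 2 := by positivity
    have e : u x ^ 2 / x ^ 2 + ((deriv u x * u x + u x * deriv u x) * x⁻¹
        + u x * u x * -(x ^ 2)⁻¹) = 2 * deriv u x * (u x / x) := by
      field_simp; ring
    rw [e, ← div_pow]
    nlinarith
  rw [intervalIntegral.integral_add hi1 hi3, intervalIntegral.integral_add (hi1.const_mul _)
    (hi2.const_mul _), intervalIntegral.integral_const_mul, intervalIntegral.integral_const_mul,
    h1] at h2
  have h4 : ∫ x in δ..1, deriv u x ^ 2 ≤ R := by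
    rw [hR, integral_leb_eq]
    exact intervalIntegral.integral_mono_interval hδ.1.le hδ.2.le le_rfl
      (ae_of_all _ fun s => sq_nonneg _) (integrable_leb_iff.1 hu.memLp.integrable_sq)
  have h5 : u δ * u δ * δ⁻¹ ≤ R := by
    rw [← div_eq_mul_inv, div_le_iff₀ hδ.1, ← pow_two, mul_comm]
    exact hu.sq_le' hδ'
  have h6 : 0 ≤ u 1 * u 1 * (1 : ℝ)⁻¹ := by
    rw [inv_one, mul_one]; exact mul_self_nonneg _
  linarith

theorem IsH1Left.integrable_div_sq {u : ℝ → ℝ} (hu : IsH1Left u) :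
    Integrable (fun x => u x ^ 2 / x ^ 2) leb := by
  have hpos : ∀ n : ℕ, (1 : ℝ) / (n + 2) ∈ Ioo (0 : ℝ) 1 := fun n =>
    ⟨by positivity, by rw [div_lt_one (by positivity)]; linarith [n.cast_nonneg (α := ℝ)]⟩
  have h := integrableOn_Ioc_of_intervalIntegral_norm_bounded_left
    (f := fun x => u x ^ 2 / x ^ 2) (a := fun n : ℕ => (1 : ℝ) / (n + 2)) (b := 1) (l := atTop)
    (I := 6 * ∫ x, deriv u x ^ 2 ∂leb) (a₀ := 0) ?_ ?_ ?_
  · exact h.mono_set Ioo_subset_Ioc_self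
  · intro n
    have hcu : ContinuousOn u (Icc ((1 : ℝ) / (n + 2)) 1) := by
      have := (hu.ac_Icc (hpos n)).continuousOn
      rwa [uIcc_of_le (hpos n).2.le] at this
    have : ContinuousOn (fun x => u x ^ 2 / x ^ 2) (Icc ((1 : ℝ) / (n + 2)) 1) :=
      (hcu.pow 2).div (continuousOn_id.pow 2)
        fun x hx => pow_ne_zero 2 ((hpos n).1.trans_le hx.1).ne'
    exact this.integrableOn_Icc.mono_set Ioc_subset_Icc_self
  · refine Tendsto.div_atTop tendsto_const_nhds ?_
    exact tendsto_atTop_add_const_right _ _ tendsto_natCast_atTop_atTop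
  · refine Eventually.of_forall fun n => ?_
    refine le_trans (le_of_eq ?_) (hu.hardy_aux (hpos n))
    rw [intervalIntegral.integral_of_le (hpos n).2.le]
    refine integral_congr_ae (ae_of_all _ fun x => ?_)
    exact Real.norm_of_nonneg (by positivity)

/-- Hardy's inequality. -/
theorem IsH1Left.hardy {u : ℝ → ℝ} (hu : IsH1Left u) :
    ∫ x, u x ^ 2 / x ^ 2 ∂leb ≤ 6 * ∫ x, deriv u x ^ 2 ∂leb := by
  refine le_of_tendsto (tendsto_integral_leb hu.integrable_div_sq) ?_
  filter_upwards [Ioo_mem_nhdsGT (zero_lt_one (α := ℝ))] with x hx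
  exact hu.hardy_aux hx

theorem IsH1Left.aestronglyMeasurable {u : ℝ → ℝ} (hu : IsH1Left u) :
    AEStronglyMeasurable u leb := by
  have := hu.ac.continuousOn
  rw [uIcc_of_le zero_le_one] at this
  exact (this.mono Ioo_subset_Icc_self).aestronglyMeasurable measurableSet_Ioo

theorem IsH1Left.memLp_div {u : ℝ → ℝ} (hu : IsH1Left u) : MemLp (fun x => u x / x) 2 leb := by
  refine (memLp_two_iff_integrable_sq ?_).2 ?_
  · exact (hu.aestronglyMeasurable.aemeasurable.div aemeasurable_id).aestronglyMeasurable
  · simpa only [div_pow] using hu.integrable_div_sq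

/-! ### Elements of `L²(0,1)` and weighted quadratic forms -/

/-- The Hilbert space `L²(0,1)`. -/
abbrev L2 : Type := Lp ℝ 2 leb

open Classical in
/-- The class in `L²(0,1)` of a square integrable function; it is `0` for other functions. -/
def toL2 (f : ℝ → ℝ) : L2 := if h : MemLp f 2 leb then h.toLp f else 0

theorem coeFn_toL2 {f : ℝ → ℝ} (h : MemLp f 2 leb) : toL2 f =ᵐ[leb] f := by
  rw [toL2, dif_pos h]
  exact h.coeFn_toLp

theorem toL2_congr {f g : ℝ → ℝ} (hf : MemLp f 2 leb) (h : f =ᵐ[leb] g) : toL2 f = toL2 g := by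
  have hg : MemLp g 2 leb := (memLp_congr_ae h).1 hf
  rw [toL2, toL2, dif_pos hf, dif_pos hg]
  exact (MemLp.toLp_eq_toLp_iff hf hg).2 h

theorem toL2_eq {f : ℝ → ℝ} {F : L2} (hf : F =ᵐ[leb] f) : toL2 f = F := by
  have h : MemLp f 2 leb := (memLp_congr_ae hf).1 (Lp.memLp F)
  refine Lp.ext ?_
  exact (coeFn_toL2 h).trans hf.symm

theorem toL2_sub {f g : ℝ → ℝ} (hf : MemLp f 2 leb) (hg : MemLp g 2 leb) :
    toL2 (fun x => f x - g x) = toL2 f - toL2 g := by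
  refine toL2_eq ?_
  filter_upwards [Lp.coeFn_sub (toL2 f) (toL2 g), coeFn_toL2 hf, coeFn_toL2 hg] with x h1 h2 h3
  rw [h1, Pi.sub_apply, h2, h3]

theorem toL2_const_mul {f : ℝ → ℝ} (hf : MemLp f 2 leb) (c : ℝ) :
    toL2 (fun x => c * f x) = c • toL2 f := by
  refine toL2_eq ?_
  filter_upwards [Lp.coeFn_smul c (toL2 f), coeFn_toL2 hf] with x h1 h2
  rw [h1, Pi.smul_apply, h2, smul_eq_mul]

theorem norm_sq_eq_integral (F : L2) : ‖F‖ ^ 2 = ∫ x, F x ^ 2 ∂leb := by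
  rw [← real_inner_self_eq_norm_sq, L2.inner_def]
  simp [pow_two]

theorem norm_toL2_sq {f : ℝ → ℝ} (hf : MemLp f 2 leb) : ‖toL2 f‖ ^ 2 = ∫ x, f x ^ 2 ∂leb := by
  rw [norm_sq_eq_integral]
  refine integral_congr_ae ?_
  filter_upwards [coeFn_toL2 hf] with x hx
  rw [hx]

/-- The bilinear form on `L²(0,1)` with weight `φ`. -/
def wform (φ : ℝ → ℝ) (F G : L2) : ℝ := ∫ x, φ x * (F x * G x) ∂leb

theorem integrable_wform {φ : ℝ → ℝ} (hφ : MemLp φ ⊤ leb) (F G : L2) :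
    Integrable (fun x => φ x * (F x * G x)) leb := by
  have h1 : MemLp (fun x => φ x * F x) 2 leb := MemLp.mul' (Lp.memLp F) hφ
  have h2 := h1.integrable_mul (Lp.memLp G)
  refine h2.congr (ae_of_all _ fun x => ?_)
  simp [mul_assoc]

theorem abs_wform_le {φ : ℝ → ℝ} {C : ℝ} (hC : ∀ᵐ x ∂leb, |φ x| ≤ C) (F G : L2) :
    |wform φ F G| ≤ C * (‖F‖ * ‖G‖) := by
  have hC0 : 0 ≤ C := by
    have : (ae leb).NeBot := by
      rw [ae_neBot, leb]
      intro h
      have := congrArg (fun μ => μ univ) h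
      simp at this
    obtain ⟨x, hx⟩ := hC.exists
    exact (abs_nonneg _).trans hx
  have habs : ∀ H : L2, MemLp (fun x => |H x|) 2 leb := fun H => (Lp.memLp H).abs
  have hFG : Integrable (fun x => |F x| * |G x|) leb := (habs F).integrable_mul (habs G)
  have h1 : |wform φ F G| ≤ ∫ x, C * (|F x| * |G x|) ∂leb := by
    rw [wform, ← Real.norm_eq_abs]
    refine norm_integral_le_of_norm_le (hFG.const_mul C) ?_
    filter_upwards [hC] with x hx
    rw [Real.norm_eq_abs, abs_mul, abs_mul]
    exact mul_le_mul_of_nonneg_right hx (by positivity)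
  rw [integral_const_mul] at h1
  refine h1.trans (mul_le_mul_of_nonneg_left ?_ hC0)
  have h2 : ∫ x, |F x| * |G x| ∂leb = inner ℝ (toL2 fun x => |F x|) (toL2 fun x => |G x|) := by
    rw [L2.inner_def]
    refine integral_congr_ae ?_
    filter_upwards [coeFn_toL2 (habs F), coeFn_toL2 (habs G)] with x hx1 hx2
    simp [hx1, hx2, mul_comm]
  rw [h2]
  refine (real_inner_le_norm _ _).trans (le_of_eq ?_)
  have h3 : ∀ H : L2, ‖toL2 fun x => |H x|‖ = ‖H‖ := by
    intro H
    rw [← sq_eq_sq₀ (norm_nonneg _) (norm_nonneg _), norm_toL2_sq (habs H),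
      norm_sq_eq_integral]
    simp
  rw [h3, h3]

theorem wform_sub_left {φ : ℝ → ℝ} (hφ : MemLp φ ⊤ leb) (F F' G : L2) :
    wform φ (F - F') G = wform φ F G - wform φ F' G := by
  rw [wform, wform, wform, ← integral_sub (integrable_wform hφ _ _) (integrable_wform hφ _ _)]
  refine integral_congr_ae ?_
  filter_upwards [Lp.coeFn_sub F F'] with x hx
  rw [hx, Pi.sub_apply]; ring

theorem wform_comm (φ : ℝ → ℝ) (F G : L2) : wform φ F G = wform φ G F := by
  simp [wform, mul_comm]

theorem wform_sub_right {φ : ℝ → ℝ} (hφ : MemLp φ ⊤ leb) (F G G' : L2) :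
    wform φ F (G - G') = wform φ F G - wform φ F G' := by
  rw [wform_comm, wform_sub_left hφ, wform_comm φ G, wform_comm φ G']

theorem wform_sub_weight {φ ψ : ℝ → ℝ} (hφ : MemLp φ ⊤ leb) (hψ : MemLp ψ ⊤ leb) (F G : L2) :
    wform (fun x => φ x - ψ x) F G = wform φ F G - wform ψ F G := by
  rw [wform, wform, wform, ← integral_sub (integrable_wform hφ _ _) (integrable_wform hψ _ _)]
  refine integral_congr_ae (ae_of_all _ fun x => ?_)
  ring

theorem wform_smul_left (φ : ℝ → ℝ) (r : ℝ) (F G : L2) :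
    wform φ (r • F) G = r * wform φ F G := by
  rw [wform, wform, ← integral_const_mul]
  refine integral_congr_ae ?_
  filter_upwards [Lp.coeFn_smul r F] with x hx
  rw [hx, Pi.smul_apply, smul_eq_mul]; ring

theorem wform_smul_right (φ : ℝ → ℝ) (r : ℝ) (F G : L2) :
    wform φ F (r • G) = r * wform φ F G := by
  rw [wform_comm, wform_smul_left, wform_comm]

theorem wform_const_mul_weight (φ : ℝ → ℝ) (r : ℝ) (F G : L2) :
    wform (fun x => r * φ x) F G = r * wform φ F G := by
  rw [wform, wform, ← integral_const_mul]
  simp [mul_assoc]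

theorem exists_bound_of_memLp_top {φ : ℝ → ℝ} (hφ : MemLp φ ⊤ leb) :
    ∃ C, ∀ᵐ x ∂leb, |φ x| ≤ C := by
  refine ⟨(eLpNorm φ ⊤ leb).toReal, ?_⟩
  filter_upwards [ae_le_eLpNormEssSup (f := φ) (μ := leb)] with x hx
  rw [← eLpNorm_exponent_top] at hx
  rw [← ENNReal.ofReal_le_ofReal_iff ENNReal.toReal_nonneg,
    ENNReal.ofReal_toReal hφ.eLpNorm_ne_top, ← Real.norm_eq_abs, ofReal_norm]
  exact hx

theorem tendsto_wform {ι : Type*} {l : Filter ι} {φ : ι → ℝ → ℝ} {ψ : ℝ → ℝ} {e : ι → ℝ}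
    (hφ : ∀ᶠ i in l, MemLp (φ i) ⊤ leb) (hψ : MemLp ψ ⊤ leb)
    (he : ∀ᶠ i in l, ∀ᵐ x ∂leb, |φ i x - ψ x| ≤ e i) (he0 : Tendsto e l (𝓝 0))
    {F G : ι → L2} {F₀ G₀ : L2} (hF : Tendsto F l (𝓝 F₀)) (hG : Tendsto G l (𝓝 G₀)) :
    Tendsto (fun i => wform (φ i) (F i) (G i)) l (𝓝 (wform ψ F₀ G₀)) := by
  obtain ⟨C, hC⟩ := exists_bound_of_memLp_top hψ
  rw [tendsto_iff_dist_tendsto_zero]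
  have hF' : Tendsto (fun i => ‖F i - F₀‖) l (𝓝 0) := tendsto_iff_norm_sub_tendsto_zero.1 hF
  have hG' : Tendsto (fun i => ‖G i - G₀‖) l (𝓝 0) := tendsto_iff_norm_sub_tendsto_zero.1 hG
  have hlim : Tendsto (fun i => e i * (‖F i‖ * ‖G i‖) + C * (‖F i - F₀‖ * ‖G i‖)
      + C * (‖F₀‖ * ‖G i - G₀‖)) l (𝓝 0) := by
    have := ((he0.mul (hF.norm.mul hG.norm)).add ((hF'.mul hG.norm).const_mul C)).add
      ((hG'.const_mul ‖F₀‖).const_mul C)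
    simpa using this
  refine squeeze_zero' (Eventually.of_forall fun _ => dist_nonneg) ?_ hlim
  filter_upwards [hφ, he] with i hi hei
  have e1 : wform (φ i) (F i) (G i) - wform ψ F₀ G₀ = wform (fun x => φ i x - ψ x) (F i) (G i)
      + wform ψ (F i - F₀) (G i) + wform ψ F₀ (G i - G₀) := by
    rw [wform_sub_weight hi hψ, wform_sub_left hψ, wform_sub_right hψ]; ring
  rw [Real.dist_eq, e1]
  exact (abs_add_three _ _ _).trans (add_le_add (add_le_add (abs_wform_le hei _ _)
    (abs_wform_le hC _ _)) (abs_wform_le hC _ _))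

/-- The product rule for a quadratic form with a weight depending on time. -/
theorem hasDerivAt_wform {φ : ℝ → ℝ → ℝ} {φ' : ℝ → ℝ} {t C : ℝ}
    (hφ : ∀ s, MemLp (φ s) ⊤ leb) (hφ' : MemLp φ' ⊤ leb)
    (hC : ∀ s, ∀ᵐ x ∂leb, |φ s x - φ t x - (s - t) * φ' x| ≤ C * (s - t) ^ 2)
    {F G : ℝ → L2} {F' G' : L2} (hF : HasDerivAt F F' t) (hG : HasDerivAt G G' t) :
    HasDerivAt (fun s => wform (φ s) (F s) (G s))
      (wform φ' (F t) (G t) + wform (φ t) F' (G t) + wform (φ t) (F t) G') t := by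
  rw [hasDerivAt_iff_tendsto_slope] at hF hG ⊢
  have hFc : Tendsto F (𝓝[≠] t) (𝓝 (F t)) :=
    ((hasDerivAt_iff_tendsto_slope.2 hF).continuousAt.tendsto).mono_left nhdsWithin_le_nhds
  have hGc : Tendsto G (𝓝[≠] t) (𝓝 (G t)) :=
    ((hasDerivAt_iff_tendsto_slope.2 hG).continuousAt.tendsto).mono_left nhdsWithin_le_nhds
  have hs : ∀ᶠ s in 𝓝[≠] t, s ≠ t := self_mem_nhdsWithin
  have t1 : Tendsto (fun s => wform (fun x => (s - t)⁻¹ * (φ s x - φ t x)) (F s) (G s)) (𝓝[≠] t)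
      (𝓝 (wform φ' (F t) (G t))) := by
    refine tendsto_wform (e := fun s => C * |s - t|)
      (Eventually.of_forall fun s => ((hφ s).sub (hφ t)).const_mul _) hφ' ?_ ?_ hFc hGc
    · filter_upwards [hs] with s hs
      filter_upwards [hC s] with x hx
      have h0 : s - t ≠ 0 := sub_ne_zero.2 hs
      have : (s - t)⁻¹ * (φ s x - φ t x) - φ' x
          = (s - t)⁻¹ * (φ s x - φ t x - (s - t) * φ' x) := by
        field_simp
      change |(s - t)⁻¹ * (φ s x - φ t x) - φ' x| ≤ _
      rw [this, abs_mul, abs_inv, inv_mul_le_iff₀ (abs_pos.2 h0)]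
      calc _ ≤ _ := hx
        _ = _ := by rw [← sq_abs]; ring
    · have : Tendsto (fun s : ℝ => C * |s - t|) (𝓝 t) (𝓝 (C * |t - t|)) :=
        Continuous.tendsto (by fun_prop) t
      simpa using this.mono_left nhdsWithin_le_nhds
  have t2 : Tendsto (fun s => wform (φ t) (slope F t s) (G s)) (𝓝[≠] t)
      (𝓝 (wform (φ t) F' (G t))) :=
    tendsto_wform (e := fun _ => 0) (Eventually.of_forall fun _ => hφ t) (hφ t)
      (Eventually.of_forall fun _ => ae_of_all _ fun x => by simp) tendsto_const_nhds hF hGc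
  have t3 : Tendsto (fun s => wform (φ t) (F t) (slope G t s)) (𝓝[≠] t)
      (𝓝 (wform (φ t) (F t) G')) :=
    tendsto_wform (e := fun _ => 0) (Eventually.of_forall fun _ => hφ t) (hφ t)
      (Eventually.of_forall fun _ => ae_of_all _ fun x => by simp) tendsto_const_nhds
      tendsto_const_nhds hG
  refine ((t1.add t2).add t3).congr fun s => ?_
  rw [wform_const_mul_weight, wform_sub_weight (hφ s) (hφ t), slope, slope, slope,
    vsub_eq_sub, vsub_eq_sub, vsub_eq_sub, wform_smul_left, wform_smul_right,
    wform_sub_left (hφ t), wform_sub_right (hφ t), smul_eq_mul]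
  ring

/-! ### The coefficients -/

/-- What is used about a degenerate coefficient, weakly or strongly: regularity away from `0`, and
the bound `x |g'(x)| ≤ K g(x)` with `K = degConst g`. -/
structure DegCoeff (g : ℝ → ℝ) : Prop where
  cont : ContinuousOn g (Icc 0 1)
  c1 : ∀ δ ∈ Ioo (0 : ℝ) 1, ContDiffOn ℝ 1 g (Icc δ 1)
  zero : g 0 = 0
  pos : ∀ x ∈ Ioc (0 : ℝ) 1, 0 < g x
  deg_pos : 0 < degConst g
  deriv_le : ∀ x ∈ Ioo (0 : ℝ) 1, |x * deriv g x| ≤ degConst g * g x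

theorem mul_abs_deriv_le_of_degConst_pos {g : ℝ → ℝ} (h : 0 < degConst g)
    (hpos : ∀ x ∈ Ioc (0 : ℝ) 1, 0 < g x) {x : ℝ} (hx : x ∈ Ioo (0 : ℝ) 1) :
    |x * deriv g x| ≤ degConst g * g x := by
  have hb : BddAbove ((fun x => x * |derivWithin g (Icc 0 1) x| / g x) '' Ioc 0 1) := by
    by_contra hb
    rw [degConst, Real.sSup_of_not_bddAbove hb] at h
    exact lt_irrefl _ h
  have hx' : x ∈ Ioc (0 : ℝ) 1 := ⟨hx.1, hx.2.le⟩
  have h1 : x * |derivWithin g (Icc 0 1) x| / g x ≤ degConst g :=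
    le_csSup hb (mem_image_of_mem _ hx')
  rw [derivWithin_of_mem_nhds (Icc_mem_nhds hx.1 hx.2), div_le_iff₀ (hpos x hx')] at h1
  rwa [abs_mul, abs_of_pos hx.1]

theorem degCoeff_of_deg {g : ℝ → ℝ} (h : WeaklyDeg g ∨ StronglyDeg g) : DegCoeff g := by
  rcases h with ⟨h1, h2, h3, h4, h5, -⟩ | ⟨h1, h3, h4, h5, -⟩
  · exact ⟨h1, fun δ hδ => h2.mono fun x hx => ⟨hδ.1.trans_le hx.1, hx.2⟩, h3, h4, h5,
      fun x hx => mul_abs_deriv_le_of_degConst_pos h5 h4 hx⟩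
  · have h6 : 0 < degConst g := one_pos.trans_le h5
    exact ⟨h1.continuousOn, fun δ hδ => h1.mono (Icc_subset_Icc_left hδ.1.le), h3, h4, h6,
      fun x hx => mul_abs_deriv_le_of_degConst_pos h6 h4 hx⟩

theorem hasDerivAt_of_c1 {g : ℝ → ℝ} (h : ∀ δ ∈ Ioo (0 : ℝ) 1, ContDiffOn ℝ 1 g (Icc δ 1))
    {x : ℝ} (hx : x ∈ Ioo (0 : ℝ) 1) : HasDerivAt g (deriv g x) x := by
  have h1 := (h (x / 2) ⟨by linarith [hx.1], by linarith [hx.1, hx.2]⟩).differentiableOn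
    one_ne_zero
  exact (h1.differentiableAt (Icc_mem_nhds (by linarith [hx.1]) hx.2)).hasDerivAt

theorem continuousOn_Ioc_of_c1 {g : ℝ → ℝ}
    (h : ∀ δ ∈ Ioo (0 : ℝ) 1, ContinuousOn g (Icc δ 1)) : ContinuousOn g (Ioc 0 1) := by
  intro x hx
  have h1 : ContinuousWithinAt g (Icc (x / 2) 1) x :=
    h (x / 2) ⟨by linarith [hx.1], by linarith [hx.1, hx.2]⟩ x ⟨by linarith [hx.1], hx.2⟩
  refine h1.mono_of_mem_nhdsWithin ?_
  filter_upwards [self_mem_nhdsWithin,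
    mem_nhdsWithin_of_mem_nhds (Ioi_mem_nhds (by linarith [hx.1] : x / 2 < x))] with y hy hy2
  exact ⟨le_of_lt hy2, hy.2⟩

/-- If `x f'(x) ≤ 2 f(x)`, then `x² / f(x)` is nondecreasing. -/
theorem monotoneOn_sq_div {f : ℝ → ℝ} (hc : ∀ δ ∈ Ioo (0 : ℝ) 1, ContDiffOn ℝ 1 f (Icc δ 1))
    (hpos : ∀ x ∈ Ioc (0 : ℝ) 1, 0 < f x) (hf : ∀ x ∈ Ioo (0 : ℝ) 1, x * deriv f x ≤ 2 * f x) :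
    MonotoneOn (fun x => x ^ 2 / f x) (Ioc 0 1) := by
  have hcf : ContinuousOn f (Ioc 0 1) :=
    continuousOn_Ioc_of_c1 fun δ hδ => (hc δ hδ).continuousOn
  have hd : ∀ x ∈ Ioo (0 : ℝ) 1, HasDerivAt (fun x => x ^ 2 / f x)
      ((2 * x * f x - x ^ 2 * deriv f x) / f x ^ 2) x := by
    intro x hx
    have := ((hasDerivAt_pow 2 x).fun_div (hasDerivAt_of_c1 hc hx) (hpos x ⟨hx.1, hx.2.le⟩).ne')
    simpa using this
  refine monotoneOn_of_deriv_nonneg (convex_Ioc 0 1)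
    ((continuousOn_id.pow 2).div hcf fun x hx => (hpos x hx).ne') ?_ ?_
  · rw [interior_Ioc]
    exact fun x hx => (hd x hx).differentiableAt.differentiableWithinAt
  · rw [interior_Ioc]
    intro x hx
    rw [(hd x hx).deriv]
    refine div_nonneg ?_ (sq_nonneg _)
    nlinarith [mul_le_mul_of_nonneg_left (hf x hx) hx.1.le]

theorem Coeffs.eta_pos (p : Coeffs) (x : ℝ) : 0 < p.eta x := Real.exp_pos _

/-- The hypotheses on the coefficients that enter the observability estimate. -/
structure Admissible (p : Coeffs) (m : ℝ) : Prop where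
  a_deg : DegCoeff p.a
  d_deg : DegCoeff p.d
  b_cont : ContinuousOn p.b (Icc 0 1)
  ba_int : Integrable (fun x => p.b x / p.a x) leb
  b_le : ∀ᵐ x ∂leb, |x * p.b x / p.a x| ≤ m
  m_nonneg : 0 ≤ m
  deg_le : degConst p.a + 2 * degConst p.d ≤ 2 - 2 * m
  lam_nonneg : 0 ≤ p.lam

theorem one_mem_Ioc : (1 : ℝ) ∈ Ioc (0 : ℝ) 1 := ⟨one_pos, le_rfl⟩

theorem aestronglyMeasurable_of_continuousOn_Ioc {f : ℝ → ℝ} (h : ContinuousOn f (Ioc 0 1)) :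
    AEStronglyMeasurable f leb :=
  (h.mono Ioo_subset_Ioc_self).aestronglyMeasurable measurableSet_Ioo

theorem memLp_top_of_bound {f : ℝ → ℝ} (h : AEStronglyMeasurable f leb) {C : ℝ}
    (hC : ∀ x ∈ Ioo (0 : ℝ) 1, |f x| ≤ C) : MemLp f ⊤ leb :=
  MemLp.of_bound h C (ae_leb_mem.mono hC)

theorem DegCoeff.continuousOn_Ioc {g : ℝ → ℝ} (h : DegCoeff g) : ContinuousOn g (Ioc 0 1) :=
  h.cont.mono Ioc_subset_Icc_self

theorem admissible_of_hyp {p : Coeffs} {m : ℝ}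
    (hyp : (p.HypLow ∧ m = p.M) ∨ (p.HypHigh ∧ m = p.Minf)) (hlam : 0 ≤ p.lam)
    (hK : degConst p.a + 2 * degConst p.d ≤ 2 - 2 * m) : Admissible p m := by
  have hS : p.Standing := by
    rcases hyp with ⟨h, -⟩ | ⟨h, -⟩ <;> exact h.1
  have ha := degCoeff_of_deg hS.deg_a
  have hd := degCoeff_of_deg hS.deg_d
  have a1 : 0 < p.a 1 := ha.pos 1 one_mem_Ioc
  refine ⟨ha, hd, hS.cont_b, hS.int_ba, ?_, ?_, hK, hlam⟩
  · rcases hyp with ⟨h, rfl⟩ | ⟨h, rfl⟩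
    · have hb : MemLp p.b ⊤ leb := by
        obtain ⟨C, hC⟩ := isCompact_Icc.exists_bound_of_continuousOn hS.cont_b
        exact memLp_top_of_bound (aestronglyMeasurable_of_continuousOn_Ioc
          (hS.cont_b.mono Ioc_subset_Icc_self)) fun x hx => hC x ⟨hx.1.le, hx.2.le⟩
      have hmono := monotoneOn_sq_div (f := fun x => p.a x ^ 2)
        (fun δ hδ => (ha.c1 δ hδ).pow 2) (fun x hx => pow_pos (ha.pos x hx) 2) (by
          intro x hx
          have h1 := ((hasDerivAt_of_c1 ha.c1 hx).fun_pow 2).deriv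
          have h2 := ha.pos x ⟨hx.1, hx.2.le⟩
          have h3 := (abs_le.1 (ha.deriv_le x hx)).2
          have h4 : x * deriv p.a x ≤ p.a x := h3.trans (by nlinarith [h.2])
          rw [h1]
          simp only [Nat.cast_ofNat]
          have : x * (2 * p.a x ^ (2 - 1) * deriv p.a x) = 2 * p.a x * (x * deriv p.a x) := by
            norm_num; ring
          rw [this]; nlinarith)
      filter_upwards [ae_leb_mem, ae_le_eLpNormEssSup (f := p.b) (μ := leb)] with x hx hbx
      have hax := ha.pos x ⟨hx.1, hx.2.le⟩
      rw [← eLpNorm_exponent_top, ← ofReal_norm, ← ENNReal.ofReal_toReal hb.eLpNorm_ne_top,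
        ENNReal.ofReal_le_ofReal_iff ENNReal.toReal_nonneg, Real.norm_eq_abs] at hbx
      have h1 := hmono ⟨hx.1, hx.2.le⟩ one_mem_Ioc hx.2.le
      simp only [← div_pow] at h1
      have h2 : x / p.a x ≤ 1 / p.a 1 :=
        (sq_le_sq₀ (div_pos hx.1 hax).le (by positivity)).1 h1
      have h3 : |x * p.b x / p.a x| = |p.b x| * (x / p.a x) := by
        rw [mul_div_right_comm, abs_mul, abs_of_pos (div_pos hx.1 hax), mul_comm]
      rw [h3, Coeffs.M, div_eq_mul_one_div (ENNReal.toReal _)]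
      exact mul_le_mul hbx h2 (div_pos hx.1 hax).le ENNReal.toReal_nonneg
    · filter_upwards [ae_le_eLpNormEssSup (f := fun x => x * p.b x / p.a x) (μ := leb)] with x hx
      rw [← eLpNorm_exponent_top, ← ofReal_norm, ← ENNReal.ofReal_toReal h.2.2.eLpNorm_ne_top,
        ENNReal.ofReal_le_ofReal_iff ENNReal.toReal_nonneg, Real.norm_eq_abs] at hx
      exact hx
  · rcases hyp with ⟨h, rfl⟩ | ⟨h, rfl⟩
    · exact div_nonneg ENNReal.toReal_nonneg a1.le
    · exact ENNReal.toReal_nonneg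

namespace Admissible

variable {p : Coeffs} {m : ℝ}

theorem a_pos (H : Admissible p m) {x : ℝ} (hx : x ∈ Ioo (0 : ℝ) 1) : 0 < p.a x :=
  H.a_deg.pos x ⟨hx.1, hx.2.le⟩

theorem d_pos (H : Admissible p m) {x : ℝ} (hx : x ∈ Ioo (0 : ℝ) 1) : 0 < p.d x :=
  H.d_deg.pos x ⟨hx.1, hx.2.le⟩

theorem hasDerivAt_a (H : Admissible p m) {x : ℝ} (hx : x ∈ Ioo (0 : ℝ) 1) :
    HasDerivAt p.a (deriv p.a x) x :=
  hasDerivAt_of_c1 H.a_deg.c1 hx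

theorem hasDerivAt_d (H : Admissible p m) {x : ℝ} (hx : x ∈ Ioo (0 : ℝ) 1) :
    HasDerivAt p.d (deriv p.d x) x :=
  hasDerivAt_of_c1 H.d_deg.c1 hx

/-- `C₆ = 1 - K_a / 2 - m` is at least `K_d`. -/
theorem deg_d_le_C6 (H : Admissible p m) : degConst p.d ≤ p.C6 m := by
  have := H.deg_le
  unfold Coeffs.C6; linarith

theorem C6_pos (H : Admissible p m) : 0 < p.C6 m := H.d_deg.deg_pos.trans_le H.deg_d_le_C6

theorem ba_cont (H : Admissible p m) {δ : ℝ} (hδ : δ ∈ Ioo (0 : ℝ) 1) :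
    ContinuousOn (fun x => p.b x / p.a x) (Icc δ 1) :=
  (H.b_cont.mono (Icc_subset_Icc_left hδ.1.le)).div (H.a_deg.c1 δ hδ).continuousOn
    fun x hx => (H.a_deg.pos x ⟨hδ.1.trans_le hx.1, hx.2⟩).ne'

/-! ### The weight `η` -/

theorem eta_c1 (H : Admissible p m) {δ : ℝ} (hδ : δ ∈ Ioo (0 : ℝ) 1) :
    ContDiffOn ℝ 1 p.eta (Icc δ 1) := by
  set f : ℝ → ℝ := IccExtend hδ.2.le ((Icc δ 1).domRestrict fun x => p.b x / p.a x) with hf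
  have hfc : Continuous f := (continuousOn_iff_continuous_domRestrict.1 (H.ba_cont hδ)).Icc_extend'
  have hF : ContDiff ℝ 1 (fun x => ∫ s in δ..x, f s) := by
    refine contDiff_one_iff_deriv.2 ⟨fun x => ?_, ?_⟩
    · exact (hfc.integral_hasStrictDerivAt δ x).hasDerivAt.differentiableAt
    · have : deriv (fun x => ∫ s in δ..x, f s) = f := by
        ext x; exact hfc.deriv_integral f δ x
      rwa [this]
  have h1 : ContDiff ℝ 1 (fun x => p.eta δ * Real.exp (∫ s in δ..x, f s)) :=
    contDiff_const.mul hF.exp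
  refine h1.contDiffOn.congr fun x hx => ?_
  have hδ' : δ ∈ Icc (0 : ℝ) 1 := ⟨hδ.1.le, hδ.2.le⟩
  have hx' : x ∈ Icc (0 : ℝ) 1 := ⟨hδ.1.le.trans hx.1, hx.2⟩
  have h2 : ∫ s in δ..x, f s = ∫ s in δ..x, p.b s / p.a s := by
    refine intervalIntegral.integral_congr fun s hs => ?_
    rw [uIcc_of_le hx.1] at hs
    have hs' : s ∈ Icc δ 1 := ⟨hs.1, hs.2.trans hx.2⟩
    rw [hf, IccExtend_of_mem hδ.2.le _ hs']; rfl
  rw [h2, Coeffs.eta, Coeffs.eta, ← Real.exp_add, intervalIntegral.integral_add_adjacent_intervals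
    (intervalIntegrable_of_leb H.ba_int (by norm_num) hδ')
    (intervalIntegrable_of_leb H.ba_int hδ' hx')]

theorem hasDerivAt_eta (H : Admissible p m) {x : ℝ} (hx : x ∈ Ioo (0 : ℝ) 1) :
    HasDerivAt p.eta (p.eta x * (p.b x / p.a x)) x := by
  have hc := H.ba_cont (δ := x / 2) ⟨by linarith [hx.1], by linarith [hx.1, hx.2]⟩
  have hn : Icc (x / 2) 1 ∈ 𝓝 x := Icc_mem_nhds (by linarith [hx.1]) hx.2
  have hm : StronglyMeasurableAtFilter (fun x => p.b x / p.a x) (𝓝 x) volume :=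
    hc.stronglyMeasurableAtFilter_nhdsWithin measurableSet_Icc x |>.filter_mono
      (by rw [nhdsWithin_eq_nhds.2 hn])
  have h1 := intervalIntegral.integral_hasDerivAt_right
    (intervalIntegrable_of_leb H.ba_int (x := 1 / 2) (by norm_num) ⟨hx.1.le, hx.2.le⟩) hm
    (hc.continuousAt hn)
  exact h1.exp

theorem exists_eta_bounds (H : Admissible p m) : ∃ e₀ e₁ : ℝ, 0 < e₀ ∧ 0 < e₁ ∧
    ∀ x ∈ Icc (0 : ℝ) 1, e₀ ≤ p.eta x ∧ p.eta x ≤ e₁ := by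
  set I := ∫ s in (0 : ℝ)..1, |p.b s / p.a s| with hI
  have key : ∀ x ∈ Icc (0 : ℝ) 1, |∫ s in (1 / 2 : ℝ)..x, p.b s / p.a s| ≤ I := by
    intro x hx
    rw [← Real.norm_eq_abs]
    refine (intervalIntegral.norm_integral_le_integral_norm_uIoc (μ := volume)
      (f := fun s => p.b s / p.a s)).trans ?_
    rw [hI, intervalIntegral.integral_of_le zero_le_one]
    refine setIntegral_mono_set ?_ (ae_of_all _ fun s => abs_nonneg _) ?_
    · exact ((intervalIntegrable_iff_integrableOn_Ioc_of_le zero_le_one).1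
        (integrable_leb_iff.1 H.ba_int)).abs
    · refine Eventually.of_forall fun s (hs : s ∈ uIoc _ _) => ?_
      rw [mem_uIoc] at hs
      rcases hs with hs | hs
      · exact ⟨by linarith [hs.1], hs.2.trans hx.2⟩
      · exact ⟨hx.1.trans_lt hs.1, by linarith [hs.2]⟩
  refine ⟨Real.exp (-I), Real.exp I, Real.exp_pos _, Real.exp_pos _, fun x hx => ?_⟩
  have := abs_le.1 (key x hx)
  exact ⟨Real.exp_le_exp.2 this.1, Real.exp_le_exp.2 this.2⟩

theorem continuousOn_eta (H : Admissible p m) : ContinuousOn p.eta (Ioc 0 1) :=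
  continuousOn_Ioc_of_c1 fun _ hδ => (H.eta_c1 hδ).continuousOn

theorem sigma_pos (H : Admissible p m) {x : ℝ} (hx : x ∈ Ioc (0 : ℝ) 1) : 0 < p.sigma x :=
  div_pos (H.a_deg.pos x hx) (p.eta_pos x)

theorem continuousOn_sigma (H : Admissible p m) : ContinuousOn p.sigma (Ioc 0 1) :=
  H.a_deg.continuousOn_Ioc.div H.continuousOn_eta fun x _ => (p.eta_pos x).ne'

/-! ### Bounded weights -/

theorem monotoneOn_sq_div_a (H : Admissible p m) :
    MonotoneOn (fun x => x ^ 2 / p.a x) (Ioc 0 1) := by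
  refine monotoneOn_sq_div H.a_deg.c1 H.a_deg.pos fun x hx => ?_
  have h1 := (abs_le.1 (H.a_deg.deriv_le x hx)).2
  have h2 := H.a_pos hx
  have h3 := H.deg_le
  have h4 := H.d_deg.deg_pos
  have h5 := H.m_nonneg
  exact h1.trans (mul_le_mul_of_nonneg_right (by linarith) h2.le)

theorem monotoneOn_sq_div_ad (H : Admissible p m) :
    MonotoneOn (fun x => x ^ 2 / (p.a x * p.d x)) (Ioc 0 1) := by
  refine monotoneOn_sq_div (fun δ hδ => (H.a_deg.c1 δ hδ).mul (H.d_deg.c1 δ hδ))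
    (fun x hx => mul_pos (H.a_deg.pos x hx) (H.d_deg.pos x hx)) fun x hx => ?_
  have h1 := (abs_le.1 (H.a_deg.deriv_le x hx)).2
  have h1' := (abs_le.1 (H.d_deg.deriv_le x hx)).2
  have h2 := H.a_pos hx
  have h2' := H.d_pos hx
  have h3 := H.deg_le
  have h4 := H.d_deg.deg_pos
  have h5 := H.m_nonneg
  rw [((H.hasDerivAt_a hx).fun_mul (H.hasDerivAt_d hx)).deriv]
  have e : x * (deriv p.a x * p.d x + p.a x * deriv p.d x)
    = (x * deriv p.a x) * p.d x + p.a x * (x * deriv p.d x) := by ring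
  rw [e]
  have := mul_le_mul_of_nonneg_right h1 h2'.le
  have := mul_le_mul_of_nonneg_left h1' h2.le
  have := mul_pos h2 h2'
  nlinarith

/-- `Y(x) = λ x² / (a(x) d(x))`, the potential relative to `1 / x²`. -/
theorem exists_Y_bound (H : Admissible p m) : ∃ C, ∀ x ∈ Ioo (0 : ℝ) 1,
    |p.lam * x ^ 2 / (p.a x * p.d x)| ≤ C := by
  refine ⟨p.lam * (1 ^ 2 / (p.a 1 * p.d 1)), fun x hx => ?_⟩
  have h1 := H.monotoneOn_sq_div_ad ⟨hx.1, hx.2.le⟩ one_mem_Ioc hx.2.le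
  have h2 := mul_pos (H.a_pos hx) (H.d_pos hx)
  rw [abs_of_nonneg (div_nonneg (mul_nonneg H.lam_nonneg (sq_nonneg _)) h2.le), mul_div_assoc]
  exact mul_le_mul_of_nonneg_left h1 H.lam_nonneg

theorem memLp_eta (H : Admissible p m) : MemLp p.eta ⊤ leb := by
  obtain ⟨e₀, e₁, h0, -, h⟩ := H.exists_eta_bounds
  refine memLp_top_of_bound (aestronglyMeasurable_of_continuousOn_Ioc H.continuousOn_eta)
    (C := e₁) fun x hx => ?_
  rw [abs_of_pos (p.eta_pos x)]
  exact (h x ⟨hx.1.le, hx.2.le⟩).2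

theorem memLp_Y (H : Admissible p m) : MemLp (fun x => p.lam * x ^ 2 / (p.a x * p.d x)) ⊤ leb := by
  obtain ⟨C, hC⟩ := H.exists_Y_bound
  refine memLp_top_of_bound (aestronglyMeasurable_of_continuousOn_Ioc ?_) hC
  exact (continuousOn_const.mul (continuousOn_id.pow 2)).div
    (H.a_deg.continuousOn_Ioc.mul H.d_deg.continuousOn_Ioc)
    fun x hx => (mul_pos (H.a_deg.pos x hx) (H.d_deg.pos x hx)).ne'

/-- `x / √σ` is bounded. -/
theorem memLp_div_sqrt_sigma (H : Admissible p m) : MemLp (fun x => x / √(p.sigma x)) ⊤ leb := by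
  obtain ⟨e₀, e₁, h0, h1, h⟩ := H.exists_eta_bounds
  refine memLp_top_of_bound (aestronglyMeasurable_of_continuousOn_Ioc ?_)
    (C := √(e₁ * (1 ^ 2 / p.a 1))) fun x hx => ?_
  · exact continuousOn_id.div H.continuousOn_sigma.sqrt
      fun x hx => (Real.sqrt_pos.2 (H.sigma_pos hx)).ne'
  · have hx' : x ∈ Ioc (0 : ℝ) 1 := ⟨hx.1, hx.2.le⟩
    refine Real.le_sqrt_of_sq_le ?_
    rw [sq_abs, div_pow, Real.sq_sqrt (H.sigma_pos hx').le, Coeffs.sigma, div_div_eq_mul_div,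
      mul_comm, mul_div_assoc]
    exact mul_le_mul (h x ⟨hx.1.le, hx.2.le⟩).2
      (H.monotoneOn_sq_div_a hx' one_mem_Ioc hx.2.le)
      (div_nonneg (sq_nonneg _) (H.a_pos hx).le) h1.le

theorem memLp_b (H : Admissible p m) : MemLp (fun x => x * p.b x / p.a x) ⊤ leb := by
  refine MemLp.of_bound (aestronglyMeasurable_of_continuousOn_Ioc ?_) m H.b_le
  exact (continuousOn_id.mul (H.b_cont.mono Ioc_subset_Icc_self)).div H.a_deg.continuousOn_Ioc
    fun x hx => (H.a_deg.pos x hx).ne'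

end Admissible

theorem DegCoeff.memLp_log_deriv {g : ℝ → ℝ} (hg : DegCoeff g) :
    MemLp (fun x => x * deriv g x / g x) ⊤ leb := by
  refine memLp_top_of_bound ?_ (C := degConst g) fun x hx => ?_
  · have h1 := aestronglyMeasurable_of_continuousOn_Ioc hg.continuousOn_Ioc
    exact ((measurable_id.mul (measurable_deriv g)).aemeasurable.div
      h1.aemeasurable).aestronglyMeasurable
  · have h2 := hg.pos x ⟨hx.1, hx.2.le⟩
    rw [abs_div, abs_of_pos h2, div_le_iff₀ h2]
    exact hg.deriv_le x hx

/-! ### Absolute continuity away from the degenerate end -/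

/-- Absolute continuity on every `[δ,1]` with `0 < δ < 1`. -/
def LocAC (f : ℝ → ℝ) : Prop := ∀ δ ∈ Ioo (0 : ℝ) 1, AbsolutelyContinuousOnInterval f δ 1

theorem LocAC.mul {f g : ℝ → ℝ} (hf : LocAC f) (hg : LocAC g) : LocAC fun x => f x * g x :=
  fun δ hδ => (hf δ hδ).fun_mul (hg δ hδ)

theorem LocAC.add {f g : ℝ → ℝ} (hf : LocAC f) (hg : LocAC g) : LocAC fun x => f x + g x :=
  fun δ hδ => (hf δ hδ).fun_add (hg δ hδ)

theorem LocAC.sub {f g : ℝ → ℝ} (hf : LocAC f) (hg : LocAC g) : LocAC fun x => f x - g x :=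
  fun δ hδ => (hf δ hδ).fun_sub (hg δ hδ)

theorem LocAC.const_mul {f : ℝ → ℝ} (hf : LocAC f) (c : ℝ) : LocAC fun x => c * f x :=
  fun δ hδ => (hf δ hδ).const_mul c

theorem locAC_of_contDiffOn {f : ℝ → ℝ} (h : ∀ δ ∈ Ioo (0 : ℝ) 1, ContDiffOn ℝ 1 f (Icc δ 1)) :
    LocAC f :=
  fun δ hδ => absolutelyContinuousOnInterval_of_contDiffOn hδ.2.le (h δ hδ)

theorem IsH1Left.locAC {u : ℝ → ℝ} (hu : IsH1Left u) : LocAC u := fun _ hδ => hu.ac_Icc hδ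

theorem LocAC.continuousOn {f : ℝ → ℝ} (hf : LocAC f) : ContinuousOn f (Ioc 0 1) :=
  continuousOn_Ioc_of_c1 fun δ hδ => by
    simpa [uIcc_of_le hδ.2.le] using (hf δ hδ).continuousOn

theorem LocAC.ae_differentiableAt {f : ℝ → ℝ} (hf : LocAC f) :
    ∀ᵐ x ∂leb, DifferentiableAt ℝ f x := by
  have h : ∀ n : ℕ, ∀ᵐ x : ℝ, x ∈ uIcc ((1 : ℝ) / (n + 2)) 1 → DifferentiableAt ℝ f x := by
    intro n
    refine (hf _ ⟨by positivity, ?_⟩).ae_differentiableAt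
    rw [div_lt_one (by positivity)]; linarith [n.cast_nonneg (α := ℝ)]
  rw [leb, ae_restrict_iff' measurableSet_Ioo]
  filter_upwards [ae_all_iff.2 h] with x hx hm
  obtain ⟨n, hn⟩ := exists_nat_one_div_lt hm.1
  refine hx n ?_
  have h1 : (1 : ℝ) / (n + 2) ≤ x := by
    refine le_trans ?_ hn.le
    exact one_div_le_one_div_of_le (by positivity) (by linarith)
  rw [uIcc_of_le (h1.trans hm.2.le)]
  exact ⟨h1, hm.2.le⟩

/-! ### Integrals of weighted products -/

/-- `f` is integrable on `(0,1)` with integral `I`. -/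
structure HasInt (f : ℝ → ℝ) (I : ℝ) : Prop where
  integrable : Integrable f leb
  integral_eq : ∫ x, f x ∂leb = I

theorem HasInt.add {f g : ℝ → ℝ} {I J : ℝ} (hf : HasInt f I) (hg : HasInt g J) :
    HasInt (fun x => f x + g x) (I + J) :=
  ⟨hf.1.add hg.1, by rw [integral_add hf.1 hg.1, hf.2, hg.2]⟩

theorem HasInt.sub {f g : ℝ → ℝ} {I J : ℝ} (hf : HasInt f I) (hg : HasInt g J) :
    HasInt (fun x => f x - g x) (I - J) :=
  ⟨hf.1.sub hg.1, by rw [integral_sub hf.1 hg.1, hf.2, hg.2]⟩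

theorem HasInt.const_mul {f : ℝ → ℝ} {I : ℝ} (hf : HasInt f I) (r : ℝ) :
    HasInt (fun x => r * f x) (r * I) :=
  ⟨hf.1.const_mul r, by rw [integral_const_mul, hf.2]⟩

theorem HasInt.le {f g : ℝ → ℝ} {I J : ℝ} (hf : HasInt f I) (hg : HasInt g J)
    (h : ∀ᵐ x ∂leb, f x ≤ g x) : I ≤ J := by
  rw [← hf.2, ← hg.2]
  exact integral_mono_ae hf.1 hg.1 h

theorem HasInt.eq {f g : ℝ → ℝ} {I J : ℝ} (hf : HasInt f I) (hg : HasInt g J)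
    (h : ∀ᵐ x ∂leb, f x = g x) : I = J := by
  rw [← hf.2, ← hg.2]
  exact integral_congr_ae h

theorem memLp_top_mul {f g : ℝ → ℝ} (hf : MemLp f ⊤ leb) (hg : MemLp g ⊤ leb) :
    MemLp (fun x => f x * g x) ⊤ leb := MemLp.mul' hg hf

theorem memLp_top_id : MemLp (fun x : ℝ => x) ⊤ leb :=
  memLp_top_of_bound aestronglyMeasurable_id (C := 1) fun x hx => by
    rw [abs_of_pos hx.1]; exact hx.2.le

theorem memLp_top_const' (c : ℝ) : MemLp (fun _ : ℝ => c) ⊤ leb := memLp_top_const c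

theorem integrable_weight_mul {φ f g : ℝ → ℝ} (hφ : MemLp φ ⊤ leb) (hf : MemLp f 2 leb)
    (hg : MemLp g 2 leb) : Integrable (fun x => φ x * (f x * g x)) leb := by
  have h1 : MemLp (fun x => φ x * f x) 2 leb := MemLp.mul' hf hφ
  refine (h1.integrable_mul hg).congr (ae_of_all _ fun x => ?_)
  simp [mul_assoc]

theorem hasInt_wform {φ f g : ℝ → ℝ} (hφ : MemLp φ ⊤ leb) (hf : MemLp f 2 leb)
    (hg : MemLp g 2 leb) :
    HasInt (fun x => φ x * (f x * g x)) (wform φ (toL2 f) (toL2 g)) := by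
  refine ⟨integrable_weight_mul hφ hf hg, integral_congr_ae ?_⟩
  filter_upwards [coeFn_toL2 hf, coeFn_toL2 hg] with x h1 h2
  rw [h1, h2]

/-! ### Elements of the domain -/

theorem Coeffs.MemH1.isH1Left {p : Coeffs} {u : ℝ → ℝ} (hu : p.MemH1 u) : IsH1Left u :=
  ⟨hu.2.1, hu.2.2.1, hu.2.2.2.1⟩

theorem Coeffs.MemDom.isH1Left {p : Coeffs} {u : ℝ → ℝ} (hu : p.MemDom u) : IsH1Left u :=
  Coeffs.MemH1.isH1Left hu.1

theorem derivWithin_eq_deriv {u : ℝ → ℝ} {x : ℝ} (hx : x ∈ Ioo (0 : ℝ) 1) :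
    derivWithin u (Icc 0 1) x = deriv u x :=
  derivWithin_of_mem_nhds (Icc_mem_nhds hx.1 hx.2)

/-- An element of the domain is continuously differentiable on `(0,1]`. -/
theorem Coeffs.MemDom.hasDerivWithinAt {p : Coeffs} {u : ℝ → ℝ} (hu : p.MemDom u) {x : ℝ}
    (hx : x ∈ Ioc (0 : ℝ) 1) :
    HasDerivWithinAt u (derivWithin u (Icc 0 1) x) (Icc 0 1) x := by
  set φ := derivWithin u (Icc 0 1) with hφ
  set δ := x / 2 with hδ
  have hδ' : δ ∈ Ioo (0 : ℝ) 1 := ⟨by linarith [hx.1], by linarith [hx.1, hx.2]⟩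
  have hc : ContinuousOn φ (Icc δ 1) := by
    simpa [uIcc_of_le hδ'.2.le] using (hu.2.1 δ hδ').continuousOn
  set f : ℝ → ℝ := IccExtend hδ'.2.le ((Icc δ 1).domRestrict φ) with hf
  have hfc : Continuous f := (continuousOn_iff_continuous_domRestrict.1 hc).Icc_extend'
  have hfx : ∀ y ∈ Icc δ 1, f y = φ y := fun y hy => by
    rw [hf, IccExtend_of_mem hδ'.2.le _ hy]; rfl
  have hF : HasDerivAt (fun y => u δ + ∫ s in δ..y, f s) (f x) x :=
    (hfc.integral_hasStrictDerivAt δ x).hasDerivAt.const_add _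
  have hxm : x ∈ Icc δ 1 := ⟨by linarith [hx.1], hx.2⟩
  have heq : ∀ y ∈ Icc δ 1, u y = u δ + ∫ s in δ..y, f s := by
    intro y hy
    have hac : AbsolutelyContinuousOnInterval u δ y := by
      refine (hu.isH1Left.ac_Icc hδ').mono ?_
      rw [uIcc_of_le hy.1, uIcc_of_le hδ'.2.le]
      exact Icc_subset_Icc_right hy.2
    have h1 := hac.integral_deriv_eq_sub
    have h2 : ∫ s in δ..y, deriv u s = ∫ s in δ..y, f s := by
      refine intervalIntegral.integral_congr_ae ?_
      have h3 : ∀ᵐ s : ℝ, s ≠ 1 := by simp [ae_iff]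
      filter_upwards [h3] with s hs hm
      rw [uIoc_of_le hy.1] at hm
      have hs1 : s ∈ Ioo (0 : ℝ) 1 :=
        ⟨hδ'.1.trans hm.1, lt_of_le_of_ne (hm.2.trans hy.2) hs⟩
      rw [hfx s ⟨hm.1.le, hs1.2.le⟩, hφ, derivWithin_eq_deriv hs1]
    linarith
  have h4 : HasDerivWithinAt u (f x) (Icc δ 1) x :=
    hF.hasDerivWithinAt.congr heq (heq x hxm)
  rw [hfx x hxm] at h4
  refine h4.mono_of_mem_nhdsWithin ?_
  filter_upwards [self_mem_nhdsWithin,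
    mem_nhdsWithin_of_mem_nhds (Ioi_mem_nhds (by linarith [hx.1] : δ < x))] with y hy hy2
  exact ⟨le_of_lt hy2, hy.2⟩

theorem Coeffs.MemDom.hasDerivAt {p : Coeffs} {u : ℝ → ℝ} (hu : p.MemDom u) {x : ℝ}
    (hx : x ∈ Ioo (0 : ℝ) 1) : HasDerivAt u (derivWithin u (Icc 0 1) x) x :=
  (hu.hasDerivWithinAt ⟨hx.1, hx.2.le⟩).hasDerivAt (Icc_mem_nhds hx.1 hx.2)

theorem Coeffs.MemDom.ae_hasDerivAt_deriv {p : Coeffs} {u : ℝ → ℝ} (hu : p.MemDom u) :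
    ∀ᵐ x ∂leb, HasDerivAt (derivWithin u (Icc 0 1)) (deriv (deriv u) x) x := by
  have h : LocAC (derivWithin u (Icc 0 1)) := hu.2.1
  filter_upwards [h.ae_differentiableAt, ae_leb_mem] with x hx hm
  have h1 : derivWithin u (Icc 0 1) =ᶠ[𝓝 x] deriv u := by
    filter_upwards [Ioo_mem_nhds hm.1 hm.2] with y hy
    exact derivWithin_eq_deriv hy
  rw [← h1.deriv_eq]
  exact hx.hasDerivAt

/-! ### Normalized coefficients -/

namespace Coeffs

variable (p : Coeffs)

/-- `ρ = x / √σ`. -/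
def rho (x : ℝ) : ℝ := x / √(p.sigma x)

/-- `β = x b / a`, the logarithmic derivative of `η` with respect to `log x`. -/
def beta (x : ℝ) : ℝ := x * p.b x / p.a x

/-- `Y = λ x² / (a d)`, the potential relative to `1 / x²`. -/
def Y (x : ℝ) : ℝ := p.lam * x ^ 2 / (p.a x * p.d x)

/-- `u / √σ`, which belongs to `L²(0,1)` exactly when `u ∈ L²_{1/σ}(0,1)`. -/
def nrm (u : ℝ → ℝ) (x : ℝ) : ℝ := u x / √(p.sigma x)

/-- `ζ = u' - c u / x`. -/
def _root_.DegWave.zeta (c : ℝ) (u : ℝ → ℝ) (x : ℝ) : ℝ := deriv u x - c * (u x / x)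

/-- The derivative of `log g` with respect to `log x`. -/
def _root_.DegWave.logDer (g : ℝ → ℝ) (x : ℝ) : ℝ := x * deriv g x / g x

end Coeffs

theorem IsH1Left.memLp_zeta {u : ℝ → ℝ} (hu : IsH1Left u) (c : ℝ) : MemLp (zeta c u) 2 leb :=
  hu.memLp.sub (hu.memLp_div.const_mul c)

namespace Admissible

variable {p : Coeffs} {m : ℝ}

theorem memLp_rho (H : Admissible p m) : MemLp p.rho ⊤ leb := H.memLp_div_sqrt_sigma

theorem memLp_beta (H : Admissible p m) : MemLp p.beta ⊤ leb := H.memLp_b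

theorem memLp_Y' (H : Admissible p m) : MemLp p.Y ⊤ leb := H.memLp_Y

theorem memLp_ka (H : Admissible p m) : MemLp (logDer p.a) ⊤ leb := H.a_deg.memLp_log_deriv

theorem memLp_kd (H : Admissible p m) : MemLp (logDer p.d) ⊤ leb := H.d_deg.memLp_log_deriv

theorem nrm_mul_nrm (H : Admissible p m) {x : ℝ} (hx : x ∈ Ioo (0 : ℝ) 1) (u v : ℝ → ℝ) :
    p.nrm u x * p.nrm v x = u x * v x * p.eta x / p.a x := by
  have h := H.sigma_pos ⟨hx.1, hx.2.le⟩
  have h1 := Real.mul_self_sqrt h.le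
  rw [Coeffs.nrm, Coeffs.nrm, div_mul_div_comm, h1, Coeffs.sigma, div_div_eq_mul_div]

theorem rho_mul_nrm (H : Admissible p m) {x : ℝ} (hx : x ∈ Ioo (0 : ℝ) 1) (u : ℝ → ℝ) :
    p.rho x * p.nrm u x = x * u x * p.eta x / p.a x :=
  H.nrm_mul_nrm hx (fun x => x) u

theorem memLp_nrm (H : Admissible p m) {u : ℝ → ℝ} (hu : p.MemL2 u) :
    MemLp (p.nrm u) 2 leb := by
  have hs := aestronglyMeasurable_of_continuousOn_Ioc H.continuousOn_sigma
  refine (memLp_two_iff_integrable_sq ?_).2 ?_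
  · exact (hu.1.aestronglyMeasurable.aemeasurable.div
      hs.aemeasurable.sqrt).aestronglyMeasurable
  · refine hu.2.congr ?_
    filter_upwards [ae_leb_mem] with x hx
    rw [Coeffs.nrm, div_pow, Real.sq_sqrt (H.sigma_pos ⟨hx.1, hx.2.le⟩).le]

end Admissible

/-- A bounded weight, absolutely continuous on `(0,1]`, with bounded derivative `Θ'`. -/
structure IsWeight (Θ Θ' : ℝ → ℝ) : Prop where
  locAC : LocAC Θ
  hasDerivAt : ∀ᵐ x ∂leb, HasDerivAt Θ (Θ' x) x
  memLp_deriv : MemLp Θ' ⊤ leb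
  bound : ∃ C, ∀ x ∈ Ioo (0 : ℝ) 1, |Θ x| ≤ C

theorem IsWeight.memLp {Θ Θ' : ℝ → ℝ} (h : IsWeight Θ Θ') : MemLp Θ ⊤ leb := by
  obtain ⟨C, hC⟩ := h.bound
  exact memLp_top_of_bound (aestronglyMeasurable_of_continuousOn_Ioc h.locAC.continuousOn) hC

theorem isWeight_one : IsWeight (fun _ => 1) (fun _ => 0) where
  locAC := locAC_of_contDiffOn fun _ _ => contDiffOn_const
  hasDerivAt := ae_of_all _ fun x => hasDerivAt_const x 1
  memLp_deriv := memLp_top_const' 0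
  bound := ⟨1, fun _ _ => by simp⟩

/-! ### Multiplier identities -/

/-- The terms at `0` of the integrations by parts below are small along a sequence: `v² / x` and
`w² / x` tend to `0` there, and `x (w')²` is small at points arbitrarily close to `0`. -/
theorem frequently_small {p : Coeffs} {w v : ℝ → ℝ} (hw : p.MemDom w) (hv : p.MemH1 v)
    {G : ℝ → ℝ} {C : ℝ} (hC : ∀ x ∈ Ioo (0 : ℝ) 1,
      |G x| ≤ C * (v x ^ 2 / x + w x ^ 2 / x + x * derivWithin w (Icc 0 1) x ^ 2)) :
    ∀ ε > 0, ∃ᶠ x in 𝓝[>] (0 : ℝ), |G x| ≤ ε := by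
  intro ε hε
  set C' := max C 1 with hC'
  have hC0 : 0 < C' := one_pos.trans_le (le_max_right _ _)
  set r := ε / (3 * C') with hr
  have hr0 : 0 < r := by positivity
  have h1 : ∀ᶠ x in 𝓝[>] (0 : ℝ), v x ^ 2 / x < r :=
    hv.isH1Left.tendsto_sq_div.eventually (gt_mem_nhds hr0)
  have h2 : ∀ᶠ x in 𝓝[>] (0 : ℝ), w x ^ 2 / x < r :=
    hw.isH1Left.tendsto_sq_div.eventually (gt_mem_nhds hr0)
  have h3 := frequently_mul_sq_le hw.isH1Left.memLp.integrable_sq hr0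
  refine ((h3.and_eventually (h1.and h2)).and_eventually
    (Ioo_mem_nhdsGT (zero_lt_one (α := ℝ)))).mono ?_
  rintro x ⟨⟨hx3, hx1, hx2⟩, hx⟩
  rw [← derivWithin_eq_deriv hx] at hx3
  have hx0 : 0 < x := hx.1
  have hnn : 0 ≤ v x ^ 2 / x + w x ^ 2 / x + x * derivWithin w (Icc 0 1) x ^ 2 := by positivity
  calc |G x| ≤ _ := hC x hx
    _ ≤ C' * (v x ^ 2 / x + w x ^ 2 / x + x * derivWithin w (Icc 0 1) x ^ 2) :=
        mul_le_mul_of_nonneg_right (le_max_left _ _) hnn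
    _ ≤ C' * (3 * r) := mul_le_mul_of_nonneg_left (by linarith) hC0.le
    _ = ε := by rw [hr]; field_simp

theorem abs_mul_le_sq_div_add (x : ℝ) (hx : 0 < x) (s t : ℝ) :
    |s * t| ≤ s ^ 2 / x + x * t ^ 2 := by
  have h1 : s ^ 2 / x = x * (s / x) ^ 2 := by field_simp
  have h2 : s * t = x * ((s / x) * t) := by field_simp
  rw [h1, h2, abs_mul, abs_of_pos hx, abs_mul, ← mul_add]
  refine mul_le_mul_of_nonneg_left ?_ hx.le
  nlinarith [sq_nonneg (|s / x| - |t|), sq_abs (s / x), sq_abs t, sq_nonneg (s / x), sq_nonneg t]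

namespace Admissible

variable {p : Coeffs} {m : ℝ}

theorem ae_hasDerivAt_data (H : Admissible p m) {w v : ℝ → ℝ} (hw : p.MemDom w)
    (hv : p.MemH1 v) : ∀ᵐ x ∂leb, x ∈ Ioo (0 : ℝ) 1 ∧
      HasDerivAt w (derivWithin w (Icc 0 1) x) x ∧ HasDerivAt v (deriv v x) x ∧
      HasDerivAt (derivWithin w (Icc 0 1)) (deriv (deriv w) x) x ∧
      HasDerivAt p.a (deriv p.a x) x ∧ HasDerivAt p.d (deriv p.d x) x ∧
      HasDerivAt p.eta (p.eta x * (p.b x / p.a x)) x := by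
  filter_upwards [ae_leb_mem, hv.isH1Left.ae_hasDerivAt, hw.ae_hasDerivAt_deriv] with x hx h1 h2
  exact ⟨hx, hw.hasDerivAt hx, h1, h2, H.hasDerivAt_a hx, H.hasDerivAt_d hx, H.hasDerivAt_eta hx⟩

/-- The identity obtained by multiplying the equation by `Θ η (x w' - c w) / a` and integrating,
in terms of the function whose derivative it integrates. -/
theorem multiplier_identity (H : Admissible p m) {w v Θ Θ' : ℝ → ℝ} (hw : p.MemDom w)
    (hv : p.MemH1 v) (hΘ : IsWeight Θ Θ') (c : ℝ) :
    HasInt (fun x => (Θ x * p.rho x) * (zeta c v x * p.nrm v x)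
      + (Θ x * p.rho x) * (zeta c w x * p.nrm (p.op w) x)
      + (1 / 2 * (x * Θ' x + Θ x * (1 - logDer p.a x + p.beta x + 2 * c)))
        * (p.nrm v x * p.nrm v x)
      + (1 / 2 * ((x * Θ' x + Θ x * (1 - p.beta x - 2 * c)) * p.eta x))
        * (deriv w x * deriv w x)
      - (c * (x * Θ' x * p.eta x)) * (w x / x * deriv w x)
      + (1 / 2 * ((x * Θ' x + Θ x * (1 - logDer p.a x + p.beta x - logDer p.d x + 2 * c))
        * (p.eta x * p.Y x))) * (w x / x * (w x / x)))
      (1 / 2 * (Θ 1 * p.eta 1 * derivWithin w (Icc 0 1) 1 ^ 2)) := by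
  have hΘm := hΘ.memLp
  have hxΘ := memLp_top_mul memLp_top_id hΘ.memLp_deriv
  have hηm := H.memLp_eta
  have hγ := hw.isH1Left.memLp_div
  have hPv := H.memLp_nrm hv.1
  have hPo := H.memLp_nrm hw.2.2
  have hφ := hw.isH1Left.memLp
  have hρ := memLp_top_mul hΘm H.memLp_rho
  have hw1 : w 1 = 0 := hw.1.2.2.2.2
  have hv1 : v 1 = 0 := hv.2.2.2.2
  have hI : Integrable (fun x => (Θ x * p.rho x) * (zeta c v x * p.nrm v x)
      + (Θ x * p.rho x) * (zeta c w x * p.nrm (p.op w) x)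
      + (1 / 2 * (x * Θ' x + Θ x * (1 - logDer p.a x + p.beta x + 2 * c)))
        * (p.nrm v x * p.nrm v x)
      + (1 / 2 * ((x * Θ' x + Θ x * (1 - p.beta x - 2 * c)) * p.eta x))
        * (deriv w x * deriv w x)
      - (c * (x * Θ' x * p.eta x)) * (w x / x * deriv w x)
      + (1 / 2 * ((x * Θ' x + Θ x * (1 - logDer p.a x + p.beta x - logDer p.d x + 2 * c))
        * (p.eta x * p.Y x))) * (w x / x * (w x / x))) leb := by
    refine (((((integrable_weight_mul hρ (hv.isH1Left.memLp_zeta c) hPv).add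
      (integrable_weight_mul hρ (hw.isH1Left.memLp_zeta c) hPo)).add
      (integrable_weight_mul ?_ hPv hPv)).add (integrable_weight_mul ?_ hφ hφ)).sub
      (integrable_weight_mul ?_ hγ hφ)).add (integrable_weight_mul ?_ hγ hγ)
    · exact (hxΘ.add (memLp_top_mul hΘm ((((memLp_top_const' 1).sub H.memLp_ka).add
        H.memLp_beta).add (memLp_top_const' (2 * c))))).const_mul _
    · exact (memLp_top_mul (hxΘ.add (memLp_top_mul hΘm (((memLp_top_const' 1).sub
        H.memLp_beta).sub (memLp_top_const' (2 * c))))) hηm).const_mul _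
    · exact (memLp_top_mul hxΘ hηm).const_mul _
    · exact (memLp_top_mul (hxΘ.add (memLp_top_mul hΘm (((((memLp_top_const' 1).sub
        H.memLp_ka).add H.memLp_beta).sub H.memLp_kd).add (memLp_top_const' (2 * c)))))
        (memLp_top_mul hηm H.memLp_Y')).const_mul _
  refine ⟨hI, ?_⟩
  set φ := derivWithin w (Icc 0 1) with hφd
  set G : ℝ → ℝ := fun x => Θ x * p.eta x * (1 / 2 * (x / p.a x) * (v x * v x)
    + 1 / 2 * (x * (φ x * φ x)) - c * (w x * φ x)
    + 1 / 2 * p.lam * (x / (p.a x * p.d x)) * (w x * w x)) with hG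
  have hG1 : G 1 = 1 / 2 * (Θ 1 * p.eta 1 * φ 1 ^ 2) := by
    simp only [hG, hw1, hv1]; ring
  rw [← hG1]
  have hpa : ∀ δ ∈ Ioo (0 : ℝ) 1, ∀ x ∈ Icc δ 1, p.a x ≠ 0 := fun δ hδ x hx =>
    (H.a_deg.pos x ⟨hδ.1.trans_le hx.1, hx.2⟩).ne'
  have hpd : ∀ δ ∈ Ioo (0 : ℝ) 1, ∀ x ∈ Icc δ 1, p.d x ≠ 0 := fun δ hδ x hx =>
    (H.d_deg.pos x ⟨hδ.1.trans_le hx.1, hx.2⟩).ne'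
  refine integral_leb_of_hasDerivAt ?_ hI ?_ ?_
  · have hxa : LocAC fun x => x / p.a x := locAC_of_contDiffOn fun δ hδ =>
      contDiffOn_id.div (H.a_deg.c1 δ hδ) (hpa δ hδ)
    have hxad : LocAC fun x => x / (p.a x * p.d x) := locAC_of_contDiffOn fun δ hδ =>
      contDiffOn_id.div ((H.a_deg.c1 δ hδ).mul (H.d_deg.c1 δ hδ))
        fun x hx => mul_ne_zero (hpa δ hδ x hx) (hpd δ hδ x hx)
    have hη : LocAC p.eta := locAC_of_contDiffOn fun δ hδ => H.eta_c1 hδ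
    have hx : LocAC fun x => x := locAC_of_contDiffOn fun δ hδ => contDiffOn_id
    have hφc : LocAC φ := hw.2.1
    have hwc := hw.isH1Left.locAC
    have hvc := hv.isH1Left.locAC
    exact (hΘ.locAC.mul hη).mul (((((hxa.const_mul _).mul (hvc.mul hvc)).add
      ((hx.mul (hφc.mul hφc)).const_mul _)).sub ((hwc.mul hφc).const_mul _)).add
      ((hxad.const_mul _).mul (hwc.mul hwc)))
  · filter_upwards [H.ae_hasDerivAt_data hw hv, hΘ.hasDerivAt] with x hx hΘx
    obtain ⟨hx, dw, dv, dφ, da, dd, dη⟩ := hx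
    have ha : p.a x ≠ 0 := (H.a_pos hx).ne'
    have hd : p.d x ≠ 0 := (H.d_pos hx).ne'
    have hx0 : x ≠ 0 := hx.1.ne'
    have dx := hasDerivAt_id' x
    have key := (hΘx.fun_mul dη).fun_mul (((((dx.fun_div da ha).const_mul (1 / 2)).fun_mul
      (dv.fun_mul dv)).fun_add ((dx.fun_mul (dφ.fun_mul dφ)).const_mul (1 / 2))).fun_sub
      ((dw.fun_mul dφ).const_mul c) |>.fun_add (((dx.fun_div (da.fun_mul dd)
      (mul_ne_zero ha hd)).const_mul (1 / 2 * p.lam)).fun_mul (dw.fun_mul dw)))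
    refine key.congr_deriv ?_
    have e1 : ∀ f, Θ x * p.rho x * (f * p.nrm v x)
        = Θ x * f * (x * v x * p.eta x / p.a x) := fun f => by
      rw [← H.rho_mul_nrm hx]; ring
    have e2 : ∀ f, Θ x * p.rho x * (f * p.nrm (p.op w) x)
        = Θ x * f * (x * p.op w x * p.eta x / p.a x) := fun f => by
      rw [← H.rho_mul_nrm hx]; ring
    rw [e1, e2, H.nrm_mul_nrm hx]
    simp only [zeta, logDer, Coeffs.beta, Coeffs.Y, Coeffs.op, derivWithin_eq_deriv (u := w) hx]
    field_simp
    ring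
  · obtain ⟨C, hC⟩ := hΘ.bound
    obtain ⟨e₀, e₁, he0, he1, he⟩ := H.exists_eta_bounds
    obtain ⟨CY, hCY⟩ := H.exists_Y_bound
    set A := 1 ^ 2 / p.a 1 with hA
    have hA0 : 0 ≤ A := div_nonneg (by norm_num) (H.a_deg.pos 1 one_mem_Ioc).le
    refine frequently_small hw hv (C := C * e₁ * (A + 1 + |c| + CY)) fun x hx => ?_
    have hx0 : 0 < x := hx.1
    have ha := H.a_pos hx
    have hd := H.d_pos hx
    have hC0 : 0 ≤ C := (abs_nonneg _).trans (hC x hx)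
    have hY0 : 0 ≤ CY := (abs_nonneg _).trans (hCY x hx)
    have hAx : x ^ 2 / p.a x ≤ A := H.monotoneOn_sq_div_a ⟨hx.1, hx.2.le⟩ one_mem_Ioc hx.2.le
    simp only [hG]
    rw [abs_mul, abs_mul, abs_of_pos (p.eta_pos x), mul_assoc (C * e₁)]
    refine mul_le_mul (mul_le_mul (hC x hx) (he x ⟨hx.1.le, hx.2.le⟩).2 (p.eta_pos x).le hC0)
      ?_ (abs_nonneg _) (mul_nonneg hC0 he1.le)
    set S := v x ^ 2 / x + w x ^ 2 / x + x * φ x ^ 2 with hS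
    have s1 : 0 ≤ v x ^ 2 / x := by positivity
    have s2 : 0 ≤ w x ^ 2 / x := by positivity
    have s3 : 0 ≤ x * φ x ^ 2 := by positivity
    have b1 : |1 / 2 * (x / p.a x) * (v x * v x)| ≤ A * S := by
      have : 1 / 2 * (x / p.a x) * (v x * v x) = 1 / 2 * ((x ^ 2 / p.a x) * (v x ^ 2 / x)) := by
        field_simp
      rw [this, abs_of_nonneg (by positivity)]
      have h1 := mul_le_mul hAx (by linarith : v x ^ 2 / x ≤ S) s1 hA0
      have h2 : 0 ≤ A * S := mul_nonneg hA0 (by linarith)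
      linarith
    have b2 : |1 / 2 * (x * (φ x * φ x))| ≤ S := by
      rw [abs_of_nonneg (by have := mul_self_nonneg (φ x); positivity), ← pow_two]
      linarith
    have b3 : |c * (w x * φ x)| ≤ |c| * S := by
      rw [abs_mul]
      refine mul_le_mul_of_nonneg_left ((abs_mul_le_sq_div_add x hx0 _ _).trans ?_) (abs_nonneg _)
      linarith
    have b4 : |1 / 2 * p.lam * (x / (p.a x * p.d x)) * (w x * w x)| ≤ CY * S := by
      have : 1 / 2 * p.lam * (x / (p.a x * p.d x)) * (w x * w x)
          = 1 / 2 * ((p.lam * x ^ 2 / (p.a x * p.d x)) * (w x ^ 2 / x)) := by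
        field_simp
      rw [this, abs_mul, abs_mul, abs_of_nonneg s2, abs_of_pos (by norm_num : (0 : ℝ) < 1 / 2)]
      have h1 := mul_le_mul (hCY x hx) (by linarith : w x ^ 2 / x ≤ S) s2 hY0
      have h2 : 0 ≤ CY * S := mul_nonneg hY0 (by linarith)
      linarith
    refine (abs_add_le _ _).trans ((add_le_add ((abs_sub _ _).trans (add_le_add
      ((abs_add_le _ _).trans (add_le_add b1 b2)) b3)) b4).trans ?_)
    linarith [hS]

/-- The identity for the flux of energy `Θ η v (w' - c w / x)`. -/
theorem energy_flux_identity (H : Admissible p m) {w v Θ Θ' : ℝ → ℝ} (hw : p.MemDom w)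
    (hv : p.MemH1 v) (hΘ : IsWeight Θ Θ') (c : ℝ) :
    HasInt (fun x => Θ x * (p.nrm v x * p.nrm (p.op w) x)
      + (Θ x * p.eta x) * (zeta c w x * zeta c v x)
      + (Θ x * (p.eta x * (c * (1 - c - p.beta x) - p.Y x))) * (w x / x * (v x / x))
      + (x * Θ' x * p.eta x) * (zeta c w x * (v x / x))) 0 := by
  have hΘm := hΘ.memLp
  have hxΘ := memLp_top_mul memLp_top_id hΘ.memLp_deriv
  have hηm := H.memLp_eta
  have hγ := hw.isH1Left.memLp_div
  have hγv := hv.isH1Left.memLp_div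
  have hw1 : w 1 = 0 := hw.1.2.2.2.2
  have hv1 : v 1 = 0 := hv.2.2.2.2
  have hI : Integrable (fun x => Θ x * (p.nrm v x * p.nrm (p.op w) x)
      + (Θ x * p.eta x) * (zeta c w x * zeta c v x)
      + (Θ x * (p.eta x * (c * (1 - c - p.beta x) - p.Y x))) * (w x / x * (v x / x))
      + (x * Θ' x * p.eta x) * (zeta c w x * (v x / x))) leb := by
    refine (((integrable_weight_mul hΘm (H.memLp_nrm hv.1) (H.memLp_nrm hw.2.2)).add
      (integrable_weight_mul (memLp_top_mul hΘm hηm) (hw.isH1Left.memLp_zeta c)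
        (hv.isH1Left.memLp_zeta c))).add (integrable_weight_mul ?_ hγ hγv)).add
      (integrable_weight_mul (memLp_top_mul hxΘ hηm) (hw.isH1Left.memLp_zeta c) hγv)
    exact memLp_top_mul hΘm (memLp_top_mul hηm
      (((((memLp_top_const' 1).sub (memLp_top_const' c)).sub H.memLp_beta).const_mul c).sub
        H.memLp_Y'))
  refine ⟨hI, ?_⟩
  set φ := derivWithin w (Icc 0 1) with hφd
  set G : ℝ → ℝ := fun x => Θ x * p.eta x * (v x * (φ x - c * (w x * x⁻¹))) with hG
  have hG1 : G 1 = 0 := by simp [hG, hv1]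
  rw [← hG1]
  refine integral_leb_of_hasDerivAt ?_ hI ?_ ?_
  · have hη : LocAC p.eta := locAC_of_contDiffOn fun δ hδ => H.eta_c1 hδ
    have hx : LocAC fun x : ℝ => x⁻¹ := locAC_of_contDiffOn fun δ hδ =>
      contDiffOn_id.inv fun x hx => (hδ.1.trans_le hx.1).ne'
    have hφc : LocAC φ := hw.2.1
    have hwc := hw.isH1Left.locAC
    have hvc := hv.isH1Left.locAC
    exact (hΘ.locAC.mul hη).mul (hvc.mul (hφc.sub ((hwc.mul hx).const_mul _)))
  · filter_upwards [H.ae_hasDerivAt_data hw hv, hΘ.hasDerivAt] with x hx hΘx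
    obtain ⟨hx, dw, dv, dφ, da, dd, dη⟩ := hx
    have ha : p.a x ≠ 0 := (H.a_pos hx).ne'
    have hd : p.d x ≠ 0 := (H.d_pos hx).ne'
    have hx0 : x ≠ 0 := hx.1.ne'
    have key := (hΘx.fun_mul dη).fun_mul (dv.fun_mul (dφ.fun_sub
      ((dw.fun_mul (hasDerivAt_inv hx0)).const_mul c)))
    refine key.congr_deriv ?_
    rw [H.nrm_mul_nrm hx]
    simp only [zeta, Coeffs.beta, Coeffs.Y, Coeffs.op, derivWithin_eq_deriv (u := w) hx]
    field_simp
    ring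
  · obtain ⟨C, hC⟩ := hΘ.bound
    obtain ⟨e₀, e₁, he0, he1, he⟩ := H.exists_eta_bounds
    refine frequently_small hw hv (C := C * e₁ * (1 + |c|)) fun x hx => ?_
    have hx0 : 0 < x := hx.1
    have hC0 : 0 ≤ C := (abs_nonneg _).trans (hC x hx)
    simp only [hG]
    rw [abs_mul, abs_mul, abs_of_pos (p.eta_pos x), mul_assoc (C * e₁)]
    refine mul_le_mul (mul_le_mul (hC x hx) (he x ⟨hx.1.le, hx.2.le⟩).2 (p.eta_pos x).le hC0)
      ?_ (abs_nonneg _) (mul_nonneg hC0 he1.le)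
    set S := v x ^ 2 / x + w x ^ 2 / x + x * φ x ^ 2 with hS
    have s1 : 0 ≤ v x ^ 2 / x := by positivity
    have s2 : 0 ≤ w x ^ 2 / x := by positivity
    have s3 : 0 ≤ x * φ x ^ 2 := by positivity
    have b1 : |v x * φ x| ≤ S := (abs_mul_le_sq_div_add x hx0 _ _).trans (by linarith)
    have b2 : |v x * (w x * x⁻¹)| ≤ S := by
      refine (abs_mul_le_sq_div_add x hx0 _ _).trans ?_
      have : x * (w x * x⁻¹) ^ 2 = w x ^ 2 / x := by field_simp
      rw [this]; linarith
    have e : v x * (φ x - c * (w x * x⁻¹)) = v x * φ x - c * (v x * (w x * x⁻¹)) := by ring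
    rw [e]
    refine (abs_sub _ _).trans ?_
    rw [abs_mul c]
    have := mul_le_mul_of_nonneg_left b2 (abs_nonneg c)
    linarith

/-- Completing the square in the Dirichlet energy with Hardy's multiplier `c / x`. -/
theorem energy_identity (H : Admissible p m) {w : ℝ → ℝ} (hw : p.MemH1 w) (c : ℝ) :
    HasInt (fun x => p.eta x * (deriv w x * deriv w x) - p.eta x * (zeta c w x * zeta c w x)
      - (p.eta x * (c * (1 - c - p.beta x))) * (w x / x * (w x / x))) 0 := by
  have hηm := H.memLp_eta
  have hL := hw.isH1Left
  have hγ := hL.memLp_div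
  have hφ := hL.memLp
  have hz := hL.memLp_zeta c
  have hw1 : w 1 = 0 := hw.2.2.2.2
  have hI : Integrable (fun x => p.eta x * (deriv w x * deriv w x)
      - p.eta x * (zeta c w x * zeta c w x)
      - (p.eta x * (c * (1 - c - p.beta x))) * (w x / x * (w x / x))) leb := by
    refine ((integrable_weight_mul hηm hφ hφ).sub (integrable_weight_mul hηm hz hz)).sub
      (integrable_weight_mul ?_ hγ hγ)
    exact memLp_top_mul hηm
      ((((memLp_top_const' 1).sub (memLp_top_const' c)).sub H.memLp_beta).const_mul c)
  refine ⟨hI, ?_⟩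
  set G : ℝ → ℝ := fun x => c * (p.eta x * (w x * w x * x⁻¹)) with hG
  have hG1 : G 1 = 0 := by simp [hG, hw1]
  rw [← hG1]
  refine integral_leb_of_hasDerivAt ?_ hI ?_ ?_
  · have hη : LocAC p.eta := locAC_of_contDiffOn fun δ hδ => H.eta_c1 hδ
    have hx : LocAC fun x : ℝ => x⁻¹ := locAC_of_contDiffOn fun δ hδ =>
      contDiffOn_id.inv fun x hx => (hδ.1.trans_le hx.1).ne'
    exact (hη.mul ((hL.locAC.mul hL.locAC).mul hx)).const_mul _
  · filter_upwards [ae_leb_mem, hL.ae_hasDerivAt] with x hx dw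
    have ha : p.a x ≠ 0 := (H.a_pos hx).ne'
    have hx0 : x ≠ 0 := hx.1.ne'
    have key := ((H.hasDerivAt_eta hx).fun_mul ((dw.fun_mul dw).fun_mul
      (hasDerivAt_inv hx0))).const_mul c
    refine key.congr_deriv ?_
    simp only [zeta, Coeffs.beta]
    field_simp
    ring
  · obtain ⟨e₀, e₁, he0, he1, he⟩ := H.exists_eta_bounds
    intro ε hε
    have h1 : Tendsto (fun x => |c| * (e₁ * (w x ^ 2 / x))) (𝓝[>] 0) (𝓝 0) := by
      simpa using (hL.tendsto_sq_div.const_mul e₁).const_mul |c|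
    refine Eventually.frequently ?_
    filter_upwards [h1.eventually (gt_mem_nhds hε), Ioo_mem_nhdsGT (zero_lt_one (α := ℝ))]
      with x hx1 hx
    have hx0 : 0 < x := hx.1
    refine le_trans ?_ hx1.le
    simp only [hG]
    rw [abs_mul, ← pow_two, ← div_eq_mul_inv]
    refine mul_le_mul_of_nonneg_left ?_ (abs_nonneg c)
    rw [abs_of_nonneg (mul_nonneg (p.eta_pos x).le (by positivity))]
    exact mul_le_mul_of_nonneg_right (he x ⟨hx.1.le, hx.2.le⟩).2 (by positivity)

end Admissible

/-! ### The multiplier inequality at a fixed time -/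

/-- The quadratic form by which the flux of energy through a moving front exceeds the flux of
momentum is nonnegative, left of the switching point. -/
theorem flux_nonneg_left {x s c k Y e Θt P Z G : ℝ} (hΘ : 0 ≤ Θt) (hk : x / s ≤ k)
    (hx : 0 ≤ x / s) (hY : Y ≤ c ^ 2) (he : c ^ 2 ≤ e) :
    0 ≤ k * (1 / 2 * Θt * (P ^ 2 + Z ^ 2 + (e - Y) * G ^ 2)) - Θt * (x / s) * Z * P := by
  have hk0 : 0 ≤ k := hx.trans hk
  have h1 : 0 ≤ k * ((e - Y) * G ^ 2) :=
    mul_nonneg hk0 (mul_nonneg (by linarith) (sq_nonneg _))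
  have h2 : (x / s) * (Z * P) ≤ (x / s) * (1 / 2 * (P ^ 2 + Z ^ 2)) :=
    mul_le_mul_of_nonneg_left (by nlinarith [sq_nonneg (Z - P)]) hx
  have h3 : (x / s) * (1 / 2 * (P ^ 2 + Z ^ 2)) ≤ k * (1 / 2 * (P ^ 2 + Z ^ 2)) :=
    mul_le_mul_of_nonneg_right hk (by positivity)
  have h4 := mul_nonneg hΘ
    (by linarith : 0 ≤ k * (1 / 2 * (P ^ 2 + Z ^ 2)) - (x / s) * (Z * P)
      + 1 / 2 * (k * ((e - Y) * G ^ 2)))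
  linarith [h4]

/-- The same, right of the switching point. The coefficient of `P ^ 2 + Z ^ 2` exceeds that of
`Z * P` by `(τ' s - 1) (x / s - k)`. -/
theorem flux_nonneg_right {x s c k Y e Θt τ P Z G : ℝ} (hΘ : 0 ≤ Θt) (hk0 : 0 ≤ k)
    (hs : 0 < s) (hk : k ≤ x / s) (hτ : 1 ≤ τ * s) (hY : c ^ 2 ≤ Y) (he : c ^ 2 ≤ e) :
    0 ≤ 1 / 2 * (x * (τ * Θt)) * (P ^ 2 + Z ^ 2 + (Y - c ^ 2) * G ^ 2)
      + k * (1 / 2 * Θt * (P ^ 2 + Z ^ 2 + (e - Y) * G ^ 2) - (τ * Θt) * s * Z * P)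
      - Θt * (x / s) * Z * P := by
  set r := x / s with hr
  have hx : x = r * s := by rw [hr]; field_simp
  have hr0 : 0 ≤ r := hk0.trans hk
  have h0 : 0 ≤ (τ * s - 1) * (r - k) := mul_nonneg (by linarith) (by linarith)
  have hxτ : k ≤ r * (τ * s) := hk.trans (le_mul_of_one_le_right hr0 hτ)
  have h1 : 0 ≤ (r * (τ * s) * (Y - c ^ 2) + k * (e - Y)) * G ^ 2 := by
    refine mul_nonneg ?_ (sq_nonneg _)
    have a1 := mul_le_mul_of_nonneg_right hxτ (by linarith : 0 ≤ Y - c ^ 2)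
    have a2 := mul_le_mul_of_nonneg_left he hk0
    linarith
  have hco : 0 ≤ r + k * (τ * s) := add_nonneg hr0 (mul_nonneg hk0 (by linarith))
  have h2 : (r + k * (τ * s)) * (Z * P) ≤ (r * (τ * s) + k) * (1 / 2 * (P ^ 2 + Z ^ 2)) := by
    refine (mul_le_mul_of_nonneg_left (by nlinarith [sq_nonneg (Z - P)] :
      Z * P ≤ 1 / 2 * (P ^ 2 + Z ^ 2)) hco).trans ?_
    exact mul_le_mul_of_nonneg_right (by linarith) (by positivity)
  have h3 := mul_nonneg hΘ (by linarith :
    0 ≤ (r * (τ * s) + k) * (1 / 2 * (P ^ 2 + Z ^ 2)) - (r + k * (τ * s)) * (Z * P)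
      + 1 / 2 * ((r * (τ * s) * (Y - c ^ 2) + k * (e - Y)) * G ^ 2))
  rw [hx]
  linarith [h3]

namespace Coeffs

variable (p : Coeffs)

/-- The constant `c = K_a / 4` of the multiplier `x w' - c w`. -/
def cst : ℝ := degConst p.a / 4

/-- The weight of `(w / x)²` in the energy, once the square is completed. -/
def kap (x : ℝ) : ℝ := p.eta x * (p.cst * (1 - p.cst - p.beta x) - p.Y x)

/-- The momentum `∫ Θ x ζ v / σ`, in terms of `Z = ζ` and `P = v / √σ`. -/
def momentum (Θ : ℝ → ℝ) (Z P : L2) : ℝ := wform (fun x => Θ x * p.rho x) Z P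

/-- The energy localized by the weight `Θ`, in terms of `Z = ζ`, `P = v / √σ` and `G = w / x`. -/
def locEnergy (Θ : ℝ → ℝ) (Z P G : L2) : ℝ :=
  1 / 2 * (wform Θ P P + wform (fun x => Θ x * p.eta x) Z Z
    + wform (fun x => Θ x * p.kap x) G G)

/-- The admissible behaviour of a moving front at a point `x`, where the weight has space
derivative `Θx` and time derivative `Θt`: either the front has infinite speed, or its speed
`1 / τ'` is at most the speed `√a` of propagation. The two regimes are separated by the value of the
potential. -/
def Front (k : ℝ) (Θ Θx Θt : ℝ → ℝ) (x : ℝ) : Prop :=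
  0 ≤ Θ x ∧ 0 ≤ Θt x ∧
    ((Θx x = 0 ∧ x / √(p.a x) ≤ k ∧ p.Y x ≤ p.cst ^ 2) ∨
      ∃ τ : ℝ, Θx x = τ * Θt x ∧ 1 ≤ τ * √(p.a x) ∧ k ≤ x / √(p.a x) ∧ p.cst ^ 2 ≤ p.Y x)

end Coeffs

theorem wform_congr {φ ψ : ℝ → ℝ} (h : ∀ᵐ x ∂leb, φ x = ψ x) (F G : L2) :
    wform φ F G = wform ψ F G := by
  refine integral_congr_ae ?_
  filter_upwards [h] with x hx
  rw [hx]

theorem wform_self_nonneg {φ : ℝ → ℝ} (h : ∀ᵐ x ∂leb, 0 ≤ φ x) (F : L2) : 0 ≤ wform φ F F := by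
  refine integral_nonneg_of_ae ?_
  filter_upwards [h] with x hx
  exact mul_nonneg hx (mul_self_nonneg _)

namespace Admissible

variable {p : Coeffs} {m : ℝ}

theorem memLp_kap (H : Admissible p m) : MemLp p.kap ⊤ leb :=
  memLp_top_mul H.memLp_eta
    (((((memLp_top_const' 1).sub (memLp_top_const' p.cst)).sub H.memLp_beta).const_mul p.cst).sub
      H.memLp_Y')

theorem cst_pos (H : Admissible p m) : 0 < p.cst := div_pos H.a_deg.deg_pos (by norm_num)

theorem Y_nonneg (H : Admissible p m) {x : ℝ} (hx : x ∈ Ioo (0 : ℝ) 1) : 0 ≤ p.Y x :=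
  div_nonneg (mul_nonneg H.lam_nonneg (sq_nonneg _)) (mul_pos (H.a_pos hx) (H.d_pos hx)).le

theorem logDer_a_le (H : Admissible p m) {x : ℝ} (hx : x ∈ Ioo (0 : ℝ) 1) :
    logDer p.a x ≤ degConst p.a := by
  rw [logDer, div_le_iff₀ (H.a_pos hx)]
  exact (le_abs_self _).trans (H.a_deg.deriv_le x hx)

theorem logDer_d_le (H : Admissible p m) {x : ℝ} (hx : x ∈ Ioo (0 : ℝ) 1) :
    logDer p.d x ≤ degConst p.d := by
  rw [logDer, div_le_iff₀ (H.d_pos hx)]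
  exact (le_abs_self _).trans (H.d_deg.deriv_le x hx)

/-- The lower order part of the multiplier identity is at least `C₆` times the energy density. -/
theorem density_ge (H : Admissible p m) {x : ℝ} (hx : x ∈ Ioo (0 : ℝ) 1)
    (hβ : |p.beta x| ≤ m) (P φ γ : ℝ) :
    1 / 2 * p.C6 m * (P * P + p.eta x * (φ * φ)) ≤
      1 / 2 * ((1 - logDer p.a x + p.beta x + 2 * p.cst) * (P * P)
        + (1 - p.beta x - 2 * p.cst) * (p.eta x * (φ * φ))
        + (1 - logDer p.a x + p.beta x - logDer p.d x + 2 * p.cst)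
          * (p.eta x * p.Y x * (γ * γ))) := by
  have h1 := H.logDer_a_le hx
  have h2 := H.logDer_d_le hx
  have h3 := abs_le.1 hβ
  have h4 := H.deg_d_le_C6
  have hη := p.eta_pos x
  unfold Coeffs.C6 Coeffs.cst at *
  have b1 := mul_le_mul_of_nonneg_right
    (by linarith : 1 - degConst p.a / 2 - m ≤
      1 - logDer p.a x + p.beta x + 2 * (degConst p.a / 4)) (mul_self_nonneg P)
  have b2 := mul_le_mul_of_nonneg_right
    (by linarith : 1 - degConst p.a / 2 - m ≤
      1 - p.beta x - 2 * (degConst p.a / 4)) (mul_nonneg hη.le (mul_self_nonneg φ))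
  have b3 := mul_nonneg
    (by linarith : 0 ≤ 1 - logDer p.a x + p.beta x - logDer p.d x + 2 * (degConst p.a / 4))
    (mul_nonneg (mul_nonneg hη.le (H.Y_nonneg hx)) (mul_self_nonneg γ))
  linarith

/-- The flux of momentum through the front is dominated by `k` times the flux of energy. -/
theorem front_flux_nonneg (H : Admissible p m) {x : ℝ} (hx : x ∈ Ioo (0 : ℝ) 1)
    (hβ : |p.beta x| ≤ m) {k : ℝ} (hk : 0 ≤ k) {Θ Θx Θt : ℝ → ℝ} (hF : p.Front k Θ Θx Θt x)
    (v : ℝ → ℝ) (Z γ : ℝ) :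
    0 ≤ 1 / 2 * (x * Θx x) * (p.nrm v x * p.nrm v x + p.eta x * (Z * Z)
        + p.eta x * (p.Y x - p.cst ^ 2) * (γ * γ))
      - Θt x * p.rho x * (Z * p.nrm v x)
      + k * (1 / 2 * (Θt x * (p.nrm v x * p.nrm v x) + Θt x * p.eta x * (Z * Z)
          + Θt x * p.kap x * (γ * γ)) - x * Θx x * p.eta x * (Z * (v x / x))) := by
  have ha := H.a_pos hx
  have hs : 0 < √(p.a x) := Real.sqrt_pos.2 ha
  have hss : p.a x = √(p.a x) ^ 2 := (Real.sq_sqrt ha.le).symm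
  have hη := p.eta_pos x
  have hx0 : 0 < x := hx.1
  have e1 : p.nrm v x * p.nrm v x = p.eta x * (v x / √(p.a x)) ^ 2 := by
    rw [H.nrm_mul_nrm hx, div_pow, ← hss]; ring
  have e2 : ∀ f, f * p.rho x * (Z * p.nrm v x)
      = p.eta x * (f * (x / √(p.a x)) * Z * (v x / √(p.a x))) := by
    intro f
    have : p.rho x * p.nrm v x = p.eta x * ((x / √(p.a x)) * (v x / √(p.a x))) := by
      rw [H.rho_mul_nrm hx, div_mul_div_comm, ← pow_two, ← hss]; ring
    linear_combination (f * Z) * this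
  have e3 : ∀ f, x * f * p.eta x * (Z * (v x / x))
      = p.eta x * (f * √(p.a x) * Z * (v x / √(p.a x))) := by
    intro f; field_simp
  obtain ⟨-, hΘt, hF⟩ := hF
  have he : p.cst ^ 2 ≤ p.cst * (1 - p.cst - p.beta x) := by
    have h1 := H.cst_pos
    have h2 := (abs_le.1 hβ).2
    have h3 := H.C6_pos
    have h4 : p.cst ≤ 1 - p.cst - p.beta x := by
      unfold Coeffs.C6 at h3; unfold Coeffs.cst; linarith
    rw [pow_two]
    exact mul_le_mul_of_nonneg_left h4 h1.le
  rw [e1, e2, e3]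
  unfold Coeffs.kap
  rcases hF with ⟨h1, h2, h3⟩ | ⟨τ, h1, h2, h3, h4⟩
  · have key := mul_nonneg hη.le (flux_nonneg_left (P := v x / √(p.a x)) (Z := Z) (G := γ) hΘt h2
      (by positivity) h3 he)
    rw [h1]
    refine key.trans_eq ?_
    ring
  · have key := mul_nonneg hη.le (flux_nonneg_right (P := v x / √(p.a x)) (Z := Z) (G := γ) hΘt hk
      hs h3 h2 h4 he)
    rw [h1]
    refine key.trans_eq ?_
    ring

/-- The time derivative of momentum minus `k` times energy, localized behind a moving front, is
bounded by the boundary term, with a gain of `C₆` times the energy. -/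
theorem multiplier_inequality (H : Admissible p m) {w v Θ Θx Θt : ℝ → ℝ} (hw : p.MemDom w)
    (hv : p.MemH1 v) (hΘ : IsWeight Θ Θx) (hΘt : MemLp Θt ⊤ leb) {k : ℝ} (hk : 0 ≤ k)
    (hF : ∀ᵐ x ∂leb, p.Front k Θ Θx Θt x) {Z Zv P Q G Gv A : L2}
    (hZ : Z = toL2 (zeta p.cst w)) (hZv : Zv = toL2 (zeta p.cst v)) (hP : P = toL2 (p.nrm v))
    (hQ : Q = toL2 (p.nrm (p.op w))) (hG : G = toL2 fun x => w x / x)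
    (hGv : Gv = toL2 fun x => v x / x) (hA : A = toL2 (deriv w)) :
    (wform (fun x => Θt x * p.rho x) Z P + wform (fun x => Θ x * p.rho x) Zv P
      + wform (fun x => Θ x * p.rho x) Z Q)
      - k * (1 / 2 * (wform Θt P P + wform (fun x => Θt x * p.eta x) Z Z
          + wform (fun x => Θt x * p.kap x) G G)
        + (wform Θ P Q + wform (fun x => Θ x * p.eta x) Z Zv
          + wform (fun x => Θ x * p.kap x) G Gv))
      + 1 / 2 * p.C6 m * (wform Θ P P + wform (fun x => Θ x * p.eta x) A A)
      ≤ 1 / 2 * (Θ 1 * p.eta 1 * derivWithin w (Icc 0 1) 1 ^ 2) := by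
  subst hZ hZv hP hQ hG hGv hA
  have hΘm := hΘ.memLp
  have hγ := hw.isH1Left.memLp_div
  have hγv := hv.isH1Left.memLp_div
  have hPv := H.memLp_nrm hv.1
  have hPo := H.memLp_nrm hw.2.2
  have hφ := hw.isH1Left.memLp
  have hz := hw.isH1Left.memLp_zeta p.cst
  have hzv := hv.isH1Left.memLp_zeta p.cst
  have hρ := memLp_top_mul hΘm H.memLp_rho
  have hη := memLp_top_mul hΘm H.memLp_eta
  have hκ := memLp_top_mul hΘm H.memLp_kap
  have hL := (((hasInt_wform (memLp_top_mul hΘt H.memLp_rho) hz hPv).add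
      (hasInt_wform hρ hzv hPv)).add (hasInt_wform hρ hz hPo)).sub
    ((((((hasInt_wform hΘt hPv hPv).add
      (hasInt_wform (memLp_top_mul hΘt H.memLp_eta) hz hz)).add
      (hasInt_wform (memLp_top_mul hΘt H.memLp_kap) hγ hγ)).const_mul (1 / 2)).add
      (((hasInt_wform hΘm hPv hPo).add (hasInt_wform hη hz hzv)).add
        (hasInt_wform hκ hγ hγv))).const_mul k) |>.add
    (((hasInt_wform hΘm hPv hPv).add (hasInt_wform hη hφ hφ)).const_mul (1 / 2 * p.C6 m))
  have hR := (H.multiplier_identity hw hv hΘ p.cst).sub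
    ((H.energy_flux_identity hw hv hΘ p.cst).const_mul k)
  rw [mul_zero, sub_zero] at hR
  refine hL.le hR ?_
  filter_upwards [ae_leb_mem, H.b_le, hF] with x hx hβ hFx
  have h1 := H.front_flux_nonneg hx hβ hk hFx v (zeta p.cst w x) (w x / x)
  have h2 := mul_le_mul_of_nonneg_left
    (H.density_ge hx hβ (p.nrm v x) (deriv w x) (w x / x)) hFx.1
  have h3 : deriv w x = zeta p.cst w x + p.cst * (w x / x) := by rw [zeta]; ring
  have e : (x * Θx x * p.eta x) * (deriv w x * deriv w x)
      - 2 * (p.cst * (x * Θx x * p.eta x) * (w x / x * deriv w x))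
      = (x * Θx x * p.eta x) * (zeta p.cst w x * zeta p.cst w x
        - p.cst ^ 2 * (w x / x * (w x / x))) := by
    rw [h3]; ring
  have hk' : p.kap x = p.eta x * (p.cst * (1 - p.cst - p.beta x) - p.Y x) := rfl
  rw [← hk']
  linarith [h1, h2, e]

theorem energy_eq (H : Admissible p m) {w v : ℝ → ℝ} (hw : p.MemH1 w) (hv : p.MemL2 v) :
    p.energy w v = p.locEnergy (fun _ => 1) (toL2 (zeta p.cst w)) (toL2 (p.nrm v))
      (toL2 fun x => w x / x) := by
  have hL := hw.isH1Left
  have h1 := memLp_top_const' 1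
  have hP := H.memLp_nrm hv
  have key := (((hasInt_wform h1 hP hP).add (hasInt_wform (memLp_top_mul h1 H.memLp_eta)
    (hL.memLp_zeta p.cst) (hL.memLp_zeta p.cst))).add
    (hasInt_wform (memLp_top_mul h1 H.memLp_kap) hL.memLp_div hL.memLp_div)).add
    (H.energy_identity hw p.cst)
  rw [add_zero] at key
  unfold Coeffs.energy Coeffs.locEnergy
  rw [← key.integral_eq]
  congr 1
  refine integral_congr_ae ?_
  filter_upwards [ae_leb_mem] with x hx
  have ha := (H.a_pos hx).ne'
  have hd := (H.d_pos hx).ne'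
  have hη := (p.eta_pos x).ne'
  have hx0 := hx.1.ne'
  rw [H.nrm_mul_nrm hx]
  unfold Coeffs.sigma Coeffs.kap Coeffs.Y
  field_simp
  ring

/-- As `λ ≥ 0`, the energy is at most its part without potential. -/
theorem energy_le (H : Admissible p m) {w v : ℝ → ℝ} (hw : p.MemH1 w) (hv : p.MemL2 v)
    {P A : L2} (hP' : P = toL2 (p.nrm v)) (hA : A = toL2 (deriv w)) {Θ : ℝ → ℝ}
    (hΘ : ∀ᵐ x ∂leb, Θ x = 1) :
    p.energy w v ≤ 1 / 2 * (wform Θ P P + wform (fun x => Θ x * p.eta x) A A) := by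
  subst hP' hA
  have hL := hw.isH1Left
  have hP := H.memLp_nrm hv
  have h1 := memLp_top_const' 1
  rw [wform_congr (φ := Θ) (ψ := fun _ => 1) hΘ, wform_congr (φ := fun x => Θ x * p.eta x)
    (ψ := fun x => 1 * p.eta x) (hΘ.mono fun x hx => by rw [hx])]
  have key := (hasInt_wform h1 hP hP).add (hasInt_wform (memLp_top_mul h1 H.memLp_eta)
    hL.memLp hL.memLp)
  have key2 := key.sub (hasInt_wform (memLp_top_mul H.memLp_eta H.memLp_Y')
    hL.memLp_div hL.memLp_div)
  have h2 : 0 ≤ wform (fun x => p.eta x * p.Y x) (toL2 fun x => w x / x)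
      (toL2 fun x => w x / x) := wform_self_nonneg (by
    filter_upwards [ae_leb_mem] with x hx
    exact mul_nonneg (p.eta_pos x).le (H.Y_nonneg hx)) _
  have h3 : p.energy w v = 1 / 2 * (wform (fun _ => 1) (toL2 (p.nrm v)) (toL2 (p.nrm v))
      + wform (fun x => 1 * p.eta x) (toL2 (deriv w)) (toL2 (deriv w))
      - wform (fun x => p.eta x * p.Y x) (toL2 fun x => w x / x) (toL2 fun x => w x / x)) := by
    unfold Coeffs.energy
    rw [← key2.integral_eq]
    congr 1
    refine integral_congr_ae ?_
    filter_upwards [ae_leb_mem] with x hx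
    have ha := (H.a_pos hx).ne'
    have hd := (H.d_pos hx).ne'
    have hη := (p.eta_pos x).ne'
    have hx0 := hx.1.ne'
    rw [H.nrm_mul_nrm hx]
    unfold Coeffs.sigma Coeffs.Y
    field_simp
  rw [h3]; linarith

end Admissible

theorem IsH1Left.norm_div_sq_le {u : ℝ → ℝ} (hu : IsH1Left u) :
    ‖toL2 fun x => u x / x‖ ^ 2 ≤ 6 * ‖toL2 (deriv u)‖ ^ 2 := by
  rw [norm_toL2_sq hu.memLp_div, norm_toL2_sq hu.memLp]
  simpa only [div_pow] using hu.hardy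

theorem wform_self_le {φ : ℝ → ℝ} {C : ℝ} (hC : ∀ᵐ x ∂leb, |φ x| ≤ C) (F : L2) :
    |wform φ F F| ≤ C * ‖F‖ ^ 2 := by
  rw [pow_two]; exact abs_wform_le hC F F

/-- The direct inequality at a fixed time. -/
theorem Admissible.exists_trace_le {p : Coeffs} {m : ℝ} (H : Admissible p m) :
    ∃ C, 0 ≤ C ∧ ∀ w v, p.MemDom w → p.MemH1 v →
      1 / 2 * (p.eta 1 * derivWithin w (Icc 0 1) 1 ^ 2) ≤
        wform p.rho (toL2 (zeta p.cst v)) (toL2 (p.nrm v))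
          + wform p.rho (toL2 (zeta p.cst w)) (toL2 (p.nrm (p.op w)))
          + C * (‖toL2 (p.nrm v)‖ ^ 2 + ‖toL2 (deriv w)‖ ^ 2) := by
  have hW1 : MemLp (fun x => 1 / 2 * (1 - logDer p.a x + p.beta x + 2 * p.cst)) ⊤ leb :=
    ((((memLp_top_const' 1).sub H.memLp_ka).add H.memLp_beta).add
      (memLp_top_const' (2 * p.cst))).const_mul _
  have hW2 : MemLp (fun x => 1 / 2 * ((1 - p.beta x - 2 * p.cst) * p.eta x)) ⊤ leb :=
    (memLp_top_mul (((memLp_top_const' 1).sub H.memLp_beta).sub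
      (memLp_top_const' (2 * p.cst))) H.memLp_eta).const_mul _
  have hW3 : MemLp (fun x => 1 / 2 * ((1 - logDer p.a x + p.beta x - logDer p.d x + 2 * p.cst)
      * (p.eta x * p.Y x))) ⊤ leb :=
    (memLp_top_mul (((((memLp_top_const' 1).sub H.memLp_ka).add H.memLp_beta).sub H.memLp_kd).add
      (memLp_top_const' (2 * p.cst))) (memLp_top_mul H.memLp_eta H.memLp_Y')).const_mul _
  obtain ⟨C1, hC1⟩ := exists_bound_of_memLp_top hW1
  obtain ⟨C2, hC2⟩ := exists_bound_of_memLp_top hW2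
  obtain ⟨C3, hC3⟩ := exists_bound_of_memLp_top hW3
  refine ⟨|C1| + |C2| + |C3| * 6, by positivity, fun w v hw hv => ?_⟩
  have hγ := hw.isH1Left.memLp_div
  have hPv := H.memLp_nrm hv.1
  have hPo := H.memLp_nrm hw.2.2
  have hφ := hw.isH1Left.memLp
  have hz := hw.isH1Left.memLp_zeta p.cst
  have hzv := hv.isH1Left.memLp_zeta p.cst
  have hL := ((((hasInt_wform H.memLp_rho hzv hPv).add (hasInt_wform H.memLp_rho hz hPo)).add
    (hasInt_wform hW1 hPv hPv)).add (hasInt_wform hW2 hφ hφ)).add (hasInt_wform hW3 hγ hγ)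
  have hR := H.multiplier_identity hw hv isWeight_one p.cst
  have key := hR.eq hL (ae_of_all _ fun x => by ring)
  have b1 := (le_abs_self _).trans (wform_self_le hC1 (toL2 (p.nrm v)))
  have b2 := (le_abs_self _).trans (wform_self_le hC2 (toL2 (deriv w)))
  have b3 := (le_abs_self _).trans (wform_self_le hC3 (toL2 fun x => w x / x))
  have h6 := hw.isH1Left.norm_div_sq_le
  have n1 := sq_nonneg ‖toL2 (p.nrm v)‖
  have n2 := sq_nonneg ‖toL2 (deriv w)‖
  have n3 := sq_nonneg ‖toL2 fun x => w x / x‖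
  have d1 := mul_le_mul_of_nonneg_right (le_abs_self C1) n1
  have d2 := mul_le_mul_of_nonneg_right (le_abs_self C2) n2
  have d3 := mul_le_mul_of_nonneg_right (le_abs_self C3) n3
  have d4 := mul_le_mul_of_nonneg_left h6 (abs_nonneg C3)
  have d5 := mul_nonneg (abs_nonneg C1) n2
  have d6 := mul_nonneg (abs_nonneg C2) n1
  have d7 := mul_nonneg (abs_nonneg C3) n1
  rw [one_mul] at key
  rw [key]
  linarith

theorem Coeffs.memH1_zero (p : Coeffs) : p.MemH1 fun _ => 0 := by
  refine ⟨⟨by simp, by simp⟩, ?_, by simp, rfl, rfl⟩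
  exact ContDiffOn.absolutelyContinuousOnInterval contDiffOn_const

/-- The normal derivative is bounded in terms of the graph norm. -/
theorem Admissible.exists_trace_sq_le {p : Coeffs} {m : ℝ} (H : Admissible p m) :
    ∃ C, 0 ≤ C ∧ ∀ w, p.MemDom w → derivWithin w (Icc 0 1) 1 ^ 2 ≤
      C * (‖toL2 (p.nrm (p.op w))‖ ^ 2 + ‖toL2 (zeta p.cst w)‖ ^ 2 + ‖toL2 (deriv w)‖ ^ 2) := by
  obtain ⟨C, hC0, hC⟩ := H.exists_trace_le
  obtain ⟨R, hR⟩ := exists_bound_of_memLp_top H.memLp_rho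
  have hη := p.eta_pos 1
  refine ⟨2 / p.eta 1 * (|R| + C), by positivity, fun w hw => ?_⟩
  have h1 := hC w _ hw p.memH1_zero
  have e1 : toL2 (p.nrm fun _ => 0) = 0 := by
    refine toL2_eq ?_
    filter_upwards [Lp.coeFn_zero ℝ 2 leb] with x hx
    exact hx.trans (by simp [Coeffs.nrm])
  have e2 : wform p.rho (toL2 (zeta p.cst fun _ => 0)) 0 = 0 := by
    simpa using wform_smul_right p.rho 0 (toL2 (zeta p.cst fun _ => 0)) 0
  rw [e1, e2, norm_zero] at h1
  have h2 := (le_abs_self _).trans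
    (abs_wform_le hR (toL2 (zeta p.cst w)) (toL2 (p.nrm (p.op w))))
  set a1 := ‖toL2 (zeta p.cst w)‖
  set a2 := ‖toL2 (p.nrm (p.op w))‖
  set a3 := ‖toL2 (deriv w)‖
  have a10 : 0 ≤ a1 := norm_nonneg _
  have a20 : 0 ≤ a2 := norm_nonneg _
  have h3 : a1 * a2 ≤ a2 ^ 2 + a1 ^ 2 := by nlinarith [sq_nonneg (a1 - a2)]
  have h4 : R * (a1 * a2) ≤ |R| * (a2 ^ 2 + a1 ^ 2) :=
    (mul_le_mul_of_nonneg_right (le_abs_self R) (by positivity)).trans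
      (mul_le_mul_of_nonneg_left h3 (abs_nonneg _))
  have h5 : 1 / 2 * (p.eta 1 * derivWithin w (Icc 0 1) 1 ^ 2)
      ≤ (|R| + C) * (a2 ^ 2 + a1 ^ 2 + a3 ^ 2) := by
    have := mul_nonneg hC0 (by positivity : 0 ≤ a2 ^ 2 + a1 ^ 2)
    have := mul_nonneg (abs_nonneg R) (by positivity : 0 ≤ a3 ^ 2)
    linarith
  rw [div_mul_eq_mul_div, div_mul_eq_mul_div, le_div_iff₀ hη]
  linarith

/-! ### The Hardy operator -/

theorem isH1Left_integral {F : ℝ → ℝ} (hF : MemLp F 2 leb) :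
    IsH1Left (fun x => ∫ s in (0 : ℝ)..x, F s) ∧
      deriv (fun x => ∫ s in (0 : ℝ)..x, F s) =ᵐ[leb] F := by
  have hi := integrable_leb_iff.1 (hF.integrable one_le_two)
  have h1 : deriv (fun x => ∫ s in (0 : ℝ)..x, F s) =ᵐ[leb] F := by
    have := hi.ae_hasDerivAt_integral
    rw [EventuallyEq, leb, ae_restrict_iff' measurableSet_Ioo]
    filter_upwards [this] with x hx hm
    refine (hx ?_ 0 (by simp)).deriv
    rw [uIcc_of_le zero_le_one]; exact ⟨hm.1.le, hm.2.le⟩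
  exact ⟨⟨hi.absolutelyContinuousOnInterval_intervalIntegral (by simp),
    (memLp_congr_ae h1).2 hF, by simp⟩, h1⟩

theorem integral_congr_leb {f g : ℝ → ℝ} (h : f =ᵐ[leb] g) {x : ℝ} (hx : x ∈ Icc (0 : ℝ) 1) :
    ∫ s in (0 : ℝ)..x, f s = ∫ s in (0 : ℝ)..x, g s := by
  refine intervalIntegral.integral_congr_ae ?_
  rw [EventuallyEq, leb, ae_restrict_iff' measurableSet_Ioo] at h
  have h1 : ∀ᵐ s : ℝ, s ≠ 1 := by simp [ae_iff]
  filter_upwards [h, h1] with s hs hs1 hm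
  rw [uIoc_of_le hx.1] at hm
  exact hs ⟨hm.1, lt_of_le_of_ne (hm.2.trans hx.2) hs1⟩

/-- The operator `F ↦ (1 / x) ∫₀ˣ F` on `L²(0,1)`, bounded by Hardy's inequality. -/
def hardyOp : L2 →L[ℝ] L2 :=
  LinearMap.mkContinuous
    { toFun := fun F => toL2 fun x => (∫ s in (0 : ℝ)..x, F s) / x
      map_add' := fun F G => by
        refine toL2_eq ?_
        filter_upwards [Lp.coeFn_add (toL2 fun x => (∫ s in (0 : ℝ)..x, F s) / x)
          (toL2 fun x => (∫ s in (0 : ℝ)..x, G s) / x),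
          coeFn_toL2 (isH1Left_integral (Lp.memLp F)).1.memLp_div,
          coeFn_toL2 (isH1Left_integral (Lp.memLp G)).1.memLp_div, ae_leb_mem] with x h1 h2 h3 hx
        have hx' : x ∈ Icc (0 : ℝ) 1 := ⟨hx.1.le, hx.2.le⟩
        have hi : ∀ F : L2, IntervalIntegrable F volume 0 x := fun F =>
          intervalIntegrable_of_leb ((Lp.memLp F).integrable one_le_two) (by simp) hx'
        rw [h1, Pi.add_apply, h2, h3, integral_congr_leb (Lp.coeFn_add F G) hx', ← add_div]
        congr 1
        exact (intervalIntegral.integral_add (hi F) (hi G)).symm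
      map_smul' := fun c F => by
        refine toL2_eq ?_
        filter_upwards [Lp.coeFn_smul c (toL2 fun x => (∫ s in (0 : ℝ)..x, F s) / x),
          coeFn_toL2 (isH1Left_integral (Lp.memLp F)).1.memLp_div, ae_leb_mem] with x h1 h2 hx
        have hx' : x ∈ Icc (0 : ℝ) 1 := ⟨hx.1.le, hx.2.le⟩
        rw [RingHom.id_apply, h1, Pi.smul_apply, h2, integral_congr_leb (Lp.coeFn_smul c F) hx',
          smul_eq_mul, ← mul_div_assoc, ← intervalIntegral.integral_const_mul]
        rfl } √6 fun F => by
    refine abs_le_of_sq_le_sq' ?_ (by positivity) |>.2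
    obtain ⟨h1, h2⟩ := isH1Left_integral (Lp.memLp F)
    rw [mul_pow, Real.sq_sqrt (by norm_num)]
    refine h1.norm_div_sq_le.trans (le_of_eq ?_)
    rw [toL2_eq (F := F) h2.symm]

theorem IsH1Left.hardyOp_deriv {u : ℝ → ℝ} (hu : IsH1Left u) :
    (toL2 fun x => u x / x) = hardyOp (toL2 (deriv u)) := by
  change _ = toL2 fun x => (∫ s in (0 : ℝ)..x, toL2 (deriv u) s) / x
  refine toL2_congr hu.memLp_div ?_
  filter_upwards [ae_leb_mem] with x hx
  have hx' : x ∈ Icc (0 : ℝ) 1 := ⟨hx.1.le, hx.2.le⟩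
  rw [integral_congr_leb (coeFn_toL2 hu.memLp) hx', ← hu.eq_integral hx']

/-- The operator `u' ↦ u' - c u / x`. -/
def zetaOp (c : ℝ) : L2 →L[ℝ] L2 := ContinuousLinearMap.id ℝ L2 - c • hardyOp

theorem IsH1Left.zetaOp_deriv {u : ℝ → ℝ} (hu : IsH1Left u) (c : ℝ) :
    toL2 (zeta c u) = zetaOp c (toL2 (deriv u)) := by
  change toL2 (fun x => deriv u x - c * (u x / x)) = toL2 (deriv u) - c • hardyOp (toL2 (deriv u))
  rw [toL2_sub hu.memLp (hu.memLp_div.const_mul c), toL2_const_mul hu.memLp_div,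
    hu.hardyOp_deriv]

/-! ### Weights depending on time -/

/-- A bounded weight on `(0,1)` which is `C^{1,1}` in time, uniformly in space, with time
derivative `Θt`. -/
structure TimeWeight (Θ Θt : ℝ → ℝ → ℝ) : Prop where
  memLp : ∀ t, MemLp (Θ t) ⊤ leb
  memLp_t : ∀ t, MemLp (Θt t) ⊤ leb
  bound : ∃ C, ∀ s t, ∀ᵐ x ∂leb, |Θ s x - Θ t x - (s - t) * Θt t x| ≤ C * (s - t) ^ 2

theorem timeWeight_one : TimeWeight (fun _ _ => 1) (fun _ _ => 0) where
  memLp _ := memLp_top_const' 1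
  memLp_t _ := memLp_top_const' 0
  bound := ⟨0, fun _ _ => ae_of_all _ fun _ => by simp⟩

theorem TimeWeight.mul {Θ Θt : ℝ → ℝ → ℝ} (h : TimeWeight Θ Θt) {ψ : ℝ → ℝ}
    (hψ : MemLp ψ ⊤ leb) :
    TimeWeight (fun t x => Θ t x * ψ x) (fun t x => Θt t x * ψ x) where
  memLp t := memLp_top_mul (h.memLp t) hψ
  memLp_t t := memLp_top_mul (h.memLp_t t) hψ
  bound := by
    obtain ⟨C, hC⟩ := h.bound
    obtain ⟨R, hR⟩ := exists_bound_of_memLp_top hψ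
    refine ⟨C * R, fun s t => ?_⟩
    filter_upwards [hC s t, hR] with x h1 h2
    have e : Θ s x * ψ x - Θ t x * ψ x - (s - t) * (Θt t x * ψ x)
        = (Θ s x - Θ t x - (s - t) * Θt t x) * ψ x := by ring
    rw [e, abs_mul]
    refine (mul_le_mul h1 h2 (abs_nonneg _) ((abs_nonneg _).trans h1)).trans (le_of_eq ?_)
    ring

theorem TimeWeight.hasDerivAt_wform {Θ Θt : ℝ → ℝ → ℝ} (h : TimeWeight Θ Θt) {t : ℝ}
    {F G : ℝ → L2} {F' G' : L2} (hF : HasDerivAt F F' t) (hG : HasDerivAt G G' t) :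
    HasDerivAt (fun s => wform (Θ s) (F s) (G s))
      (wform (Θt t) (F t) (G t) + wform (Θ t) F' (G t) + wform (Θ t) (F t) G') t := by
  obtain ⟨C, hC⟩ := h.bound
  exact DegWave.hasDerivAt_wform h.memLp (h.memLp_t t) (fun s => hC s t) hF hG

theorem TimeWeight.continuousOn_wform {Θ Θt : ℝ → ℝ → ℝ} (h : TimeWeight Θ Θt) {S : Set ℝ}
    {F G : ℝ → L2} (hF : ContinuousOn F S) (hG : ContinuousOn G S) :
    ContinuousOn (fun s => wform (Θ s) (F s) (G s)) S := by
  intro t ht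
  obtain ⟨C, hC⟩ := h.bound
  obtain ⟨R, hR⟩ := exists_bound_of_memLp_top (h.memLp_t t)
  refine tendsto_wform (e := fun s => C * (s - t) ^ 2 + |s - t| * R)
    (Eventually.of_forall fun s => h.memLp s) (h.memLp t) (Eventually.of_forall fun s => ?_) ?_
    (hF t ht) (hG t ht)
  · filter_upwards [hC s t, hR] with x h1 h2
    have e : Θ s x - Θ t x = (Θ s x - Θ t x - (s - t) * Θt t x) + (s - t) * Θt t x := by ring
    rw [e]
    refine (abs_add_le _ _).trans (add_le_add h1 ?_)
    rw [abs_mul]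
    exact mul_le_mul_of_nonneg_left h2 (abs_nonneg _)
  · have : Tendsto (fun s : ℝ => C * (s - t) ^ 2 + |s - t| * R) (𝓝 t)
        (𝓝 (C * (t - t) ^ 2 + |t - t| * R)) := Continuous.tendsto (by fun_prop) t
    simpa using this.mono_left nhdsWithin_le_nhds

/-! ### Classical solutions -/

namespace Coeffs

/-- `(w, v)` with `v = w_t` is a solution on `[0,T]` with values in the domain of the generator.
Only the properties entering the multiplier method are listed; derivatives in time are taken in
`L²(0,1)`, after division of the velocity by `√σ`. -/
structure ClassicalSolution (p : Coeffs) (T : ℝ) (w v : ℝ → ℝ → ℝ) : Prop where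
  memDom : ∀ t ∈ Icc 0 T, p.MemDom (w t)
  memH1 : ∀ t ∈ Icc 0 T, p.MemH1 (v t)
  continuousOn_deriv : ContinuousOn (fun t => toL2 (deriv (w t))) (Icc 0 T)
  continuousOn_vel : ContinuousOn (fun t => toL2 (p.nrm (v t))) (Icc 0 T)
  hasDerivAt_deriv : ∀ t ∈ Ioo 0 T,
    HasDerivAt (fun t => toL2 (deriv (w t))) (toL2 (deriv (v t))) t
  hasDerivAt_vel : ∀ t ∈ Ioo 0 T,
    HasDerivAt (fun t => toL2 (p.nrm (v t))) (toL2 (p.nrm (p.op (w t)))) t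
  continuousOn_trace : ContinuousOn (fun t => derivWithin (w t) (Icc 0 1) 1) (Icc 0 T)

end Coeffs

theorem toL2_neg (f : ℝ → ℝ) (hf : MemLp f 2 leb) : toL2 (fun x => -f x) = -toL2 f := by
  have := toL2_const_mul hf (-1)
  simpa using this

theorem Coeffs.MemL2.neg {p : Coeffs} {u : ℝ → ℝ} (hu : p.MemL2 u) : p.MemL2 fun x => -u x :=
  ⟨hu.1.neg, by simpa using hu.2⟩

theorem Coeffs.MemH1.neg {p : Coeffs} {u : ℝ → ℝ} (hu : p.MemH1 u) : p.MemH1 fun x => -u x :=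
  ⟨hu.1.neg, hu.2.1.fun_neg, by
    have h : MemLp (fun x => -deriv u x) 2 leb := hu.2.2.1.neg
    simpa using h, by simp [hu.2.2.2.1],
    by simp [hu.2.2.2.2]⟩

/-- Time reversal. -/
theorem Coeffs.ClassicalSolution.reverse {p : Coeffs} {m : ℝ} (H : Admissible p m) {T : ℝ}
    {w v : ℝ → ℝ → ℝ} (h : p.ClassicalSolution T w v) :
    p.ClassicalSolution T (fun t => w (T - t)) (fun t x => -v (T - t) x) := by
  have hm : MapsTo (fun t => T - t) (Icc 0 T) (Icc 0 T) := fun t ht =>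
    ⟨by linarith [ht.2], by linarith [ht.1]⟩
  have hm' : MapsTo (fun t => T - t) (Ioo 0 T) (Ioo 0 T) := fun t ht =>
    ⟨by linarith [ht.2], by linarith [ht.1]⟩
  have hc : ContinuousOn (fun t : ℝ => T - t) (Icc 0 T) := by fun_prop
  have hd : ∀ t, HasDerivAt (fun t : ℝ => T - t) (-1) t := fun t =>
    (hasDerivAt_id' t).const_sub T
  have hP : ∀ t ∈ Icc 0 T,
      toL2 (p.nrm fun x => -v (T - t) x) = -toL2 (p.nrm (v (T - t))) := fun t ht => by
    rw [← toL2_neg _ (H.memLp_nrm (h.memH1 _ (hm ht)).1)]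
    congr 1; ext x; simp [Coeffs.nrm, neg_div]
  have hV : ∀ t ∈ Icc 0 T,
      toL2 (deriv fun x => -v (T - t) x) = -toL2 (deriv (v (T - t))) := fun t ht => by
    rw [← toL2_neg _ (h.memH1 _ (hm ht)).2.2.1]
    congr 1; ext x; simp
  refine ⟨fun t ht => h.memDom _ (hm ht), fun t ht => (h.memH1 _ (hm ht)).neg,
    h.continuousOn_deriv.comp hc hm, ?_, ?_, ?_, h.continuousOn_trace.comp hc hm⟩
  · exact ((h.continuousOn_vel.comp hc hm).neg).congr hP
  · intro t ht
    have h1 := (h.hasDerivAt_deriv _ (hm' ht)).scomp t (hd t)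
    rw [hV t ⟨ht.1.le, ht.2.le⟩]
    simpa using! h1
  · intro t ht
    have h1 := ((h.hasDerivAt_vel _ (hm' ht)).scomp t (hd t)).neg
    have h2 : (fun t => toL2 (p.nrm fun x => -v (T - t) x))
        =ᶠ[𝓝 t] fun t => -toL2 (p.nrm (v (T - t))) := by
      filter_upwards [Ioo_mem_nhds ht.1 ht.2] with s hs
      exact hP s ⟨hs.1.le, hs.2.le⟩
    refine (HasDerivAt.congr_of_eventuallyEq ?_ h2)
    simpa using! h1

namespace Admissible

variable {p : Coeffs} {m : ℝ}

section

variable {T : ℝ} {w v : ℝ → ℝ → ℝ}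

theorem hasDerivAt_momentum (h : p.ClassicalSolution T w v) (H : Admissible p m)
    {Θ Θt : ℝ → ℝ → ℝ} (hΘ : TimeWeight Θ Θt) {t : ℝ} (ht : t ∈ Ioo 0 T) :
    HasDerivAt (fun s => p.momentum (Θ s) (zetaOp p.cst (toL2 (deriv (w s))))
        (toL2 (p.nrm (v s))))
      (wform (fun x => Θt t x * p.rho x) (zetaOp p.cst (toL2 (deriv (w t)))) (toL2 (p.nrm (v t)))
        + wform (fun x => Θ t x * p.rho x) (zetaOp p.cst (toL2 (deriv (v t))))
          (toL2 (p.nrm (v t)))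
        + wform (fun x => Θ t x * p.rho x) (zetaOp p.cst (toL2 (deriv (w t))))
          (toL2 (p.nrm (p.op (w t))))) t :=
  (hΘ.mul H.memLp_rho).hasDerivAt_wform
    ((zetaOp p.cst).hasFDerivAt.comp_hasDerivAt t (h.hasDerivAt_deriv t ht))
    (h.hasDerivAt_vel t ht)

theorem hasDerivAt_locEnergy (h : p.ClassicalSolution T w v) (H : Admissible p m)
    {Θ Θt : ℝ → ℝ → ℝ} (hΘ : TimeWeight Θ Θt) {t : ℝ} (ht : t ∈ Ioo 0 T) :
    HasDerivAt (fun s => p.locEnergy (Θ s) (zetaOp p.cst (toL2 (deriv (w s))))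
        (toL2 (p.nrm (v s))) (hardyOp (toL2 (deriv (w s)))))
      (1 / 2 * (wform (Θt t) (toL2 (p.nrm (v t))) (toL2 (p.nrm (v t)))
          + wform (fun x => Θt t x * p.eta x) (zetaOp p.cst (toL2 (deriv (w t))))
            (zetaOp p.cst (toL2 (deriv (w t))))
          + wform (fun x => Θt t x * p.kap x) (hardyOp (toL2 (deriv (w t))))
            (hardyOp (toL2 (deriv (w t)))))
        + (wform (Θ t) (toL2 (p.nrm (v t))) (toL2 (p.nrm (p.op (w t))))
          + wform (fun x => Θ t x * p.eta x) (zetaOp p.cst (toL2 (deriv (w t))))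
            (zetaOp p.cst (toL2 (deriv (v t))))
          + wform (fun x => Θ t x * p.kap x) (hardyOp (toL2 (deriv (w t))))
            (hardyOp (toL2 (deriv (v t)))))) t := by
  have hz := (zetaOp p.cst).hasFDerivAt.comp_hasDerivAt t (h.hasDerivAt_deriv t ht)
  have hg := hardyOp.hasFDerivAt.comp_hasDerivAt t (h.hasDerivAt_deriv t ht)
  have h1 := hΘ.hasDerivAt_wform (h.hasDerivAt_vel t ht) (h.hasDerivAt_vel t ht)
  have h2 := (hΘ.mul H.memLp_eta).hasDerivAt_wform hz hz
  have h3 := (hΘ.mul H.memLp_kap).hasDerivAt_wform hg hg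
  refine (((h1.add h2).add h3).const_mul (1 / 2)).congr_deriv ?_
  rw [wform_comm (Θ t) (toL2 (p.nrm (p.op (w t)))),
    wform_comm (fun x => Θ t x * p.eta x) (zetaOp p.cst (toL2 (deriv (v t)))),
    wform_comm (fun x => Θ t x * p.kap x) (hardyOp (toL2 (deriv (v t))))]
  simp only [Function.comp_apply]
  ring

theorem continuousOn_momentum (h : p.ClassicalSolution T w v) (H : Admissible p m)
    {Θ Θt : ℝ → ℝ → ℝ} (hΘ : TimeWeight Θ Θt) :
    ContinuousOn (fun s => p.momentum (Θ s) (zetaOp p.cst (toL2 (deriv (w s))))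
        (toL2 (p.nrm (v s)))) (Icc 0 T) :=
  (hΘ.mul H.memLp_rho).continuousOn_wform
    ((zetaOp p.cst).continuous.comp_continuousOn h.continuousOn_deriv) h.continuousOn_vel

theorem continuousOn_locEnergy (h : p.ClassicalSolution T w v) (H : Admissible p m)
    {Θ Θt : ℝ → ℝ → ℝ} (hΘ : TimeWeight Θ Θt) :
    ContinuousOn (fun s => p.locEnergy (Θ s) (zetaOp p.cst (toL2 (deriv (w s))))
        (toL2 (p.nrm (v s))) (hardyOp (toL2 (deriv (w s))))) (Icc 0 T) := by
  have hz := (zetaOp p.cst).continuous.comp_continuousOn h.continuousOn_deriv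
  have hg := hardyOp.continuous.comp_continuousOn h.continuousOn_deriv
  exact continuousOn_const.mul (((hΘ.continuousOn_wform h.continuousOn_vel
    h.continuousOn_vel).add ((hΘ.mul H.memLp_eta).continuousOn_wform hz hz)).add
    ((hΘ.mul H.memLp_kap).continuousOn_wform hg hg))

theorem energy_eq' (H : Admissible p m) {u z : ℝ → ℝ} (hu : p.MemH1 u) (hz : p.MemL2 z) :
    p.energy u z = p.locEnergy (fun _ => 1) (zetaOp p.cst (toL2 (deriv u))) (toL2 (p.nrm z))
      (hardyOp (toL2 (deriv u))) := by
  rw [H.energy_eq hu hz, hu.isH1Left.zetaOp_deriv, hu.isH1Left.hardyOp_deriv]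

theorem energy_conserved (H : Admissible p m) (h : p.ClassicalSolution T w v) {t : ℝ}
    (ht : t ∈ Icc 0 T) : p.energy (w t) (v t) = p.energy (w 0) (v 0) := by
  rcases ht.1.eq_or_lt with h0 | h0
  · rw [← h0]
  have hT : (0 : ℝ) ≤ T := ht.1.trans ht.2
  rw [H.energy_eq' (h.memDom t ht).1 (h.memH1 t ht).1,
    H.energy_eq' (h.memDom 0 ⟨le_rfl, hT⟩).1 (h.memH1 0 ⟨le_rfl, hT⟩).1]
  have hd : ∀ s ∈ Ioo 0 t, HasDerivAt (fun s => p.locEnergy (fun _ => 1)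
      (zetaOp p.cst (toL2 (deriv (w s)))) (toL2 (p.nrm (v s)))
      (hardyOp (toL2 (deriv (w s))))) ((fun _ => (0 : ℝ)) s) s := by
    intro s hs
    have hs' : s ∈ Ioo 0 T := ⟨hs.1, hs.2.trans_le ht.2⟩
    have hs'' : s ∈ Icc 0 T := ⟨hs'.1.le, hs'.2.le⟩
    refine (hasDerivAt_locEnergy h H timeWeight_one hs').congr_deriv ?_
    have hwD := h.memDom s hs''
    have hvH := h.memH1 s hs''
    have hw := hwD.isH1Left
    have hv := hvH.isH1Left
    have hP := H.memLp_nrm hvH.1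
    have hQ := H.memLp_nrm hwD.2.2
    have h1 := memLp_top_const' 1
    have key := ((hasInt_wform h1 hP hQ).add (hasInt_wform (memLp_top_mul h1 H.memLp_eta)
      (hw.memLp_zeta p.cst) (hv.memLp_zeta p.cst))).add
      (hasInt_wform (memLp_top_mul h1 H.memLp_kap) hw.memLp_div hv.memLp_div)
    have key2 := key.eq (H.energy_flux_identity hwD hvH isWeight_one p.cst)
      (ae_of_all _ fun x => by unfold Coeffs.kap; ring)
    rw [hw.zetaOp_deriv, hv.zetaOp_deriv, hw.hardyOp_deriv, hv.hardyOp_deriv] at key2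
    rw [key2]
    simp [wform]
  obtain ⟨s, -, hs⟩ := exists_hasDerivAt_eq_slope _ _ h0
    ((continuousOn_locEnergy h H timeWeight_one).mono (Icc_subset_Icc_right ht.2)) hd
  rw [eq_comm, div_eq_zero_iff] at hs
  rcases hs with hs | hs
  · linarith
  · linarith

end

/-- The direct inequality: the normal derivative is controlled by the norm of the solution. -/
theorem exists_direct (H : Admissible p m) {T : ℝ} (hT : 0 ≤ T) :
    ∃ C, 0 ≤ C ∧ ∀ w v R, p.ClassicalSolution T w v →
      (∀ t ∈ Icc 0 T, ‖toL2 (p.nrm (v t))‖ ^ 2 + ‖toL2 (deriv (w t))‖ ^ 2 ≤ R) →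
      ∫ t in (0 : ℝ)..T, derivWithin (w t) (Icc 0 1) 1 ^ 2 ≤ C * R := by
  obtain ⟨C, hC0, hC⟩ := H.exists_trace_le
  obtain ⟨B, hB⟩ := exists_bound_of_memLp_top H.memLp_rho
  set N := ‖zetaOp p.cst‖ with hN
  have hN0 : 0 ≤ N := norm_nonneg _
  have hη := p.eta_pos 1
  refine ⟨2 / p.eta 1 * (C * T + 2 * (|B| * N)), by positivity, fun w v R h hR => ?_⟩
  have hR0 : 0 ≤ R := le_trans (by positivity) (hR 0 ⟨le_rfl, hT⟩)
  have hmom : ∀ t ∈ Icc 0 T, |p.momentum (fun _ => 1) (zetaOp p.cst (toL2 (deriv (w t))))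
      (toL2 (p.nrm (v t)))| ≤ |B| * N * R := by
    intro t ht
    have h1 : ∀ᵐ x ∂leb, |1 * p.rho x| ≤ |B| := hB.mono fun x hx => by
      rw [one_mul]; exact hx.trans (le_abs_self _)
    refine (abs_wform_le h1 _ _).trans ?_
    rw [mul_assoc]
    refine mul_le_mul_of_nonneg_left ?_ (abs_nonneg _)
    have h2 := (zetaOp p.cst).le_opNorm (toL2 (deriv (w t)))
    have h3 := norm_nonneg (toL2 (p.nrm (v t)))
    calc _ ≤ N * ‖toL2 (deriv (w t))‖ * ‖toL2 (p.nrm (v t))‖ :=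
          mul_le_mul_of_nonneg_right h2 h3
      _ = N * (‖toL2 (deriv (w t))‖ * ‖toL2 (p.nrm (v t))‖) := by ring
      _ ≤ N * R := mul_le_mul_of_nonneg_left (by
        nlinarith [hR t ht, sq_nonneg (‖toL2 (deriv (w t))‖ - ‖toL2 (p.nrm (v t))‖),
          sq_nonneg ‖toL2 (deriv (w t))‖, sq_nonneg ‖toL2 (p.nrm (v t))‖]) hN0
  have htr : ContinuousOn (fun t => C * R
      - 1 / 2 * (p.eta 1 * derivWithin (w t) (Icc 0 1) 1 ^ 2)) (Icc 0 T) :=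
    continuousOn_const.sub (continuousOn_const.mul
      (continuousOn_const.mul (h.continuousOn_trace.pow 2)))
  have key := intervalIntegral.sub_le_integral_of_hasDeriv_right_of_le hT
    (continuousOn_momentum h H timeWeight_one).neg
    (fun t ht => (hasDerivAt_momentum h H timeWeight_one ht).neg.hasDerivWithinAt)
    htr.integrableOn_Icc (fun t ht => by
      have ht' : t ∈ Icc 0 T := ⟨ht.1.le, ht.2.le⟩
      have h1 := hC _ _ (h.memDom t ht') (h.memH1 t ht')
      have h2 := mul_le_mul_of_nonneg_left (hR t ht') hC0
      rw [(h.memDom t ht').isH1Left.zetaOp_deriv, (h.memH1 t ht').isH1Left.zetaOp_deriv] at h1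
      have h3 : wform (fun x => (0 : ℝ) * p.rho x) (zetaOp p.cst (toL2 (deriv (w t))))
        (toL2 (p.nrm (v t))) = 0 := by simp [wform]
      have h4 : (fun x => (1 : ℝ) * p.rho x) = p.rho := by ext x; rw [one_mul]
      rw [h3, h4]
      linarith)
  have hi : IntervalIntegrable (fun t => derivWithin (w t) (Icc 0 1) 1 ^ 2) volume 0 T :=
    ContinuousOn.intervalIntegrable (by rw [uIcc_of_le hT]; exact h.continuousOn_trace.pow 2)
  rw [intervalIntegral.integral_sub (by simp) ((hi.const_mul _).const_mul _),
    intervalIntegral.integral_const_mul (1 / 2),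
    intervalIntegral.integral_const_mul (p.eta 1),
    intervalIntegral.integral_const] at key
  have k1 := (abs_le.1 (hmom 0 ⟨le_rfl, hT⟩)).1
  have k2 := (abs_le.1 (hmom T ⟨hT, le_rfl⟩)).2
  simp only [Pi.neg_apply, sub_zero, smul_eq_mul] at key
  rw [div_mul_eq_mul_div, div_mul_eq_mul_div, le_div_iff₀ hη]
  linarith

end Admissible

/-! ### A smooth step -/

theorem absolutelyContinuousOnInterval_of_dist_le {f g : ℝ → ℝ} {a b : ℝ}
    (hf : AbsolutelyContinuousOnInterval f a b)
    (h : ∀ x y, dist (g x) (g y) ≤ dist (f x) (f y)) :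
    AbsolutelyContinuousOnInterval g a b := by
  rw [absolutelyContinuousOnInterval_iff] at hf ⊢
  intro ε hε
  obtain ⟨δ, hδ, H⟩ := hf ε hε
  exact ⟨δ, hδ, fun E hE hl =>
    (Finset.sum_le_sum fun i _ => h _ _).trans_lt (H E hE hl)⟩

theorem LocAC.max_zero {f : ℝ → ℝ} (hf : LocAC f) : LocAC fun x => max (f x) 0 :=
  fun δ hδ => absolutelyContinuousOnInterval_of_dist_le (hf δ hδ) fun x y => by
    rw [Real.dist_eq, Real.dist_eq]
    exact abs_max_sub_max_le_abs _ _ _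

/-- A `C^{1,1}` step function, equal to `0` on `(-∞,0]` and to `1` on `[1,∞)`. -/
def step (u : ℝ) : ℝ :=
  2 * (max u 0 * max u 0) - 4 * (max (u - 1 / 2) 0 * max (u - 1 / 2) 0)
    + 2 * (max (u - 1) 0 * max (u - 1) 0)

/-- The derivative of `step`. -/
def stepDeriv (u : ℝ) : ℝ := 4 * max u 0 - 8 * max (u - 1 / 2) 0 + 4 * max (u - 1) 0

theorem step_of_nonpos {u : ℝ} (h : u ≤ 0) : step u = 0 := by
  unfold step
  rw [max_eq_right h, max_eq_right (by linarith), max_eq_right (by linarith)]; ring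

theorem step_of_one_le {u : ℝ} (h : 1 ≤ u) : step u = 1 := by
  unfold step
  rw [max_eq_left (by linarith), max_eq_left (by linarith), max_eq_left (by linarith)]; ring

theorem step_mem (u : ℝ) : 0 ≤ step u ∧ step u ≤ 1 := by
  rcases le_total u 0 with h | h
  · rw [step_of_nonpos h]; norm_num
  rcases le_total 1 u with h1 | h1
  · rw [step_of_one_le h1]; norm_num
  unfold step
  rw [max_eq_left h, max_eq_right (by linarith : u - 1 ≤ 0)]
  rcases le_total u (1 / 2) with h2 | h2
  · rw [max_eq_right (by linarith : u - 1 / 2 ≤ 0)]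
    constructor <;> nlinarith
  · rw [max_eq_left (by linarith : 0 ≤ u - 1 / 2)]
    constructor <;> nlinarith [sq_nonneg (u - 1)]

theorem stepDeriv_mem (u : ℝ) : 0 ≤ stepDeriv u ∧ stepDeriv u ≤ 2 := by
  unfold stepDeriv
  rcases max_cases u 0 with h | h <;> rcases max_cases (u - 1 / 2) 0 with h1 | h1 <;>
    rcases max_cases (u - 1) 0 with h2 | h2 <;> constructor <;> linarith

theorem abs_sq_max_sub_le (u h : ℝ) :
    |max (u + h) 0 * max (u + h) 0 - max u 0 * max u 0 - h * (2 * max u 0)| ≤ h ^ 2 := by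
  rw [abs_le]
  rcases max_cases u 0 with h1 | h1 <;> rcases max_cases (u + h) 0 with h2 | h2 <;>
    rw [h1.1, h2.1] <;> constructor <;> nlinarith

theorem abs_step_sub_le (u h : ℝ) : |step (u + h) - step u - h * stepDeriv u| ≤ 8 * h ^ 2 := by
  have h1 := abs_le.1 (abs_sq_max_sub_le u h)
  have h2 := abs_le.1 (abs_sq_max_sub_le (u - 1 / 2) h)
  have h3 := abs_le.1 (abs_sq_max_sub_le (u - 1) h)
  have e2 : u + h - 1 / 2 = u - 1 / 2 + h := by ring
  have e3 : u + h - 1 = u - 1 + h := by ring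
  unfold step stepDeriv
  rw [e2, e3, abs_le]
  constructor <;> linarith [h1.1, h1.2, h2.1, h2.2, h3.1, h3.2]

theorem hasDerivAt_step (u : ℝ) : HasDerivAt step (stepDeriv u) u := by
  rw [hasDerivAt_iff_isLittleO_nhds_zero]
  have h1 : (fun h : ℝ => step (u + h) - step u - h • stepDeriv u) =O[𝓝 0] fun h => h ^ 2 := by
    refine Asymptotics.IsBigO.of_bound 8 (Eventually.of_forall fun h => ?_)
    rw [Real.norm_eq_abs, Real.norm_eq_abs, abs_of_nonneg (sq_nonneg h)]
    exact abs_step_sub_le u h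
  exact h1.trans_isLittleO (Asymptotics.isLittleO_pow_id one_lt_two)

theorem continuous_stepDeriv : Continuous stepDeriv := by
  unfold stepDeriv; fun_prop

theorem LocAC.step {f : ℝ → ℝ} (hf : LocAC f) : LocAC fun x => step (f x) := by
  have hc : ∀ c : ℝ, LocAC fun _ => c := fun c => locAC_of_contDiffOn fun _ _ => contDiffOn_const
  have h1 := hf.max_zero
  have h2 := (hf.sub (hc (1 / 2))).max_zero
  have h3 := (hf.sub (hc 1)).max_zero
  exact (((h1.mul h1).const_mul 2).sub ((h2.mul h2).const_mul 4)).add ((h3.mul h3).const_mul 2)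

/-! ### The moving front -/

/-- A weight depending on time which vanishes at time `0`, equals `1` from time `t₁` on, and moves
through `(0,1)` in the admissible way. -/
structure MovingFront (p : Coeffs) (k t₁ : ℝ) (Θ Θx Θt : ℝ → ℝ → ℝ) : Prop where
  isWeight : ∀ t, IsWeight (Θ t) (Θx t)
  timeWeight : TimeWeight Θ Θt
  front : ∀ t, ∀ᵐ x ∂leb, p.Front k (Θ t) (Θx t) (Θt t) x
  start : ∀ᵐ x ∂leb, Θ 0 x = 0
  full : ∀ t, t₁ ≤ t → ∀ᵐ x ∂leb, Θ t x = 1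
  trace_le : ∀ t, Θ t 1 ≤ 1

namespace Admissible

variable {p : Coeffs} {m : ℝ}

/-- As `Y = λ x² / (a d)` is nondecreasing and tends to `0` at `0`, it passes the value `c²` at most
once; the switching point is `1` if it stays below. -/
theorem exists_switch (H : Admissible p m) : ∃ xs ∈ Ioc (0 : ℝ) 1,
    (∀ x ∈ Ioo (0 : ℝ) 1, x < xs → p.Y x ≤ p.cst ^ 2) ∧
      ∀ x ∈ Ioo (0 : ℝ) 1, xs < x → p.cst ^ 2 ≤ p.Y x := by
  have hmono : MonotoneOn p.Y (Ioc 0 1) := by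
    intro x hx y hy hxy
    have := mul_le_mul_of_nonneg_left (H.monotoneOn_sq_div_ad hx hy hxy) H.lam_nonneg
    simpa only [Coeffs.Y, mul_div_assoc] using this
  have hmono2 : MonotoneOn (fun x => x ^ 2 / (p.a x * p.d x ^ 2)) (Ioc 0 1) := by
    refine monotoneOn_sq_div (fun δ hδ => (H.a_deg.c1 δ hδ).mul ((H.d_deg.c1 δ hδ).pow 2))
      (fun x hx => mul_pos (H.a_deg.pos x hx) (pow_pos (H.d_deg.pos x hx) 2)) fun x hx => ?_
    have h1 := (abs_le.1 (H.a_deg.deriv_le x hx)).2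
    have h1' := (abs_le.1 (H.d_deg.deriv_le x hx)).2
    have h2 := H.a_pos hx
    have h2' := H.d_pos hx
    have h3 := H.deg_le
    have h5 := H.m_nonneg
    rw [((H.hasDerivAt_a hx).fun_mul ((H.hasDerivAt_d hx).fun_pow 2)).deriv]
    simp only [Nat.cast_ofNat, Nat.add_one_sub_one, pow_one]
    have e : x * (deriv p.a x * p.d x ^ 2 + p.a x * (2 * p.d x * deriv p.d x))
      = (x * deriv p.a x) * p.d x ^ 2 + 2 * p.a x * p.d x * (x * deriv p.d x) := by ring
    rw [e]
    have b1 := mul_le_mul_of_nonneg_right h1 (sq_nonneg (p.d x))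
    have b2 := mul_le_mul_of_nonneg_left h1' (by positivity : 0 ≤ 2 * p.a x * p.d x)
    have b3 := mul_le_mul_of_nonneg_right
      (by linarith : degConst p.a + 2 * degConst p.d ≤ 2)
      (by positivity : 0 ≤ p.a x * p.d x ^ 2)
    linarith
  set S : Set ℝ := {x | x ∈ Ioc (0 : ℝ) 1 ∧ p.Y x ≤ p.cst ^ 2} with hS
  have hne : S.Nonempty := by
    set C := p.lam * (1 ^ 2 / (p.a 1 * p.d 1 ^ 2)) with hC
    have hd0 : Tendsto p.d (𝓝[>] 0) (𝓝 0) := by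
      have h1 := (H.d_deg.cont 0 (by simp)).tendsto
      rw [H.d_deg.zero] at h1
      refine h1.mono_left ?_
      rw [← nhdsWithin_Ioc_eq_nhdsGT (zero_lt_one (α := ℝ))]
      exact nhdsWithin_mono _ Ioc_subset_Icc_self
    have h2 : Tendsto (fun x => C * p.d x) (𝓝[>] 0) (𝓝 0) := by simpa using hd0.const_mul C
    obtain ⟨x, hx1, hx⟩ := ((h2.eventually (gt_mem_nhds (pow_pos H.cst_pos 2))).and
      (Ioo_mem_nhdsGT (zero_lt_one (α := ℝ)))).exists
    have hx' : x ∈ Ioc (0 : ℝ) 1 := ⟨hx.1, hx.2.le⟩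
    refine ⟨x, hx', le_trans ?_ hx1.le⟩
    have ha := H.a_pos hx
    have hd := H.d_pos hx
    have h3 := mul_le_mul_of_nonneg_right (mul_le_mul_of_nonneg_left
      (hmono2 hx' one_mem_Ioc hx.2.le) H.lam_nonneg) hd.le
    refine le_trans (le_of_eq ?_) h3
    unfold Coeffs.Y; field_simp
  have hbdd : BddAbove S := ⟨1, fun x hx => hx.1.2⟩
  obtain ⟨y, hy⟩ := hne
  refine ⟨sSup S, ⟨hy.1.1.trans_le (le_csSup hbdd hy), csSup_le ⟨y, hy⟩ fun x hx => hx.1.2⟩,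
    fun x hx hlt => ?_, fun x hx hlt => ?_⟩
  · obtain ⟨z, hz, hxz⟩ := exists_lt_of_lt_csSup ⟨y, hy⟩ hlt
    exact (hmono ⟨hx.1, hx.2.le⟩ hz.1 hxz.le).trans hz.2
  · by_contra hcon
    exact absurd (le_csSup hbdd ⟨⟨hx.1, hx.2.le⟩, (not_le.1 hcon).le⟩) (not_le.2 hlt)

theorem monotoneOn_div_sqrt (H : Admissible p m) :
    MonotoneOn (fun x => x / √(p.a x)) (Ioc 0 1) := by
  intro x hx y hy hxy
  have h1 := Real.sqrt_le_sqrt (H.monotoneOn_sq_div_a hx hy hxy)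
  simp only [Real.sqrt_div (sq_nonneg _), Real.sqrt_sq hx.1.le, Real.sqrt_sq hy.1.le] at h1
  exact h1

theorem hasDerivAt_div_sqrt (H : Admissible p m) {x : ℝ} (hx : x ∈ Ioo (0 : ℝ) 1) :
    HasDerivAt (fun x => x / √(p.a x)) ((1 - 1 / 2 * logDer p.a x) * (1 / √(p.a x))) x := by
  have ha := H.a_pos hx
  have hs : 0 < √(p.a x) := Real.sqrt_pos.2 ha
  have h1 := (hasDerivAt_id' x).fun_div ((H.hasDerivAt_a hx).sqrt ha.ne') hs.ne'
  refine h1.congr_deriv ?_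
  unfold logDer
  have hss : √(p.a x) ^ 2 = p.a x := Real.sq_sqrt ha.le
  rw [hss]
  field_simp
  rw [hss]
  ring

/-- A front crossing `(0,1)` from right to left. Right of the switching point `xs` it moves slower
than the waves by the factor `(1 - K_a / 2) / (1 - k_a / 2)`, with `k_a = x a' / a`, which
makes its travel time explicit; left of `xs` it is instantaneous. -/
theorem exists_movingFront (H : Admissible p m) : ∃ k t₁ Θ Θx Θt, MovingFront p k t₁ Θ Θx Θt ∧
    0 ≤ k ∧ 0 ≤ t₁ ∧ k + p.C6 m * t₁ ≤ 2 * (1 / √(p.a 1)) := by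
  obtain ⟨xs, hxs, hleft, hright⟩ := H.exists_switch
  have hC6 := H.C6_pos
  have hm0 := H.m_nonneg
  have hK : 0 < 1 - degConst p.a / 2 := by unfold Coeffs.C6 at hC6; linarith
  set ξ : ℝ → ℝ := fun x => x / √(p.a x) with hξ
  have hmono : MonotoneOn ξ (Ioc 0 1) := H.monotoneOn_div_sqrt
  have hsq : ∀ x ∈ Ioc (0 : ℝ) 1, 0 < √(p.a x) := fun x hx => Real.sqrt_pos.2 (H.a_deg.pos x hx)
  set κ := 1 / √(p.a 1) with hκ
  have hκ0 : 0 < κ := one_div_pos.2 (hsq 1 one_mem_Ioc)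
  set k := ξ xs with hk
  have hk0 : 0 < k := div_pos hxs.1 (hsq xs hxs)
  have hkκ : k ≤ κ := hmono hxs one_mem_Ioc hxs.2
  -- `τ x` is the time the front takes from `x` to the switching point
  set τ : ℝ → ℝ := fun x => (1 - degConst p.a / 2)⁻¹ * max (ξ x - k) 0 with hτ
  set τ₁ := (1 - degConst p.a / 2)⁻¹ * (κ - k) with hτ₁
  have hτ₁0 : 0 ≤ τ₁ := mul_nonneg (inv_nonneg.2 hK.le) (by linarith)
  have hτ0 : ∀ x, 0 ≤ τ x := fun x => mul_nonneg (inv_nonneg.2 hK.le) (le_max_right _ _)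
  have hττ : ∀ x ∈ Ioo (0 : ℝ) 1, τ x ≤ τ₁ := fun x hx =>
    mul_le_mul_of_nonneg_left (max_le (sub_le_sub_right
      (hmono ⟨hx.1, hx.2.le⟩ one_mem_Ioc hx.2.le) _) (by linarith)) (inv_nonneg.2 hK.le)
  have hτac : LocAC τ := by
    have h1 : LocAC ξ := locAC_of_contDiffOn fun δ hδ =>
      contDiffOn_id.div ((H.a_deg.c1 δ hδ).sqrt fun x hx =>
        (H.a_deg.pos x ⟨hδ.1.trans_le hx.1, hx.2⟩).ne')
        fun x hx => (hsq x ⟨hδ.1.trans_le hx.1, hx.2⟩).ne'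
    exact ((h1.sub (locAC_of_contDiffOn fun _ _ => contDiffOn_const)).max_zero).const_mul _
  -- the width `δ` in time of the front is chosen with `C₆ δ = κ`, as the travel time `τ₁` costs
  -- `C₆ τ₁ ≤ κ - k`, which leaves `2 κ - k - C₆ τ₁ ≥ κ` for it
  set δ := κ / p.C6 m with hδ
  have hδ0 : 0 < δ := div_pos hκ0 hC6
  set τ' : ℝ → ℝ := fun x =>
    (1 - degConst p.a / 2)⁻¹ * ((1 - 1 / 2 * logDer p.a x) * (1 / √(p.a x))) with hτ'
  set q : ℝ → ℝ → ℝ := fun t x => δ⁻¹ * (t - τ₁ + τ x) with hq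
  have hqac : ∀ t, LocAC (q t) := fun t =>
    ((locAC_of_contDiffOn fun _ _ => contDiffOn_const).add hτac).const_mul _
  have hΘt : ∀ t, MemLp (fun x => δ⁻¹ * stepDeriv (q t x)) ⊤ leb := fun t =>
    memLp_top_of_bound (C := δ⁻¹ * 2) (aestronglyMeasurable_of_continuousOn_Ioc
      (continuousOn_const.mul (continuous_stepDeriv.comp_continuousOn (hqac t).continuousOn)))
      fun x _ => by
        have := stepDeriv_mem (q t x)
        rw [abs_of_nonneg (mul_nonneg (inv_nonneg.2 hδ0.le) this.1)]
        exact mul_le_mul_of_nonneg_left this.2 (inv_nonneg.2 hδ0.le)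
  have hτ'm : MemLp ((Ioi xs).indicator τ') ⊤ leb := by
    refine memLp_top_of_bound (C := (1 - degConst p.a / 2)⁻¹
      * ((1 + 1 / 2 * degConst p.a) * (κ / xs))) ?_ fun x hx => ?_
    · refine AEStronglyMeasurable.indicator ?_ measurableSet_Ioi
      have h1 : AEStronglyMeasurable (fun x => 1 / √(p.a x)) leb :=
        aestronglyMeasurable_of_continuousOn_Ioc (continuousOn_const.div
          H.a_deg.continuousOn_Ioc.sqrt fun x hx => (hsq x hx).ne')
      exact (((aestronglyMeasurable_const (b := (1 : ℝ))).sub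
        (H.memLp_ka.aestronglyMeasurable.const_mul (1 / 2))).mul h1).const_mul _
    · have hx' : x ∈ Ioc (0 : ℝ) 1 := ⟨hx.1, hx.2.le⟩
      have hd0 := H.a_deg.deg_pos
      by_cases hxx : x ∈ Ioi xs
      · rw [indicator_of_mem hxx, hτ', abs_mul, abs_of_pos (inv_pos.2 hK), abs_mul]
        refine mul_le_mul_of_nonneg_left (mul_le_mul ?_ ?_ (abs_nonneg _) (by linarith))
          (inv_nonneg.2 hK.le)
        · have h1 : |logDer p.a x| ≤ degConst p.a := by
            rw [logDer, abs_div, abs_of_pos (H.a_pos hx), div_le_iff₀ (H.a_pos hx)]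
            exact H.a_deg.deriv_le x hx
          have := abs_le.1 h1
          rw [abs_le]; constructor <;> linarith
        · rw [abs_of_pos (one_div_pos.2 (hsq x hx')), div_le_div_iff₀ (hsq x hx') hxs.1, one_mul]
          have h2 : x / √(p.a x) ≤ κ := hmono hx' one_mem_Ioc hx.2.le
          rw [div_le_iff₀ (hsq x hx')] at h2
          exact (le_of_lt hxx).trans h2
      · rw [indicator_of_notMem hxx, abs_zero]
        have := hxs.1
        positivity
  have hne : ∀ᵐ x ∂leb, x ≠ xs := by
    refine ae_restrict_of_ae ?_
    simp [ae_iff]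
  refine ⟨k, τ₁ + δ, fun t x => step (q t x),
    fun t x => (Ioi xs).indicator τ' x * (δ⁻¹ * stepDeriv (q t x)),
    fun t x => δ⁻¹ * stepDeriv (q t x), ?_, hk0.le, by linarith, ?_⟩
  · refine ⟨fun t => ⟨(hqac t).step, ?_, memLp_top_mul hτ'm (hΘt t), 1, fun x _ => ?_⟩,
      ⟨fun t => ?_, hΘt, 8 * δ⁻¹ ^ 2, fun s t => ae_of_all _ fun x => ?_⟩, fun t => ?_, ?_,
      fun t ht => ae_of_all _ fun x => ?_, fun t => (step_mem _).2⟩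
    · filter_upwards [ae_leb_mem, hne] with x hx hxne
      have hx' : x ∈ Ioc (0 : ℝ) 1 := ⟨hx.1, hx.2.le⟩
      have hτd : HasDerivAt τ ((Ioi xs).indicator τ' x) x := by
        rcases lt_or_gt_of_ne hxne with hlt | hgt
        · rw [indicator_of_notMem (by simpa using hlt.le)]
          refine (hasDerivAt_const x (0 : ℝ)).congr_of_eventuallyEq ?_
          filter_upwards [Ioo_mem_nhds hx.1 hlt] with y hy
          have : ξ y ≤ k := hmono ⟨hy.1, hy.2.le.trans hxs.2⟩ hxs hy.2.le
          simp only [hτ]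
          rw [max_eq_right (by linarith), mul_zero]
        · rw [indicator_of_mem (mem_Ioi.2 hgt)]
          refine (((H.hasDerivAt_div_sqrt hx).sub_const k).const_mul
            (1 - degConst p.a / 2)⁻¹).congr_of_eventuallyEq ?_
          filter_upwards [Ioo_mem_nhds hgt hx.2] with y hy
          have : k ≤ ξ y := hmono hxs ⟨hxs.1.trans hy.1, hy.2.le⟩ hy.1.le
          simp only [hτ]
          rw [max_eq_left (by linarith)]
      have h1 := (hasDerivAt_step (q t x)).comp x ((hτd.const_add (t - τ₁)).const_mul δ⁻¹)
      refine h1.congr_deriv ?_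
      ring
    · have := step_mem (q t x)
      rw [abs_of_nonneg this.1]; exact this.2
    · refine memLp_top_of_bound (C := 1) (aestronglyMeasurable_of_continuousOn_Ioc
        (hqac t).step.continuousOn) fun x _ => ?_
      have := step_mem (q t x)
      rw [abs_of_nonneg this.1]; exact this.2
    · have h1 := abs_step_sub_le (q t x) (δ⁻¹ * (s - t))
      have e1 : q t x + δ⁻¹ * (s - t) = q s x := by simp only [hq]; ring
      rw [e1] at h1
      have e2 : (s - t) * (δ⁻¹ * stepDeriv (q t x)) = δ⁻¹ * (s - t) * stepDeriv (q t x) := by ring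
      rw [e2]
      refine h1.trans (le_of_eq ?_)
      ring
    · filter_upwards [ae_leb_mem, hne] with x hx hxne
      have hx' : x ∈ Ioc (0 : ℝ) 1 := ⟨hx.1, hx.2.le⟩
      refine ⟨(step_mem _).1, mul_nonneg (inv_nonneg.2 hδ0.le) (stepDeriv_mem _).1, ?_⟩
      rcases lt_or_gt_of_ne hxne with hlt | hgt
      · left
        exact ⟨by beta_reduce; rw [indicator_of_notMem (by simpa using hlt.le), zero_mul],
          hmono hx' hxs hlt.le, hleft x hx hlt⟩
      · right
        refine ⟨τ' x, by beta_reduce; rw [indicator_of_mem (mem_Ioi.2 hgt)], ?_,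
          hmono hxs hx' hgt.le, hright x hx hgt⟩
        have h1 := H.logDer_a_le hx
        have hs := hsq x hx'
        have e : τ' x * √(p.a x) = (1 - degConst p.a / 2)⁻¹ * (1 - 1 / 2 * logDer p.a x) := by
          simp only [hτ']; field_simp
        rw [e, inv_mul_eq_div, le_div_iff₀ hK]
        linarith
    · filter_upwards [ae_leb_mem] with x hx
      refine step_of_nonpos (mul_nonpos_of_nonneg_of_nonpos (inv_nonneg.2 hδ0.le) ?_)
      linarith [hττ x hx]
    · refine step_of_one_le ?_
      simp only [hq]
      rw [inv_mul_eq_div, le_div_iff₀ hδ0]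
      linarith [hτ0 x]
  · have h1 : p.C6 m * τ₁ ≤ κ - k := by
      rw [hτ₁, ← mul_assoc, ← div_eq_mul_inv]
      refine mul_le_of_le_one_left (by linarith) ?_
      rw [div_le_one hK]
      unfold Coeffs.C6; linarith
    have h2 : p.C6 m * δ = κ := by rw [hδ]; field_simp
    rw [mul_add, h2]
    linarith

end Admissible

/-! ### Observability of classical solutions -/

namespace Admissible

variable {p : Coeffs} {m : ℝ}

theorem locEnergy_congr {Θ Ψ : ℝ → ℝ} (h : ∀ᵐ x ∂leb, Θ x = Ψ x) (Z P G : L2) :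
    p.locEnergy Θ Z P G = p.locEnergy Ψ Z P G := by
  unfold Coeffs.locEnergy
  rw [wform_congr h, wform_congr (φ := fun x => Θ x * p.eta x) (ψ := fun x => Ψ x * p.eta x)
    (h.mono fun x hx => by rw [hx]), wform_congr (φ := fun x => Θ x * p.kap x)
    (ψ := fun x => Ψ x * p.kap x) (h.mono fun x hx => by rw [hx])]

theorem momentum_congr {Θ Ψ : ℝ → ℝ} (h : ∀ᵐ x ∂leb, Θ x = Ψ x) (Z P : L2) :
    p.momentum Θ Z P = p.momentum Ψ Z P :=
  wform_congr (h.mono fun x hx => by rw [hx]) _ _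

/-- The multiplier inequality integrated over the passage of a moving front. -/
theorem half_estimate (H : Admissible p m) {T S k t₁ : ℝ} {w v Θ Θx Θt : ℝ → ℝ → ℝ}
    (h : p.ClassicalSolution T w v) (hF : MovingFront p k t₁ Θ Θx Θt) (hk : 0 ≤ k)
    (ht₁ : 0 ≤ t₁) (htS : t₁ ≤ S) (hST : S ≤ T) :
    p.momentum (fun _ => 1) (zetaOp p.cst (toL2 (deriv (w S)))) (toL2 (p.nrm (v S)))
      - k * p.energy (w 0) (v 0) + p.C6 m * p.energy (w 0) (v 0) * (S - t₁)
      ≤ 1 / 2 * p.eta 1 * ∫ t in (0 : ℝ)..S, derivWithin (w t) (Icc 0 1) 1 ^ 2 := by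
  set E := p.energy (w 0) (v 0) with hE
  have hS : 0 ≤ S := ht₁.trans htS
  have hη := p.eta_pos 1
  have hC6 := H.C6_pos
  have hsub : Icc 0 S ⊆ Icc 0 T := Icc_subset_Icc_right hST
  have htr : ContinuousOn (fun t => derivWithin (w t) (Icc 0 1) 1 ^ 2) (Icc 0 S) :=
    (h.continuousOn_trace.mono hsub).pow 2
  have hint1 : IntervalIntegrable (fun t => 1 / 2 * p.eta 1 * derivWithin (w t) (Icc 0 1) 1 ^ 2)
      volume 0 S :=
    (ContinuousOn.intervalIntegrable (by rwa [uIcc_of_le hS])).const_mul _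
  have hint2 : IntervalIntegrable ((Ici t₁).indicator fun _ => p.C6 m * E) volume 0 S :=
    ⟨(integrable_const _).indicator measurableSet_Ici,
      (integrable_const _).indicator measurableSet_Ici⟩
  have key := intervalIntegral.sub_le_integral_of_hasDeriv_right_of_le hS
    (((continuousOn_momentum h H hF.timeWeight).mono hsub).sub
      (continuousOn_const.mul ((continuousOn_locEnergy h H hF.timeWeight).mono hsub)))
    (fun t ht => ((hasDerivAt_momentum h H hF.timeWeight ⟨ht.1, ht.2.trans_le hST⟩).sub
      ((hasDerivAt_locEnergy h H hF.timeWeight ⟨ht.1, ht.2.trans_le hST⟩).const_mul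
        k)).hasDerivWithinAt)
    ((intervalIntegrable_iff_integrableOn_Icc_of_le hS).1 (hint1.sub hint2))
    (fun t ht => by
      have ht' : t ∈ Icc 0 T := ⟨ht.1.le, ht.2.le.trans hST⟩
      have hw := h.memDom t ht'
      have hv := h.memH1 t ht'
      have h1 := H.multiplier_inequality hw hv (hF.isWeight t) (hF.timeWeight.memLp_t t) hk
        (hF.front t) (hw.isH1Left.zetaOp_deriv _).symm (hv.isH1Left.zetaOp_deriv _).symm rfl rfl
        hw.isH1Left.hardyOp_deriv.symm hv.isH1Left.hardyOp_deriv.symm rfl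
      refine (le_sub_iff_add_le.2 h1).trans ?_
      have h2 : Θ t 1 * p.eta 1 * derivWithin (w t) (Icc 0 1) 1 ^ 2
          ≤ p.eta 1 * derivWithin (w t) (Icc 0 1) 1 ^ 2 :=
        mul_le_mul_of_nonneg_right (mul_le_of_le_one_left hη.le (hF.trace_le t)) (sq_nonneg _)
      by_cases htt : t ∈ Ici t₁
      · have h3 := H.energy_le hw.1 hv.1 rfl rfl (hF.full t htt)
        rw [H.energy_conserved h ht', ← hE] at h3
        have h4 := mul_le_mul_of_nonneg_left h3 hC6.le
        rw [indicator_of_mem htt]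
        linarith
      · have h3 := wform_self_nonneg ((hF.front t).mono fun x hx => hx.1)
          (toL2 (p.nrm (v t)))
        have h4 := wform_self_nonneg (φ := fun x => Θ t x * p.eta x)
          ((hF.front t).mono fun x hx => mul_nonneg hx.1 (p.eta_pos x).le) (toL2 (deriv (w t)))
        have h5 := mul_nonneg hC6.le (add_nonneg h3 h4)
        rw [indicator_of_notMem htt]
        linarith)
  have e2 : ∫ t in (0 : ℝ)..S, (Ici t₁).indicator (fun _ => p.C6 m * E) t
      = p.C6 m * E * (S - t₁) := by
    have hsub2 : ∀ a b : ℝ, IntervalIntegrable ((Ici t₁).indicator fun _ => p.C6 m * E) volume a b :=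
      fun a b => ⟨(integrable_const _).indicator measurableSet_Ici,
        (integrable_const _).indicator measurableSet_Ici⟩
    rw [← intervalIntegral.integral_add_adjacent_intervals (hsub2 0 t₁) (hsub2 t₁ S)]
    have i1 : ∫ t in (0 : ℝ)..t₁, (Ici t₁).indicator (fun _ => p.C6 m * E) t = 0 := by
      rw [intervalIntegral.integral_of_le ht₁, integral_Ioc_eq_integral_Ioo]
      refine setIntegral_eq_zero_of_forall_eq_zero fun x hx => ?_
      exact indicator_of_notMem (by simpa using hx.2) _
    have i2 : ∫ t in t₁..S, (Ici t₁).indicator (fun _ => p.C6 m * E) t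
        = ∫ t in t₁..S, p.C6 m * E := by
      refine intervalIntegral.integral_congr fun x hx => ?_
      rw [uIcc_of_le htS] at hx
      exact indicator_of_mem (mem_Ici.2 hx.1) _
    rw [i1, i2, intervalIntegral.integral_const, smul_eq_mul]; ring
  have hSm : S ∈ Icc 0 T := ⟨hS, hST⟩
  have hSD := h.memDom S hSm
  have hSH := h.memH1 S hSm
  have e3 : p.locEnergy (Θ S) (zetaOp p.cst (toL2 (deriv (w S)))) (toL2 (p.nrm (v S)))
      (hardyOp (toL2 (deriv (w S)))) = E := by
    rw [locEnergy_congr (hF.full S htS), ← H.energy_eq' hSD.1 hSH.1, H.energy_conserved h hSm]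
  have e4 := momentum_congr (p := p) (hF.full S htS) (zetaOp p.cst (toL2 (deriv (w S))))
    (toL2 (p.nrm (v S)))
  have e5 : p.locEnergy (Θ 0) (zetaOp p.cst (toL2 (deriv (w 0)))) (toL2 (p.nrm (v 0)))
      (hardyOp (toL2 (deriv (w 0)))) = 0 := by
    rw [locEnergy_congr hF.start]; simp [Coeffs.locEnergy, wform]
  have e6 : p.momentum (Θ 0) (zetaOp p.cst (toL2 (deriv (w 0)))) (toL2 (p.nrm (v 0))) = 0 := by
    rw [momentum_congr hF.start]; simp [Coeffs.momentum, wform]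
  rw [intervalIntegral.integral_sub hint1 hint2, e2, intervalIntegral.integral_const_mul] at key
  simp only [Pi.sub_apply, Pi.mul_apply] at key
  rw [e3, e4, e5, e6] at key
  linarith

/-- Observability of classical solutions with nonnegative energy. The estimate over the first half of the time interval is
combined with the same estimate for the solution run backwards; the momenta at the middle time
cancel. -/
theorem observability_classical_of_energy_nonneg (H : Admissible p m) {T : ℝ} {w v : ℝ → ℝ → ℝ}
    (h : p.ClassicalSolution T w v) (hT : 4 * (1 / √(p.a 1)) ≤ p.C6 m * T)
    (hE : 0 ≤ p.energy (w 0) (v 0)) :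
    (p.C6 m * T - 4 * (1 / √(p.a 1))) * p.energy (w 0) (v 0)
      ≤ 1 / 2 * p.eta 1 * ∫ t in (0 : ℝ)..T, derivWithin (w t) (Icc 0 1) 1 ^ 2 := by
  obtain ⟨k, t₁, Θ, Θx, Θt, hF, hk, ht₁, hkt⟩ := H.exists_movingFront
  have hC6 := H.C6_pos
  have ht : t₁ ≤ T / 2 := by
    have : p.C6 m * t₁ ≤ p.C6 m * (T / 2) := by linarith
    exact le_of_mul_le_mul_left this hC6
  have hT0 : 0 ≤ T := by linarith
  have h1 := H.half_estimate h hF hk ht₁ ht (by linarith)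
  have hr := h.reverse H
  have h2 := H.half_estimate hr hF hk ht₁ ht (by linarith)
  have hTm : T ∈ Icc 0 T := ⟨hT0, le_rfl⟩
  have hmid : T / 2 ∈ Icc 0 T := ⟨by linarith, by linarith⟩
  have eE : p.energy (w (T - 0)) (fun x => -v (T - 0) x) = p.energy (w 0) (v 0) := by
    rw [sub_zero, ← H.energy_conserved h hTm]
    simp [Coeffs.energy]
  have eh : T - T / 2 = T / 2 := by ring
  have eP : toL2 (p.nrm fun x => -v (T / 2) x) = -toL2 (p.nrm (v (T / 2))) := by
    rw [← toL2_neg _ (H.memLp_nrm (h.memH1 _ hmid).1)]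
    congr 1; ext x; simp [Coeffs.nrm, neg_div]
  have em : p.momentum (fun _ => 1) (zetaOp p.cst (toL2 (deriv (w (T / 2)))))
      (-toL2 (p.nrm (v (T / 2)))) = -p.momentum (fun _ => 1)
        (zetaOp p.cst (toL2 (deriv (w (T / 2))))) (toL2 (p.nrm (v (T / 2)))) := by
    unfold Coeffs.momentum
    rw [← neg_one_smul ℝ (toL2 (p.nrm (v (T / 2)))), wform_smul_right]; ring
  have ei : ∫ t in (0 : ℝ)..T / 2, derivWithin (w (T - t)) (Icc 0 1) 1 ^ 2
      = ∫ t in T / 2..T, derivWithin (w t) (Icc 0 1) 1 ^ 2 := by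
    have := intervalIntegral.integral_comp_sub_left (a := 0) (b := T / 2)
      (fun t => derivWithin (w t) (Icc 0 1) 1 ^ 2) T
    rw [this, eh, sub_zero]
  have hi : ∀ a b : ℝ, a ∈ Icc 0 T → b ∈ Icc 0 T →
      IntervalIntegrable (fun t => derivWithin (w t) (Icc 0 1) 1 ^ 2) volume a b := by
    intro a b ha hb
    refine ContinuousOn.intervalIntegrable ((h.continuousOn_trace.pow 2).mono ?_)
    exact uIcc_subset_Icc ha hb
  beta_reduce at h2
  rw [eE, eh, eP, em, ei] at h2
  rw [← intervalIntegral.integral_add_adjacent_intervals (hi 0 (T / 2) ⟨le_rfl, hT0⟩ hmid)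
    (hi (T / 2) T hmid hTm)]
  have h3 := mul_le_mul_of_nonneg_right hkt hE
  linarith

end Admissible

/-! ### Linear combinations -/

theorem tendsto_of_norm_sub_sq {ι E : Type*} [NormedAddCommGroup E] {l : Filter ι} {f : ι → E}
    {a : E} (h : Tendsto (fun i => ‖f i - a‖ ^ 2) l (𝓝 0)) : Tendsto f l (𝓝 a) := by
  rw [tendsto_iff_norm_sub_tendsto_zero]
  have h1 := h.sqrt
  simpa [Real.sqrt_sq (norm_nonneg _)] using h1

theorem toL2_comb {f g : ℝ → ℝ} (hf : MemLp f 2 leb) (hg : MemLp g 2 leb) (c : ℝ) :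
    toL2 (fun x => c * (f x - g x)) = c • (toL2 f - toL2 g) := by
  have h : MemLp (fun x => f x - g x) 2 leb := hf.sub hg
  rw [toL2_const_mul h, toL2_sub hf hg]

theorem IsH1Left.deriv_comb {u z : ℝ → ℝ} (hu : IsH1Left u) (hz : IsH1Left z) (c : ℝ) :
    deriv (fun x => c * (u x - z x)) =ᵐ[leb] fun x => c * (deriv u x - deriv z x) := by
  filter_upwards [hu.ae_hasDerivAt, hz.ae_hasDerivAt] with x h1 h2
  exact ((h1.fun_sub h2).const_mul c).deriv

theorem memLp_comb {f g : ℝ → ℝ} {q : ENNReal} (hf : MemLp f q leb) (hg : MemLp g q leb) (c : ℝ) :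
    MemLp (fun x => c * (f x - g x)) q leb := (hf.sub hg).const_mul c

theorem IsH1Left.toL2_deriv_comb {u z : ℝ → ℝ} (hu : IsH1Left u) (hz : IsH1Left z) (c : ℝ) :
    toL2 (deriv fun x => c * (u x - z x)) = c • (toL2 (deriv u) - toL2 (deriv z)) := by
  rw [← toL2_comb hu.memLp hz.memLp]
  exact (toL2_congr (memLp_comb hu.memLp hz.memLp c) (hu.deriv_comb hz c).symm).symm

theorem Coeffs.nrm_comb (p : Coeffs) (u z : ℝ → ℝ) (c : ℝ) :
    p.nrm (fun x => c * (u x - z x)) = fun x => c * (p.nrm u x - p.nrm z x) := by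
  ext x; simp only [Coeffs.nrm]; ring

namespace Admissible

variable {p : Coeffs} {m : ℝ}

theorem toL2_nrm_comb (H : Admissible p m) {u z : ℝ → ℝ} (hu : p.MemL2 u) (hz : p.MemL2 z)
    (c : ℝ) : toL2 (p.nrm fun x => c * (u x - z x))
      = c • (toL2 (p.nrm u) - toL2 (p.nrm z)) := by
  rw [p.nrm_comb, toL2_comb (H.memLp_nrm hu) (H.memLp_nrm hz)]

theorem memL2_of_nrm (H : Admissible p m) {u : ℝ → ℝ} (h1 : MemLp u 2 leb)
    (h2 : MemLp (p.nrm u) 2 leb) : p.MemL2 u := by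
  refine ⟨h1, h2.integrable_sq.congr ?_⟩
  filter_upwards [ae_leb_mem] with x hx
  rw [Coeffs.nrm, div_pow, Real.sq_sqrt (H.sigma_pos ⟨hx.1, hx.2.le⟩).le]

theorem normL2sq_eq (H : Admissible p m) {u : ℝ → ℝ} (hu : p.MemL2 u) :
    p.normL2sq u = ‖toL2 (p.nrm u)‖ ^ 2 := by
  rw [norm_toL2_sq (H.memLp_nrm hu)]
  refine integral_congr_ae ?_
  filter_upwards [ae_leb_mem] with x hx
  rw [Coeffs.nrm, div_pow, Real.sq_sqrt (H.sigma_pos ⟨hx.1, hx.2.le⟩).le]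

theorem memL2_comb (H : Admissible p m) {u z : ℝ → ℝ} (hu : p.MemL2 u) (hz : p.MemL2 z) (c : ℝ) :
    p.MemL2 fun x => c * (u x - z x) := by
  refine H.memL2_of_nrm (memLp_comb hu.1 hz.1 c) ?_
  rw [p.nrm_comb]
  exact memLp_comb (H.memLp_nrm hu) (H.memLp_nrm hz) c

theorem memH1_comb (H : Admissible p m) {u z : ℝ → ℝ} (hu : p.MemH1 u) (hz : p.MemH1 z) (c : ℝ) :
    p.MemH1 fun x => c * (u x - z x) := by
  refine ⟨H.memL2_comb hu.1 hz.1 c, (hu.2.1.fun_sub hz.2.1).const_mul c, ?_, ?_, ?_⟩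
  · exact (memLp_congr_ae (hu.isH1Left.deriv_comb hz.isH1Left c)).2
      (memLp_comb hu.2.2.1 hz.2.2.1 c)
  · simp [hu.2.2.2.1, hz.2.2.2.1]
  · simp [hu.2.2.2.2, hz.2.2.2.2]

theorem derivWithin_comb {u z : ℝ → ℝ} (hu : p.MemDom u) (hz : p.MemDom z) (c : ℝ) {x : ℝ}
    (hx : x ∈ Ioc (0 : ℝ) 1) : derivWithin (fun x => c * (u x - z x)) (Icc 0 1) x
      = c * (derivWithin u (Icc 0 1) x - derivWithin z (Icc 0 1) x) :=
  (((hu.hasDerivWithinAt hx).fun_sub (hz.hasDerivWithinAt hx)).const_mul c).derivWithin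
    (uniqueDiffOn_Icc zero_lt_one x ⟨hx.1.le, hx.2⟩)

theorem op_comb {u z : ℝ → ℝ} (hu : p.MemDom u) (hz : p.MemDom z) (c : ℝ) :
    p.op (fun x => c * (u x - z x)) =ᵐ[leb] fun x => c * (p.op u x - p.op z x) := by
  filter_upwards [ae_leb_mem, hu.ae_hasDerivAt_deriv, hz.ae_hasDerivAt_deriv] with x hx h1 h2
  have e1 : deriv (fun x => c * (u x - z x)) x = c * (deriv u x - deriv z x) := by
    have := derivWithin_comb hu hz c ⟨hx.1, hx.2.le⟩
    rwa [derivWithin_eq_deriv hx, derivWithin_eq_deriv hx, derivWithin_eq_deriv hx] at this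
  have e2 : deriv (deriv fun x => c * (u x - z x)) x
      = c * (deriv (deriv u) x - deriv (deriv z) x) := by
    refine (((h1.fun_sub h2).const_mul c).congr_of_eventuallyEq ?_).deriv
    filter_upwards [Ioo_mem_nhds hx.1 hx.2] with y hy
    rw [← derivWithin_comb hu hz c ⟨hy.1, hy.2.le⟩, derivWithin_eq_deriv hy]
  simp only [Coeffs.op]
  rw [e1, e2]; ring

theorem memL2_congr (H : Admissible p m) {u z : ℝ → ℝ} (hu : p.MemL2 u) (h : u =ᵐ[leb] z) :
    p.MemL2 z := by
  refine H.memL2_of_nrm ((memLp_congr_ae h).1 hu.1) ((memLp_congr_ae ?_).1 (H.memLp_nrm hu))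
  filter_upwards [h] with x hx
  simp only [Coeffs.nrm, hx]

theorem toL2_nrm_congr (H : Admissible p m) {u z : ℝ → ℝ} (hu : p.MemL2 u) (h : u =ᵐ[leb] z) :
    toL2 (p.nrm u) = toL2 (p.nrm z) := by
  refine toL2_congr (H.memLp_nrm hu) ?_
  filter_upwards [h] with x hx
  simp only [Coeffs.nrm, hx]

theorem memDom_comb (H : Admissible p m) {u z : ℝ → ℝ} (hu : p.MemDom u) (hz : p.MemDom z)
    (c : ℝ) : p.MemDom fun x => c * (u x - z x) := by
  refine ⟨H.memH1_comb hu.1 hz.1 c, fun δ hδ => ?_,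
    H.memL2_congr (H.memL2_comb hu.2.2 hz.2.2 c) (op_comb hu hz c).symm⟩
  refine absolutelyContinuousOnInterval_congr
    (((hu.2.1 δ hδ).fun_sub (hz.2.1 δ hδ)).const_mul c) fun x hx => ?_
  rw [uIcc_of_le hδ.2.le] at hx
  exact (derivWithin_comb hu hz c ⟨hδ.1.trans_le hx.1, hx.2⟩).symm

theorem toL2_nrm_op_comb (H : Admissible p m) {u z : ℝ → ℝ} (hu : p.MemDom u) (hz : p.MemDom z)
    (c : ℝ) : toL2 (p.nrm (p.op fun x => c * (u x - z x)))
      = c • (toL2 (p.nrm (p.op u)) - toL2 (p.nrm (p.op z))) := by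
  rw [← H.toL2_nrm_comb hu.2.2 hz.2.2]
  exact H.toL2_nrm_congr (H.memDom_comb hu hz c).2.2 (op_comb hu hz c)

theorem classicalSolution_comb (H : Admissible p m) {T : ℝ} {w v w' v' : ℝ → ℝ → ℝ}
    (h : p.ClassicalSolution T w v) (h' : p.ClassicalSolution T w' v') (c : ℝ) :
    p.ClassicalSolution T (fun t x => c * (w t x - w' t x)) (fun t x => c * (v t x - v' t x)) := by
  have e1 : ∀ t ∈ Icc 0 T, toL2 (deriv fun x => c * (w t x - w' t x))
      = c • (toL2 (deriv (w t)) - toL2 (deriv (w' t))) := fun t ht =>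
    (h.memDom t ht).isH1Left.toL2_deriv_comb (h'.memDom t ht).isH1Left c
  have e2 : ∀ t ∈ Icc 0 T, toL2 (p.nrm fun x => c * (v t x - v' t x))
      = c • (toL2 (p.nrm (v t)) - toL2 (p.nrm (v' t))) := fun t ht =>
    H.toL2_nrm_comb (h.memH1 t ht).1 (h'.memH1 t ht).1 c
  have ev : ∀ t ∈ Ioo 0 T, ∀ᶠ s in 𝓝 t, s ∈ Icc 0 T := fun t ht => Icc_mem_nhds ht.1 ht.2
  refine ⟨fun t ht => H.memDom_comb (h.memDom t ht) (h'.memDom t ht) c,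
    fun t ht => H.memH1_comb (h.memH1 t ht) (h'.memH1 t ht) c, ?_, ?_, ?_, ?_, ?_⟩
  · exact ((h.continuousOn_deriv.sub h'.continuousOn_deriv).const_smul c).congr e1
  · exact ((h.continuousOn_vel.sub h'.continuousOn_vel).const_smul c).congr e2
  · intro t ht
    have ht' : t ∈ Icc 0 T := ⟨ht.1.le, ht.2.le⟩
    rw [(h.memH1 t ht').isH1Left.toL2_deriv_comb (h'.memH1 t ht').isH1Left]
    exact (((h.hasDerivAt_deriv t ht).fun_sub (h'.hasDerivAt_deriv t ht)).fun_const_smul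
      c).congr_of_eventuallyEq ((ev t ht).mono e1)
  · intro t ht
    have ht' : t ∈ Icc 0 T := ⟨ht.1.le, ht.2.le⟩
    rw [H.toL2_nrm_op_comb (h.memDom t ht') (h'.memDom t ht')]
    exact (((h.hasDerivAt_vel t ht).fun_sub (h'.hasDerivAt_vel t ht)).fun_const_smul
      c).congr_of_eventuallyEq ((ev t ht).mono e2)
  · exact (continuousOn_const.mul (h.continuousOn_trace.sub h'.continuousOn_trace)).congr
      fun t ht => derivWithin_comb (h.memDom t ht) (h'.memDom t ht) c one_mem_Ioc

end Admissible

/-! ### Mild solutions as curves in `L²(0,1)` -/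

/-- The functional `F ↦ ∫₀ˣ F` on `L²(0,1)`. -/
def evalOp (x : ℝ) (hx : x ∈ Icc (0 : ℝ) 1) : L2 →L[ℝ] ℝ :=
  LinearMap.mkContinuous
    { toFun := fun F => ∫ s in (0 : ℝ)..x, F s
      map_add' := fun F G => by
        have hi : ∀ F : L2, IntervalIntegrable F volume 0 x := fun F =>
          intervalIntegrable_of_leb ((Lp.memLp F).integrable one_le_two) (by simp) hx
        rw [integral_congr_leb (Lp.coeFn_add F G) hx]
        exact intervalIntegral.integral_add (hi F) (hi G)
      map_smul' := fun c F => by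
        rw [RingHom.id_apply, integral_congr_leb (Lp.coeFn_smul c F) hx, smul_eq_mul,
          ← intervalIntegral.integral_const_mul]
        rfl } 1 fun F => by
    obtain ⟨h1, h2⟩ := isH1Left_integral (Lp.memLp F)
    have h3 := h1.sq_le' hx
    rw [← norm_toL2_sq h1.memLp, toL2_eq (F := F) h2.symm] at h3
    rw [Real.norm_eq_abs, one_mul]
    refine abs_le_of_sq_le_sq (h3.trans ?_) (norm_nonneg _)
    exact mul_le_of_le_one_left (sq_nonneg _) hx.2

theorem evalOp_apply {x : ℝ} (hx : x ∈ Icc (0 : ℝ) 1) (F : L2) :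
    evalOp x hx F = ∫ s in (0 : ℝ)..x, F s := rfl

theorem IsH1Left.toL2_deriv_eq {u : ℝ → ℝ} {F : L2}
    (h : ∀ x ∈ Icc (0 : ℝ) 1, u x = ∫ s in (0 : ℝ)..x, F s) : toL2 (deriv u) = F := by
  refine toL2_eq ?_
  filter_upwards [(isH1Left_integral (Lp.memLp F)).2, ae_leb_mem] with x h1 hx
  rw [← h1]
  refine Filter.EventuallyEq.deriv_eq ?_
  filter_upwards [Icc_mem_nhds hx.1 hx.2] with y hy
  exact (h y hy).symm

namespace Coeffs.IsMildSolution

variable {p : Coeffs} {m : ℝ} {y0 y1 : ℝ → ℝ} {y v : ℝ → ℝ → ℝ}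

theorem continuousOn_deriv (H : Admissible p m) (h : p.IsMildSolution y0 y1 y v) :
    ContinuousOn (fun t => toL2 (deriv (y t))) (Ici 0) := by
  obtain ⟨e₀, e₁, he0, -, he⟩ := H.exists_eta_bounds
  intro t ht
  refine tendsto_of_norm_sub_sq ?_
  have h1 := (h.continuousH1 t ht).const_mul e₀⁻¹
  rw [mul_zero] at h1
  refine squeeze_zero' (Eventually.of_forall fun s => sq_nonneg _) ?_ h1
  filter_upwards [self_mem_nhdsWithin] with s hs
  have hcomb := H.memH1_comb (h.memH1 s hs) (h.memH1 t ht) 1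
  have e := (h.memH1 s hs).isH1Left.toL2_deriv_comb (h.memH1 t ht).isH1Left 1
  simp only [one_mul, one_smul] at e hcomb
  rw [← e, norm_toL2_sq hcomb.isH1Left.memLp, ← div_eq_inv_mul, le_div_iff₀ he0]
  unfold Coeffs.normH1sq
  have h2 : 0 ≤ p.normL2sq fun x => y s x - y t x := by
    rw [H.normL2sq_eq hcomb.1]; positivity
  refine le_add_of_nonneg_of_le h2 ?_
  rw [mul_comm, ← integral_const_mul]
  have hsq := hcomb.isH1Left.memLp
  refine integral_mono_ae (hsq.integrable_sq.const_mul _) ?_ ?_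
  · refine (integrable_weight_mul H.memLp_eta hsq hsq).congr (ae_of_all _ fun x => ?_)
    simp only [pow_two]
  · filter_upwards [ae_leb_mem] with x hx
    exact mul_le_mul_of_nonneg_right (he x ⟨hx.1.le, hx.2.le⟩).1 (sq_nonneg _)

theorem continuousOn_vel (H : Admissible p m) (h : p.IsMildSolution y0 y1 y v) :
    ContinuousOn (fun t => toL2 (p.nrm (v t))) (Ici 0) := by
  intro t ht
  refine tendsto_of_norm_sub_sq ((h.continuousL2 t ht).congr' ?_)
  filter_upwards [self_mem_nhdsWithin] with s hs
  have hcomb := H.memL2_comb (h.memL2 s hs) (h.memL2 t ht) 1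
  have e := H.toL2_nrm_comb (h.memL2 s hs) (h.memL2 t ht) 1
  simp only [one_mul, one_smul] at e hcomb
  rw [H.normL2sq_eq hcomb, e]

theorem hasDerivWithinAt_pos (H : Admissible p m) (h : p.IsMildSolution y0 y1 y v) {t : ℝ}
    (ht : 0 ≤ t) : HasDerivWithinAt (fun t => toL2 (p.nrm (y t))) (toL2 (p.nrm (v t)))
      (Ici 0) t := by
  rw [hasDerivWithinAt_iff_tendsto_slope]
  refine tendsto_of_norm_sub_sq ((h.hasDeriv t ht).congr' ?_)
  filter_upwards [self_mem_nhdsWithin] with s hs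
  have hyc := H.memL2_comb (h.memH1 s hs.1).1 (h.memH1 t ht).1 (s - t)⁻¹
  have hcomb := H.memL2_comb hyc (h.memL2 t ht) 1
  have e := H.toL2_nrm_comb hyc (h.memL2 t ht) 1
  rw [H.toL2_nrm_comb (h.memH1 s hs.1).1 (h.memH1 t ht).1] at e
  simp only [one_mul, one_smul] at e hcomb
  rw [slope, vsub_eq_sub, ← e, ← H.normL2sq_eq hcomb]
  congr 1
  ext x
  rw [div_eq_inv_mul]

/-- The velocity curve `t ↦ v(t) / √σ`, extended by its initial value to negative times. -/
def _root_.DegWave.Coeffs.velCurve (p : Coeffs) (v : ℝ → ℝ → ℝ) (t : ℝ) : L2 :=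
  toL2 (p.nrm (v (max t 0)))

/-- The curve `t ↦ y_x(t)`, extended by its initial value to negative times. -/
def _root_.DegWave.derivCurve (y : ℝ → ℝ → ℝ) (t : ℝ) : L2 := toL2 (deriv (y (max t 0)))

theorem continuous_derivCurve (H : Admissible p m) (h : p.IsMildSolution y0 y1 y v) :
    Continuous (derivCurve y) :=
  (h.continuousOn_deriv H).comp_continuous (by fun_prop) fun _ => mem_Ici.2 (le_max_right _ _)

theorem continuous_velCurve (H : Admissible p m) (h : p.IsMildSolution y0 y1 y v) :
    Continuous (p.velCurve v) :=
  (h.continuousOn_vel H).comp_continuous (by fun_prop) fun _ => mem_Ici.2 (le_max_right _ _)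

theorem toL2_nrm_pos (H : Admissible p m) (h : p.IsMildSolution y0 y1 y v) {t : ℝ} (ht : 0 ≤ t) :
    toL2 (p.nrm (y t)) = toL2 (p.nrm (y 0)) + ∫ s in (0 : ℝ)..t, p.velCurve v s := by
  have hd : ∀ s ∈ Ici (0 : ℝ), HasDerivWithinAt (fun t => toL2 (p.nrm (y t)))
      (p.velCurve v s) (Ici 0) s := fun s hs => by
    have := h.hasDerivWithinAt_pos H hs
    rwa [Coeffs.velCurve, max_eq_left hs]
  rw [intervalIntegral.integral_eq_sub_of_hasDeriv_right_of_le ht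
    (f := fun t => toL2 (p.nrm (y t)))
    (fun s hs => (hd s hs.1).continuousWithinAt.mono Icc_subset_Ici_self)
    (fun s hs => (hd s hs.1.le).mono (Ioi_subset_Ici hs.1.le))
    ((h.continuous_velCurve H).intervalIntegrable _ _)]
  abel

theorem toL2_deriv_timeInt (H : Admissible p m) (h : p.IsMildSolution y0 y1 y v) {t : ℝ}
    (ht : 0 ≤ t) : toL2 (deriv (Coeffs.timeInt y t)) = ∫ s in (0 : ℝ)..t, derivCurve y s := by
  refine IsH1Left.toL2_deriv_eq fun x hx => ?_
  rw [← evalOp_apply hx, ← ContinuousLinearMap.intervalIntegral_comp_comm _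
    ((h.continuous_derivCurve H).intervalIntegrable _ _)]
  refine intervalIntegral.integral_congr fun s hs => ?_
  rw [uIcc_of_le ht] at hs
  have hy := (h.memH1 s hs.1).isH1Left
  rw [evalOp_apply, derivCurve, max_eq_left hs.1, integral_congr_leb (coeFn_toL2 hy.memLp) hx]
  exact hy.eq_integral hx

theorem toL2_nrm_op_timeInt (H : Admissible p m) (h : p.IsMildSolution y0 y1 y v) {t : ℝ}
    (ht : 0 ≤ t) : toL2 (p.nrm (p.op (Coeffs.timeInt y t)))
      = toL2 (p.nrm (v t)) - toL2 (p.nrm (v 0)) := by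
  have e := H.toL2_nrm_comb (h.memL2 t ht) (h.memL2 0 le_rfl) 1
  have hc := H.memL2_comb (h.memL2 t ht) (h.memL2 0 le_rfl) 1
  simp only [one_mul, one_smul] at e hc
  rw [← e]
  exact (H.toL2_nrm_congr hc (h.equation t ht)).symm

/-- The normal derivative of `∫₀ᵗ y ds` is continuous in time. -/
theorem continuousOn_trace (H : Admissible p m) (h : p.IsMildSolution y0 y1 y v) :
    ContinuousOn (fun t => derivWithin (Coeffs.timeInt y t) (Icc 0 1) 1) (Ici 0) := by
  obtain ⟨C, hC0, hC⟩ := H.exists_trace_sq_le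
  intro t ht
  refine tendsto_of_norm_sub_sq ?_
  set Φ : ℝ → L2 := fun t => ∫ s in (0 : ℝ)..t, derivCurve y s with hΦ
  have hΦc : Continuous Φ :=
    intervalIntegral.continuous_primitive
      (fun a b => (h.continuous_derivCurve H).intervalIntegrable a b) 0
  have hlim : Tendsto (fun s => C * (‖p.velCurve v s - p.velCurve v t‖ ^ 2
      + ‖zetaOp p.cst (Φ s - Φ t)‖ ^ 2 + ‖Φ s - Φ t‖ ^ 2)) (𝓝[Ici 0] t) (𝓝 0) := by
    have hv := h.continuous_velCurve H
    have h1 : Tendsto (fun s => C * (‖p.velCurve v s - p.velCurve v t‖ ^ 2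
      + ‖zetaOp p.cst (Φ s - Φ t)‖ ^ 2 + ‖Φ s - Φ t‖ ^ 2)) (𝓝 t)
      (𝓝 (C * (‖p.velCurve v t - p.velCurve v t‖ ^ 2
      + ‖zetaOp p.cst (Φ t - Φ t)‖ ^ 2 + ‖Φ t - Φ t‖ ^ 2))) :=
      Continuous.tendsto (by fun_prop) t
    simpa using h1.mono_left nhdsWithin_le_nhds
  refine squeeze_zero' (Eventually.of_forall fun s => sq_nonneg _) ?_ hlim
  filter_upwards [self_mem_nhdsWithin] with s hs
  have hs0 : 0 ≤ s := hs
  have ht0 : 0 ≤ t := ht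
  have hDs := h.memDom s hs
  have hDt := h.memDom t ht
  have h1 := hC _ (H.memDom_comb hDs hDt 1)
  rw [Admissible.derivWithin_comb hDs hDt 1 one_mem_Ioc,
    (H.memDom_comb hDs hDt 1).isH1Left.zetaOp_deriv,
    hDs.isH1Left.toL2_deriv_comb hDt.isH1Left, H.toL2_nrm_op_comb hDs hDt,
    h.toL2_deriv_timeInt H hs, h.toL2_deriv_timeInt H ht, h.toL2_nrm_op_timeInt H hs,
    h.toL2_nrm_op_timeInt H ht, sub_sub_sub_cancel_right, one_smul, one_smul, one_mul] at h1
  rw [Real.norm_eq_abs, sq_abs, Coeffs.velCurve, Coeffs.velCurve, max_eq_left hs0, max_eq_left ht0]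
  exact h1

/-- The mean of `f` over `[t, t + ε]`. -/
def _root_.DegWave.average {E : Type*} [NormedAddCommGroup E] [NormedSpace ℝ E] (ε : ℝ)
    (f : ℝ → E) (t : ℝ) : E := ε⁻¹ • ∫ s in t..t + ε, f s

theorem _root_.DegWave.hasDerivAt_average {E : Type*} [NormedAddCommGroup E] [NormedSpace ℝ E]
    [CompleteSpace E] {f : ℝ → E} (hf : Continuous f) (ε t : ℝ) :
    HasDerivAt (average ε f) (ε⁻¹ • (f (t + ε) - f t)) t := by
  have hd : ∀ t, HasDerivAt (fun t => ∫ s in (0 : ℝ)..t, f s) (f t) t := fun t =>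
    (hf.integral_hasStrictDerivAt 0 t).hasDerivAt
  have h1 := (((hd (t + ε)).comp_add_const t ε).fun_sub (hd t)).fun_const_smul ε⁻¹
  refine h1.congr_of_eventuallyEq (Eventually.of_forall fun s => ?_)
  simp only [average]
  rw [intervalIntegral.integral_interval_sub_left (hf.intervalIntegrable _ _)
    (hf.intervalIntegrable _ _)]

theorem toL2_deriv_average (H : Admissible p m) (h : p.IsMildSolution y0 y1 y v)
    {ε t : ℝ} (hε : 0 < ε) (ht : 0 ≤ t) :
    toL2 (deriv fun x => ε⁻¹ * (Coeffs.timeInt y (t + ε) x - Coeffs.timeInt y t x))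
      = average ε (derivCurve y) t := by
  have hε' : 0 ≤ t + ε := add_nonneg ht hε.le
  have hc := h.continuous_derivCurve H
  rw [(h.memDom _ hε').isH1Left.toL2_deriv_comb (h.memDom t ht).isH1Left,
    h.toL2_deriv_timeInt H hε', h.toL2_deriv_timeInt H ht,
    intervalIntegral.integral_interval_sub_left (hc.intervalIntegrable _ _)
    (hc.intervalIntegrable _ _), average]

theorem toL2_nrm_average (H : Admissible p m) (h : p.IsMildSolution y0 y1 y v)
    {ε t : ℝ} (hε : 0 < ε) (ht : 0 ≤ t) :
    toL2 (p.nrm fun x => ε⁻¹ * (y (t + ε) x - y t x)) = average ε (p.velCurve v) t := by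
  have hε' : 0 ≤ t + ε := add_nonneg ht hε.le
  have hc := h.continuous_velCurve H
  rw [H.toL2_nrm_comb (h.memH1 _ hε').1 (h.memH1 t ht).1, h.toL2_nrm_pos H hε',
    h.toL2_nrm_pos H ht, add_sub_add_left_eq_sub,
    intervalIntegral.integral_interval_sub_left (hc.intervalIntegrable _ _)
    (hc.intervalIntegrable _ _), average]

/-- Averaging a mild solution over time intervals of length `ε` gives a classical solution. -/
theorem classicalSolution_average (H : Admissible p m) (h : p.IsMildSolution y0 y1 y v)
    {ε : ℝ} (hε : 0 < ε) (T : ℝ) :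
    p.ClassicalSolution T
      (fun t x => ε⁻¹ * (Coeffs.timeInt y (t + ε) x - Coeffs.timeInt y t x))
      (fun t x => ε⁻¹ * (y (t + ε) x - y t x)) := by
  have hac := h.continuous_derivCurve H
  have hvc := h.continuous_velCurve H
  have ev : ∀ t ∈ Ioo 0 T, ∀ᶠ s in 𝓝 t, s ∈ Icc 0 T := fun t ht => Icc_mem_nhds ht.1 ht.2
  refine ⟨fun t ht => H.memDom_comb (h.memDom _ (add_nonneg ht.1 hε.le)) (h.memDom t ht.1) _,
    fun t ht => H.memH1_comb (h.memH1 _ (add_nonneg ht.1 hε.le)) (h.memH1 t ht.1) _,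
    ?_, ?_, ?_, ?_, ?_⟩
  · exact ContinuousOn.congr
      (fun t _ => (hasDerivAt_average hac ε t).continuousAt.continuousWithinAt)
      fun t ht => h.toL2_deriv_average H hε ht.1
  · exact ContinuousOn.congr
      (fun t _ => (hasDerivAt_average hvc ε t).continuousAt.continuousWithinAt)
      fun t ht => h.toL2_nrm_average H hε ht.1
  · intro t ht
    have hε' : 0 ≤ t + ε := add_nonneg ht.1.le hε.le
    rw [(h.memH1 _ hε').isH1Left.toL2_deriv_comb (h.memH1 t ht.1.le).isH1Left]
    have := (hasDerivAt_average hac ε t).congr_of_eventuallyEq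
      ((ev t ht).mono fun s hs => h.toL2_deriv_average H hε hs.1)
    rwa [derivCurve, derivCurve, max_eq_left hε', max_eq_left ht.1.le] at this
  · intro t ht
    have hε' : 0 ≤ t + ε := add_nonneg ht.1.le hε.le
    rw [H.toL2_nrm_op_comb (h.memDom _ hε') (h.memDom t ht.1.le), h.toL2_nrm_op_timeInt H hε',
      h.toL2_nrm_op_timeInt H ht.1.le, sub_sub_sub_cancel_right]
    have := (hasDerivAt_average hvc ε t).congr_of_eventuallyEq
      ((ev t ht).mono fun s hs => h.toL2_nrm_average H hε hs.1)
    rwa [Coeffs.velCurve, Coeffs.velCurve, max_eq_left hε', max_eq_left ht.1.le] at this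
  · have hg := h.continuousOn_trace H
    have h1 : ContinuousOn (fun t => derivWithin (Coeffs.timeInt y (t + ε)) (Icc 0 1) 1)
        (Icc 0 T) := hg.comp (f := fun t => t + ε) (by fun_prop)
      fun t ht => add_nonneg ht.1 hε.le
    have h2 : ContinuousOn (fun t => derivWithin (Coeffs.timeInt y t) (Icc 0 1) 1) (Icc 0 T) :=
      hg.mono Icc_subset_Ici_self
    have h3 : ContinuousOn (fun t => ε⁻¹ * (derivWithin (Coeffs.timeInt y (t + ε)) (Icc 0 1) 1
        - derivWithin (Coeffs.timeInt y t) (Icc 0 1) 1)) (Icc 0 T) :=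
      continuousOn_const.mul (h1.sub h2)
    refine h3.congr fun t ht => ?_
    exact Admissible.derivWithin_comb (h.memDom _ (add_nonneg ht.1 hε.le)) (h.memDom t ht.1) _
      one_mem_Ioc

end Coeffs.IsMildSolution

/-! ### Limits of averages -/

/-- The averages of a continuous curve converge uniformly on bounded time intervals. -/
theorem eventually_norm_average_sub_le {E : Type*} [NormedAddCommGroup E] [NormedSpace ℝ E]
    [CompleteSpace E] {f : ℝ → E} (hf : Continuous f) (T : ℝ) {r : ℝ} (hr : 0 < r) :
    ∀ᶠ ε in 𝓝[>] (0 : ℝ), ∀ t ∈ Icc 0 T, ‖average ε f t - f t‖ ≤ r := by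
  have huc := (isCompact_Icc (a := (0 : ℝ)) (b := T + 1)).uniformContinuousOn_of_continuous
    hf.continuousOn
  obtain ⟨δ, hδ, hu⟩ := Metric.uniformContinuousOn_iff_le.1 huc r hr
  filter_upwards [Ioo_mem_nhdsGT (lt_min hδ one_pos)] with ε hε t ht
  have hε0 : 0 < ε := hε.1
  have h1 : ε < δ := hε.2.trans_le (min_le_left _ _)
  have h2 : ε < 1 := hε.2.trans_le (min_le_right _ _)
  have e : average ε f t - f t = ε⁻¹ • ∫ s in t..t + ε, (f s - f t) := by
    rw [intervalIntegral.integral_sub (hf.intervalIntegrable _ _) (by simp),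
      intervalIntegral.integral_const, add_sub_cancel_left, smul_sub, smul_smul,
      inv_mul_cancel₀ hε0.ne', one_smul, average]
  have h3 : ‖∫ s in t..t + ε, (f s - f t)‖ ≤ r * |t + ε - t| := by
    refine intervalIntegral.norm_integral_le_of_norm_le_const fun s hs => ?_
    rw [uIoc_of_le (by linarith)] at hs
    rw [← dist_eq_norm]
    refine hu s ⟨ht.1.trans hs.1.le, by linarith [hs.2, ht.2]⟩ t ⟨ht.1, by linarith [ht.2]⟩ ?_
    rw [Real.dist_eq, abs_of_pos (by linarith [hs.1])]
    linarith [hs.2]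
  rw [e, norm_smul, norm_inv, Real.norm_eq_abs, abs_of_pos hε0, inv_mul_le_iff₀ hε0]
  rwa [add_sub_cancel_left, abs_of_pos hε0, mul_comm] at h3

theorem norm_toLp_sq {μ : Measure ℝ} {f : ℝ → ℝ} (hf : MemLp f 2 μ) :
    ‖hf.toLp f‖ ^ 2 = ∫ x, f x ^ 2 ∂μ := by
  rw [← real_inner_self_eq_norm_sq, L2.inner_def]
  refine integral_congr_ae ?_
  filter_upwards [hf.coeFn_toLp] with x hx
  rw [hx]
  simp [pow_two]

/-- Completeness of `L²`, for a sequence of functions. -/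
theorem exists_limit_of_cauchy {μ : Measure ℝ} [IsFiniteMeasure μ] {f : ℕ → ℝ → ℝ}
    (hf : ∀ n, MemLp (f n) 2 μ)
    (hc : ∀ r > 0, ∃ N, ∀ i ≥ N, ∀ j ≥ N, ∫ x, (f i x - f j x) ^ 2 ∂μ ≤ r) :
    ∃ g, MemLp g 2 μ ∧
      Tendsto (fun n => ∫ x, f n x ^ 2 ∂μ) atTop (𝓝 (∫ x, g x ^ 2 ∂μ)) ∧
      ∀ s, MeasurableSet s → Tendsto (fun n => ∫ x in s, f n x ∂μ) atTop
        (𝓝 (∫ x in s, g x ∂μ)) := by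
  set F : ℕ → Lp ℝ 2 μ := fun n => (hf n).toLp (f n) with hF
  have hcs : CauchySeq F := by
    rw [Metric.cauchySeq_iff]
    intro r hr
    obtain ⟨N, hN⟩ := hc ((r / 2) ^ 2) (by positivity)
    refine ⟨N, fun i hi j hj => ?_⟩
    have h1 : F i - F j = ((hf i).sub (hf j)).toLp _ := (MemLp.toLp_sub _ _).symm
    have h2 : ‖F i - F j‖ ^ 2 ≤ (r / 2) ^ 2 := by
      rw [h1, norm_toLp_sq]
      exact hN i hi j hj
    rw [dist_eq_norm]
    have := abs_le_of_sq_le_sq h2 (by positivity)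
    rw [abs_of_nonneg (norm_nonneg _)] at this
    linarith
  obtain ⟨G, hG⟩ := cauchySeq_tendsto_of_complete hcs
  refine ⟨G, Lp.memLp G, ?_, fun s hs => ?_⟩
  · have h1 := (hG.norm.pow 2)
    have h2 : ‖G‖ ^ 2 = ∫ x, G x ^ 2 ∂μ := by
      rw [← norm_toLp_sq (Lp.memLp G), Lp.toLp_coeFn]
    rw [h2] at h1
    exact h1.congr fun n => norm_toLp_sq (hf n)
  · have h1 : Tendsto (fun n => inner ℝ (indicatorConstLp 2 hs (measure_ne_top μ s) (1 : ℝ)) (F n))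
        atTop (𝓝 (inner ℝ (indicatorConstLp 2 hs (measure_ne_top μ s) (1 : ℝ)) G)) :=
      tendsto_const_nhds.inner hG
    simp only [L2.inner_indicatorConstLp_one] at h1
    refine h1.congr fun n => integral_congr_ae (ae_restrict_of_ae (hf n).coeFn_toLp)

theorem integral_Ioo_restrict {T t : ℝ} (ht : t ∈ Icc 0 T) (f : ℝ → ℝ) :
    ∫ s in Iio t, f s ∂(volume.restrict (Ioo 0 T)) = ∫ s in (0 : ℝ)..t, f s := by
  rw [Measure.restrict_restrict measurableSet_Iio, intervalIntegral.integral_of_le ht.1,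
    integral_Ioc_eq_integral_Ioo]
  congr 2
  ext s
  constructor
  · exact fun h => ⟨h.2.1, h.1⟩
  · exact fun h => ⟨h.2, h.1, h.2.trans_le ht.2⟩

theorem integral_average {f : ℝ → ℝ} (hf : Continuous f) (ε t : ℝ) :
    ∫ s in (0 : ℝ)..t, ε⁻¹ * (f (s + ε) - f s) = average ε f t - average ε f 0 := by
  have hi : ∀ a b : ℝ, IntervalIntegrable f volume a b := fun a b => hf.intervalIntegrable a b
  have hi' : ∀ a b : ℝ, IntervalIntegrable (fun s => f (s + ε)) volume a b := fun a b =>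
    Continuous.intervalIntegrable (by fun_prop) a b
  rw [intervalIntegral.integral_const_mul, intervalIntegral.integral_sub (hi' _ _) (hi _ _),
    intervalIntegral.integral_comp_add_right, average, average, smul_eq_mul, smul_eq_mul,
    ← mul_sub]
  congr 1
  have h1 := intervalIntegral.integral_add_adjacent_intervals (hi 0 (0 + ε)) (hi (0 + ε) (t + ε))
  have h2 := intervalIntegral.integral_add_adjacent_intervals (hi 0 t) (hi t (t + ε))
  linarith

namespace Admissible

variable {p : Coeffs} {m : ℝ}

theorem tendsto_energy (H : Admissible p m) {u z : ℕ → ℝ → ℝ} {u₀ z₀ : ℝ → ℝ}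
    (hu : ∀ n, p.MemH1 (u n)) (hz : ∀ n, p.MemL2 (z n)) (hu₀ : p.MemH1 u₀) (hz₀ : p.MemL2 z₀)
    (h1 : Tendsto (fun n => toL2 (deriv (u n))) atTop (𝓝 (toL2 (deriv u₀))))
    (h2 : Tendsto (fun n => toL2 (p.nrm (z n))) atTop (𝓝 (toL2 (p.nrm z₀)))) :
    Tendsto (fun n => p.energy (u n) (z n)) atTop (𝓝 (p.energy u₀ z₀)) := by
  have hw : ∀ {φ : ℝ → ℝ}, MemLp φ ⊤ leb → ∀ {F : ℕ → L2} {F₀ : L2}, Tendsto F atTop (𝓝 F₀) →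
      Tendsto (fun n => wform φ (F n) (F n)) atTop (𝓝 (wform φ F₀ F₀)) := fun hφ _ _ hF =>
    tendsto_wform (e := fun _ => 0) (Eventually.of_forall fun _ => hφ) hφ
      (Eventually.of_forall fun _ => ae_of_all _ fun x => by simp) tendsto_const_nhds hF hF
  rw [H.energy_eq' hu₀ hz₀]
  refine Tendsto.congr (fun n => (H.energy_eq' (hu n) (hz n)).symm) ?_
  have hone := memLp_top_const' 1
  have t1 := hw hone h2
  have t2 := hw (memLp_top_mul hone H.memLp_eta) (((zetaOp p.cst).continuous.tendsto _).comp h1)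
  have t3 := hw (memLp_top_mul hone H.memLp_kap) ((hardyOp.continuous.tendsto _).comp h1)
  exact ((t1.add t2).add t3).const_mul (1 / 2)

/-- Observability of classical solutions, with an explicit constant. -/
theorem observability_classical (H : Admissible p m) {T : ℝ} {w v : ℝ → ℝ → ℝ}
    (h : p.ClassicalSolution T w v) (hT : 4 * (1 / √(p.a 1)) ≤ p.C6 m * T) (hT0 : 0 ≤ T) :
    (p.C6 m * T - 4 * (1 / √(p.a 1))) * p.energy (w 0) (v 0)
      ≤ 1 / 2 * p.eta 1 * ∫ t in (0 : ℝ)..T, derivWithin (w t) (Icc 0 1) 1 ^ 2 := by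
  rcases le_total 0 (p.energy (w 0) (v 0)) with hE | hE
  · exact H.observability_classical_of_energy_nonneg h hT hE
  · refine (mul_nonpos_of_nonneg_of_nonpos (by linarith) hE).trans ?_
    have := p.eta_pos 1
    exact mul_nonneg (by positivity)
      (intervalIntegral.integral_nonneg hT0 fun t _ => sq_nonneg _)

/-- A mild solution has a normal derivative in `L²(0,T)`, the limit of the normal derivatives of its
averages in time, and inherits their observability estimate. -/
theorem exists_normalDeriv (H : Admissible p m) {y0 y1 : ℝ → ℝ} {y v : ℝ → ℝ → ℝ}
    (h : p.IsMildSolution y0 y1 y v) {T : ℝ} (hT0 : 0 < T)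
    (hT : 4 * (1 / √(p.a 1)) ≤ p.C6 m * T) :
    ∃ q : ℝ → ℝ, Coeffs.IsNormalDeriv y T q ∧
      (p.C6 m * T - 4 * (1 / √(p.a 1))) * p.energy (y 0) (v 0)
        ≤ 1 / 2 * p.eta 1 * ∫ t in Ioo 0 T, q t ^ 2 := by
  have hac := h.continuous_derivCurve H
  have hvc := h.continuous_velCurve H
  set ε : ℕ → ℝ := fun n => 1 / ((n : ℝ) + 1) with hε
  have hε0 : ∀ n, 0 < ε n := fun n => by positivity
  have hεlim : Tendsto ε atTop (𝓝[>] 0) :=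
    tendsto_nhdsWithin_iff.2 ⟨tendsto_one_div_add_atTop_nhds_zero_nat,
      Eventually.of_forall fun n => hε0 n⟩
  set W : ℕ → ℝ → ℝ → ℝ := fun n t x =>
    (ε n)⁻¹ * (Coeffs.timeInt y (t + ε n) x - Coeffs.timeInt y t x) with hW
  set V : ℕ → ℝ → ℝ → ℝ := fun n t x => (ε n)⁻¹ * (y (t + ε n) x - y t x) with hV
  have hsol : ∀ n, p.ClassicalSolution T (W n) (V n) := fun n =>
    h.classicalSolution_average H (hε0 n) T
  set f : ℕ → ℝ → ℝ := fun n t => derivWithin (W n t) (Icc 0 1) 1 with hf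
  have hfc : ∀ n, ContinuousOn (f n) (Icc 0 T) := fun n => (hsol n).continuousOn_trace
  have hfm : ∀ n, MemLp (f n) 2 (volume.restrict (Ioo 0 T)) := fun n => by
    obtain ⟨C, hC⟩ := isCompact_Icc.exists_bound_of_continuousOn (hfc n)
    refine MemLp.of_bound (((hfc n).mono Ioo_subset_Icc_self).aestronglyMeasurable
      measurableSet_Ioo) C ?_
    exact (ae_restrict_mem measurableSet_Ioo).mono fun x hx => hC x ⟨hx.1.le, hx.2.le⟩
  have hIoo : ∀ g : ℝ → ℝ, ∫ t in Ioo 0 T, g t = ∫ t in (0 : ℝ)..T, g t := fun g => by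
    rw [intervalIntegral.integral_of_le hT0.le, integral_Ioc_eq_integral_Ioo]
  obtain ⟨C, hC0, hC⟩ := H.exists_direct hT0.le
  obtain ⟨q, hq, hq2, hqs⟩ := exists_limit_of_cauchy hfm (by
    intro r hr
    -- two means that are `s`-close to their limit differ by `2 * s`, and the squared norms of the
    -- velocity and of the space derivative contribute `4 * s ^ 2` each
    set s := √(r / (8 * (C + 1))) with hs
    have hs0 : 0 < s := Real.sqrt_pos.2 (by positivity)
    have hs2 : s ^ 2 = r / (8 * (C + 1)) := Real.sq_sqrt (by positivity)
    obtain ⟨N, hN⟩ := eventually_atTop.1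
      ((hεlim.eventually (eventually_norm_average_sub_le hac T hs0)).and
        (hεlim.eventually (eventually_norm_average_sub_le hvc T hs0)))
    refine ⟨N, fun i hi j hj => ?_⟩
    have hd := hC _ _ (8 * s ^ 2) (H.classicalSolution_comb (hsol i) (hsol j) 1) (by
      intro t ht
      rw [((hsol i).memDom t ht).isH1Left.toL2_deriv_comb ((hsol j).memDom t ht).isH1Left,
        H.toL2_nrm_comb ((hsol i).memH1 t ht).1 ((hsol j).memH1 t ht).1, one_smul, one_smul,
        h.toL2_deriv_average H (hε0 i) ht.1, h.toL2_deriv_average H (hε0 j) ht.1,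
        h.toL2_nrm_average H (hε0 i) ht.1, h.toL2_nrm_average H (hε0 j) ht.1]
      have tri : ∀ g : ℝ → L2, ‖average (ε i) g t - g t‖ ≤ s → ‖average (ε j) g t - g t‖ ≤ s →
          ‖average (ε i) g t - average (ε j) g t‖ ^ 2 ≤ 4 * s ^ 2 := fun g h1 h2 => by
        have h3 : ‖average (ε i) g t - average (ε j) g t‖ ≤ 2 * s := by
          rw [← sub_sub_sub_cancel_right _ _ (g t)]
          exact (norm_sub_le _ _).trans (by linarith)
        calc _ ≤ (2 * s) ^ 2 := pow_le_pow_left₀ (norm_nonneg _) h3 2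
          _ = _ := by ring
      have h1 := tri _ ((hN i hi).1 t ht) ((hN j hj).1 t ht)
      have h2 := tri _ ((hN i hi).2 t ht) ((hN j hj).2 t ht)
      linarith)
    rw [hIoo]
    refine le_trans (le_of_eq ?_) (hd.trans ?_)
    · refine intervalIntegral.integral_congr fun t ht => ?_
      rw [uIcc_of_le hT0.le] at ht
      rw [derivWithin_comb ((hsol i).memDom t ht) ((hsol j).memDom t ht) 1 one_mem_Ioc, one_mul]
    · rw [hs2, show C * (8 * (r / (8 * (C + 1)))) = C / (C + 1) * r by field_simp]
      exact mul_le_of_le_one_left hr.le (by rw [div_le_one (by positivity)]; linarith))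
  refine ⟨q, ⟨hq, fun t ht => ?_⟩, ?_⟩
  · set g : ℝ → ℝ := fun t => derivWithin (Coeffs.timeInt y (max t 0)) (Icc 0 1) 1 with hg
    have hgc : Continuous g := (h.continuousOn_trace H).comp_continuous (by fun_prop)
      fun _ => mem_Ici.2 (le_max_right _ _)
    have hav : ∀ s ∈ Icc 0 T, Tendsto (fun n => average (ε n) g s) atTop (𝓝 (g s)) := by
      intro s hs
      rw [tendsto_iff_norm_sub_tendsto_zero, Metric.tendsto_nhds]
      intro r hr
      filter_upwards [hεlim.eventually (eventually_norm_average_sub_le hgc T (half_pos hr))]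
        with n hn
      rw [Real.dist_eq, sub_zero, abs_of_nonneg (norm_nonneg _)]
      linarith [hn s hs]
    have h0 : g 0 = 0 := by
      have : Coeffs.timeInt y 0 = fun _ => 0 := by
        ext x; simp [Coeffs.timeInt]
      simp only [hg, max_self, this]
      simp
    have h1 := hqs (Iio t) measurableSet_Iio
    rw [integral_Ioo_restrict ht] at h1
    have h2 := (hav t ht).sub (hav 0 ⟨le_rfl, hT0.le⟩)
    rw [h0, sub_zero] at h2
    have h3 := tendsto_nhds_unique (h2.congr fun n => ?_) h1
    · rw [← h3, hg]
      simp only [max_eq_left ht.1]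
    · rw [integral_Ioo_restrict ht, ← integral_average hgc]
      refine intervalIntegral.integral_congr fun s hs => ?_
      rw [uIcc_of_le ht.1] at hs
      have hs0 : 0 ≤ s + ε n := add_nonneg hs.1 (hε0 n).le
      simp only [hg, max_eq_left hs.1, max_eq_left hs0]
      exact (derivWithin_comb (h.memDom _ hs0) (h.memDom s hs.1) _ one_mem_Ioc).symm
  · have hav : ∀ k : ℝ → L2, Continuous k → Tendsto (fun n => average (ε n) k 0) atTop
        (𝓝 (k 0)) := by
      intro k hk
      rw [tendsto_iff_norm_sub_tendsto_zero, Metric.tendsto_nhds]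
      intro r hr
      filter_upwards [hεlim.eventually (eventually_norm_average_sub_le hk T (half_pos hr))]
        with n hn
      rw [Real.dist_eq, sub_zero, abs_of_nonneg (norm_nonneg _)]
      linarith [hn 0 ⟨le_rfl, hT0.le⟩]
    have h0 : (0 : ℝ) ∈ Icc 0 T := ⟨le_rfl, hT0.le⟩
    have h1 := hav _ hac
    have h2 := hav _ hvc
    simp only [derivCurve, Coeffs.velCurve, max_self] at h1 h2
    have hE := H.tendsto_energy (fun n => ((hsol n).memDom 0 h0).1)
      (fun n => ((hsol n).memH1 0 h0).1)
      (h.memH1 0 le_rfl) (h.memL2 0 le_rfl)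
      (h1.congr fun n => (h.toL2_deriv_average H (hε0 n) le_rfl).symm)
      (h2.congr fun n => (h.toL2_nrm_average H (hε0 n) le_rfl).symm)
    refine le_of_tendsto_of_tendsto (hE.const_mul _) (hq2.const_mul _)
      (Eventually.of_forall fun n => ?_)
    beta_reduce
    rw [hIoo]
    exact H.observability_classical (hsol n) hT hT0.le

end Admissible

/-- The multiplier method needs only `4 / √a(1)` in place of `C₅`. -/
theorem Admissible.le_C5 {p : Coeffs} {m : ℝ} (H : Admissible p m) :
    4 * (1 / √(p.a 1)) ≤ p.C5 := by
  have ha : 0 < p.a 1 := H.a_deg.pos 1 one_mem_Ioc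
  have h1 : 1 / √(p.a 1) ≤ max (1 / p.a 1) 1 := by
    rcases le_total 1 (p.a 1) with h | h
    · refine le_max_of_le_right ?_
      rw [div_le_one (Real.sqrt_pos.2 ha)]
      exact Real.one_le_sqrt.2 h
    · refine le_max_of_le_left (one_div_le_one_div_of_le ha ?_)
      refine Real.le_sqrt_of_sq_le ?_
      nlinarith
  have h2 : 0 ≤ degConst p.a * max 1 (p.hardyConst * sSup (p.d '' Icc 0 1)) :=
    mul_nonneg H.a_deg.deg_pos.le (zero_le_one.trans (le_max_left _ _))
  unfold Coeffs.C5
  linarith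

end DegWave

end

theorem mainTheorem3 (p : DegWave.Coeffs) (m : ℝ)
    (hyp : (p.HypLow ∧ m = p.M) ∨ (p.HypHigh ∧ m = p.Minf))
    (hlam : 0 ≤ p.lam)
    (hK : DegWave.degConst p.a + 2 * DegWave.degConst p.d ≤ 2 - 2 * m)
    (T : ℝ) (hT : p.C5 / p.C6 m < T) :
    p.Observable T ∧
      (((p.C6 m * T - p.C5) / p.eta 1 : ℝ) : EReal) ≤ p.obsSup T := by
  have H := DegWave.admissible_of_hyp hyp hlam hK
  have hC6 := H.C6_pos
  have hC5 := H.le_C5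
  have hη := p.eta_pos 1
  have hκ : 0 < 1 / √(p.a 1) :=
    one_div_pos.2 (Real.sqrt_pos.2 (H.a_deg.pos 1 DegWave.one_mem_Ioc))
  rw [div_lt_iff₀ hC6, mul_comm] at hT
  have hT0 : 0 < T := by
    have : 0 < p.C6 m * T := by linarith
    exact (mul_pos_iff_of_pos_left hC6).1 this
  have hobs : p.IsObsConst T ((p.C6 m * T - p.C5) / p.eta 1) := by
    refine ⟨div_pos (by linarith) hη, fun y0 y1 _ _ y v h => ?_⟩
    obtain ⟨q, hq, hE⟩ := H.exists_normalDeriv h hT0 (by linarith)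
    refine ⟨q, hq, ?_⟩
    rw [div_mul_eq_mul_div, div_le_iff₀ hη]
    have hq0 : 0 ≤ ∫ t in Ioo 0 T, q t ^ 2 := integral_nonneg fun t => sq_nonneg _
    rcases le_total 0 (p.energy (y 0) (v 0)) with h0 | h0
    · have h1 : (p.C6 m * T - p.C5) * p.energy (y 0) (v 0)
          ≤ 2 * (p.C6 m * T - 4 * (1 / √(p.a 1))) * p.energy (y 0) (v 0) :=
        mul_le_mul_of_nonneg_right (by linarith) h0
      linarith
    · exact (mul_nonpos_of_nonneg_of_nonpos (by linarith) h0).trans (mul_nonneg hq0 hη.le)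
  exact ⟨⟨_, hobs⟩, le_sSup ⟨_, hobs, rfl⟩⟩
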